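/- Let $\overline G$ be a Lie group with Lie algebra $\overline{\mathfrak g}$, let $\overline H\subset\overline G$ be a closed subgroup, and let $\overline M=\overline G/\overline H$ be the homogeneous manifold with base point $o=e\overline H$. Write $L_g$ for left translation by $g$ on $\overline M$, and $X^*_p=\frac{d}{dt}\big|_{t=0}\exp(tX)\cdot p$ for the fundamental vector fields. Let $G\subset\overline G$ be a Lie subgroup with Lie algebra $\mathfrak g$, let $H=G\cap\overline H$ with Lie algebra $\mathfrak h$, and suppose that the orbit $M=G\cdot o=G/H$ is a closed embedded submanifold of $\overline M$. Let $\mathfrak m\subset\mathfrak g$ be an $\mathrm{Ad}(H)$-invariant subspace with $\mathfrak g=\mathfrak h\oplus\mathfrak m$ (a reductive decomposition). Then the left-invariant distribution on $G$ generated by $\mathfrak m$ is a principal connection on the principal $H$-bundle $\pi\colon G\to G/H=M$, and $[g,v]\mapsto (L_g)_*v$ is a well-defined bijection, linear on fibres and induced by a smooth map on $G\times T_o\overline M$, from the associated bundle $G\times_H T_o\overline M$ onto $E=T\overline M|_M$. Let $D$ be the linear connection on $E$ induced by this principal connection (the canonical $G$-connection): for a section $s$ of $E$, $g\in G$ and $v\in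 T_{\pi(g)}M$, $$D_v s=(L_g)_*\,df_s(\tilde v),\qquad f_s\colon G\to T_o\overline M,\quad f_s(g)=(L_g)_*^{-1}s(\pi(g)),$$ where $\tilde v$ is the horizontal lift of $v$ at $g$. This does not depend on the choice of $g$ over $\pi(g)$, and $D$ is a smooth linear connection on $E$. It is a $G$-connection: for every piecewise smooth curve $c\colon[a,b]\to M$ there is $g\in G$ with $g\cdot c(a)=c(b)$ such that the $D$-parallel transport along $c$ is $(L_g)_*\colon T_{c(a)}\overline M\to T_{c(b)}\overline M$. At $o$ it satisfies $$(D_{X^*}B^*)_o=-[X,B]^*_o\qquad\text{for all }X\in\mathfrak m,\ B\in\overline{\mathfrak g},$$ and it is characterized at $o$ by this condition: if $D'$ is a linear connection on $E$ with $(D'_{X^*}B^*)_o=-[X,B]^*_o$ for all $X\in\mathfrak m$ and $B\in\overline{\mathfrak g}$, then $(D's)_o=(Ds)_o$ for every section $s$ of $E$ that is differentiable at $o$. -/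

import Mathlib

open scoped Manifold ContDiff
open Bundle

noncomputable section

namespace ReductiveOrbit

section LieTheory

variable {E : Type*} [NormedAddCommGroup E] [NormedSpace ℝ E]
  {G : Type*} [TopologicalSpace G] [ChartedSpace E G] [Group G]

/-- The adjoint representation `Ad g` on the Lie algebra: the differential at `1` of the
conjugation `x ↦ g x g⁻¹`. -/
def Ad (g : G) : GroupLieAlgebra 𝓘(ℝ, E) G →L[ℝ] GroupLieAlgebra 𝓘(ℝ, E) G :=
  mfderiv 𝓘(ℝ, E) 𝓘(ℝ, E) (fun x : G => g * x * g⁻¹) 1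

/-- `X` is the velocity at time `0` of a curve in the group, smooth near time `0`, that passes
through `1` at time `0` and stays in the subgroup `K`. -/
def IsVelocityIn (K : Subgroup G) (X : GroupLieAlgebra 𝓘(ℝ, E) G) : Prop :=
  ∃ γ : ℝ → G, γ 0 = 1 ∧ (∀ t, γ t ∈ K) ∧ ContMDiffAt 𝓘(ℝ, ℝ) 𝓘(ℝ, E) ∞ γ 0 ∧
    (mfderiv 𝓘(ℝ, ℝ) 𝓘(ℝ, E) γ 0 : ℝ →L[ℝ] E) 1 = X

/-- A direct sum decomposition `𝔤 = 𝔨 + 𝔪`, where `𝔨` is the Lie algebra of the (closed)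
subgroup `K`, that is, the space of velocities at `1` of curves in `K`, and where the subspace `𝔪`
is `Ad K`-invariant. -/
structure IsReductiveDecomposition (K : Subgroup G)
    (m : Submodule ℝ (GroupLieAlgebra 𝓘(ℝ, E) G)) : Prop where
  decomposition : ∃ k : Submodule ℝ (GroupLieAlgebra 𝓘(ℝ, E) G),
    (∀ X, X ∈ k ↔ IsVelocityIn K X) ∧ IsCompl k m
  ad_invariant : ∀ h ∈ K, ∀ X ∈ m, Ad h X ∈ m

/-- The left-invariant distribution on the group generated by a subspace of the Lie algebra. -/
def leftInvariantDistribution (m : Submodule ℝ (GroupLieAlgebra 𝓘(ℝ, E) G)) (g : G) :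
    Submodule ℝ (TangentSpace 𝓘(ℝ, E) g) :=
  m.map (mfderiv 𝓘(ℝ, E) 𝓘(ℝ, E) (fun x : G => g * x) 1 : E →L[ℝ] E).toLinearMap

/-- The fundamental vector field `X*` of an action of a Lie group on `M`: its value at `p` is
`d/dt (exp (t X) • p)` at `t = 0`, i.e. the image of `X` under the differential at `1` of the orbit
map `g ↦ g • p`. -/
def fundamentalField (F : Type*) [NormedAddCommGroup F] [NormedSpace ℝ F]
    {M : Type*} [TopologicalSpace M] [ChartedSpace F M] [MulAction G M]
    (X : GroupLieAlgebra 𝓘(ℝ, E) G) (p : M) : TangentSpace 𝓘(ℝ, F) p :=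
  (mfderiv 𝓘(ℝ, E) 𝓘(ℝ, F) (fun g : G => g • p) 1 : E →L[ℝ] F) X

/-- The differential of the projection `G → G ⧸ K` at `g`. -/
def projDeriv (F : Type*) [NormedAddCommGroup F] [NormedSpace ℝ F]
    (K : Subgroup G) [ChartedSpace F (G ⧸ K)] (g : G) :
    TangentSpace 𝓘(ℝ, E) g →L[ℝ] TangentSpace 𝓘(ℝ, F) (g : G ⧸ K) :=
  mfderiv 𝓘(ℝ, E) 𝓘(ℝ, F) (fun x : G => (x : G ⧸ K)) g

/-- A principal connection on the principal `K`-bundle `G → G ⧸ K`: a smooth distribution on `G`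
that is complementary to the vertical distribution and invariant under right translation
by elements of `K`. -/
structure IsPrincipalConnection [IsManifold 𝓘(ℝ, E) 1 G]
    (F : Type*) [NormedAddCommGroup F] [NormedSpace ℝ F] (K : Subgroup G) [ChartedSpace F (G ⧸ K)]
    (hor : ∀ g : G, Submodule ℝ (TangentSpace 𝓘(ℝ, E) g)) : Prop where
  smooth : ∀ g : G, ∃ (r : ℕ) (X : Fin r → ∀ x : G, TangentSpace 𝓘(ℝ, E) x),
    (∀ i, ContMDiffAt 𝓘(ℝ, E) (𝓘(ℝ, E).prod 𝓘(ℝ, E)) ∞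
      (fun x => (⟨x, X i x⟩ : TangentBundle 𝓘(ℝ, E) G)) g) ∧
    ∀ᶠ x in nhds g, LinearIndependent ℝ (fun i => X i x) ∧
      hor x = Submodule.span ℝ (Set.range fun i => X i x)
  isCompl_vertical : ∀ g : G, IsCompl (projDeriv (E := E) F K g).ker (hor g)
  right_invariant : ∀ g : G, ∀ h ∈ K, ∀ w ∈ hor g,
    mfderiv 𝓘(ℝ, E) 𝓘(ℝ, E) (fun x : G => x * h) g w ∈ hor (g * h)

/-- The horizontal lift at `g` of tangent vectors of `G ⧸ K` at `g K`: the inverse of the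
restriction of the differential of the projection to the horizontal space. -/
def horizontalLift {F : Type*} [NormedAddCommGroup F] [NormedSpace ℝ F]
    (K : Subgroup G) [ChartedSpace F (G ⧸ K)]
    (hor : ∀ g : G, Submodule ℝ (TangentSpace 𝓘(ℝ, E) g)) (g : G) :
    TangentSpace 𝓘(ℝ, F) (g : G ⧸ K) →L[ℝ] TangentSpace 𝓘(ℝ, E) g :=
  (hor g).subtypeL ∘L ((projDeriv F K g) ∘L (hor g).subtypeL).inverse

end LieTheory

section ParallelTransport

variable {E : Type*} [NormedAddCommGroup E] [NormedSpace ℝ E]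
  {M : Type*} [TopologicalSpace M] [ChartedSpace E M]
  (F : Type*) [NormedAddCommGroup F] [NormedSpace ℝ F]
  {V : M → Type*} [TopologicalSpace (TotalSpace F V)]
  [∀ x, AddCommGroup (V x)] [∀ x, Module ℝ (V x)]
  [∀ x : M, TopologicalSpace (V x)] [FiberBundle F V]

/-- The field `S` along the curve `c` is parallel on the interval `J` for the covariant
derivative `D`: its covariant derivative along `c`, which at `t₀` is the sum of
`D_{c'(t₀)} s` and the derivative of `S - s ∘ c` for any section `s` with `s (c t₀) = S t₀`,
vanishes. As `S - s ∘ c` vanishes at `t₀`, its derivative there may be read in any trivialization. -/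
def IsParallelOn
    (D : (∀ x : M, V x) → ∀ x : M, TangentSpace 𝓘(ℝ, E) x →L[ℝ] V x)
    (c : ℝ → M) (J : Set ℝ) (S : ∀ t : ℝ, V (c t)) : Prop :=
  ∀ t₀ ∈ J, ∀ s : ∀ x : M, V x,
    MDifferentiableAt 𝓘(ℝ, E) (𝓘(ℝ, E).prod 𝓘(ℝ, F)) (fun x => (⟨x, s x⟩ : TotalSpace F V))
      (c t₀) →
    s (c t₀) = S t₀ →
    HasDerivWithinAt
      (fun t => (trivializationAt F V (c t₀) (⟨c t, S t - s (c t)⟩ : TotalSpace F V)).2)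
      (-(trivializationAt F V (c t₀)
        (⟨c t₀, D s (c t₀) ((mfderivWithin 𝓘(ℝ, ℝ) 𝓘(ℝ, E) c J t₀ : ℝ →L[ℝ] E) 1)⟩ :
          TotalSpace F V)).2) J t₀

/-- `c` is a piecewise smooth curve on `[t 0, t n]`, smooth on the intervals `[t i, t (i + 1)]`. -/
def IsPiecewiseSmooth (c : ℝ → M) (n : ℕ) (t : ℕ → ℝ) : Prop :=
  ∀ i < n, t i ≤ t (i + 1) ∧
    ContMDiffOn 𝓘(ℝ, ℝ) 𝓘(ℝ, E) ∞ c (Set.Icc (t i) (t (i + 1)))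

/-- `τ` is the `D`-parallel transport along the piecewise smooth curve `c` on `[t 0, t n]`. -/
def IsParallelTransport
    (D : (∀ x : M, V x) → ∀ x : M, TangentSpace 𝓘(ℝ, E) x →L[ℝ] V x)
    (c : ℝ → M) (n : ℕ) (t : ℕ → ℝ) (τ : V (c (t 0)) → V (c (t n))) : Prop :=
  (∀ v : V (c (t 0)), ∃ S : ∀ r : ℝ, V (c r), S (t 0) = v ∧
    ∀ i < n, IsParallelOn F D c (Set.Icc (t i) (t (i + 1))) S) ∧
  ∀ S : ∀ r : ℝ, V (c r),
    (∀ i < n, IsParallelOn F D c (Set.Icc (t i) (t (i + 1))) S) → S (t n) = τ (S (t 0))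

end ParallelTransport

/-- The fibres of a pulled back vector bundle are additive groups. -/
instance pullbackAddCommGroup {B B' : Type*} (f : B' → B) (V : B → Type*)
    [∀ x, AddCommGroup (V x)] (x : B') : AddCommGroup ((f *ᵖ V) x) :=
  inferInstanceAs (AddCommGroup (V (f x)))

instance pullbackIsTopologicalAddGroup {B B' : Type*} (f : B' → B) (V : B → Type*)
    [∀ x, AddCommGroup (V x)] [∀ x, TopologicalSpace (V x)] [∀ x, IsTopologicalAddGroup (V x)]
    (x : B') : IsTopologicalAddGroup ((f *ᵖ V) x) :=
  inferInstanceAs (IsTopologicalAddGroup (V (f x)))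

instance pullbackContinuousSMul {B B' : Type*} (f : B' → B) (V : B → Type*)
    [∀ x, AddCommGroup (V x)] [∀ x, Module ℝ (V x)] [∀ x, TopologicalSpace (V x)]
    [∀ x, ContinuousSMul ℝ (V x)] (x : B') : ContinuousSMul ℝ ((f *ᵖ V) x) :=
  inferInstanceAs (ContinuousSMul ℝ (V (f x)))

section Orbit

variable {EGb : Type*} [NormedAddCommGroup EGb] [NormedSpace ℝ EGb]
  {Gb : Type*} [TopologicalSpace Gb] [ChartedSpace EGb Gb] [Group Gb]
  {EG : Type*} [NormedAddCommGroup EG] [NormedSpace ℝ EG]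
  {G : Type*} [TopologicalSpace G] [ChartedSpace EG G] [Group G]
  {FMb : Type*} [NormedAddCommGroup FMb] [NormedSpace ℝ FMb]
  {FM : Type*} [NormedAddCommGroup FM] [NormedSpace ℝ FM]

/-- For a group homomorphism `ι : G → Gb` (the inclusion of a Lie subgroup) and `Hb ⊆ Gb`, the
map `G ⧸ (G ∩ Hb) → Gb ⧸ Hb`, whose image is the orbit `G • o` of the base point. -/
def orbitMap (ι : G →* Gb) (Hb : Subgroup Gb) : G ⧸ Hb.comap ι → Gb ⧸ Hb :=
  Quotient.lift (fun g : G => (ι g : Gb ⧸ Hb)) fun a b hab => by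
    have h : a⁻¹ * b ∈ Hb.comap ι := QuotientGroup.leftRel_apply.mp hab
    exact QuotientGroup.eq.mpr (by simpa using h)

/-- The orbit map as a smooth map. -/
def orbitInclusion {ι : G →* Gb} {Hb : Subgroup Gb}
    [ChartedSpace FMb (Gb ⧸ Hb)] [ChartedSpace FM (G ⧸ Hb.comap ι)]
    (hj : Manifold.IsSmoothEmbedding 𝓘(ℝ, FM) 𝓘(ℝ, FMb) ∞ (orbitMap ι Hb)) :
    ContMDiffMap 𝓘(ℝ, FM) 𝓘(ℝ, FMb) (G ⧸ Hb.comap ι) (Gb ⧸ Hb) ∞ :=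
  ⟨orbitMap ι Hb, hj.contMDiff⟩

/-- The inclusion of the Lie algebra of `G` into that of `Gb`: the differential of `ι` at `1`. -/
def lieInclusion (ι : G →* Gb) (X : GroupLieAlgebra 𝓘(ℝ, EG) G) : GroupLieAlgebra 𝓘(ℝ, EGb) Gb :=
  (mfderiv 𝓘(ℝ, EG) 𝓘(ℝ, EGb) ι 1 : EG →L[ℝ] EGb) X

variable {ι : G →* Gb} {Hb : Subgroup Gb}
  [ChartedSpace FMb (Gb ⧸ Hb)] [ChartedSpace FM (G ⧸ Hb.comap ι)]
  (hj : Manifold.IsSmoothEmbedding 𝓘(ℝ, FM) 𝓘(ℝ, FMb) ∞ (orbitMap ι Hb))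

/-- The vector bundle `T(Gb ⧸ Hb)|_M` over the orbit `M = G ⧸ (G ∩ Hb)`. -/
abbrev AmbientTangent : G ⧸ Hb.comap ι → Type _ :=
  (orbitInclusion hj) *ᵖ (TangentSpace 𝓘(ℝ, FMb) : Gb ⧸ Hb → Type _)

/-- The restriction to the orbit of the fundamental vector field `B*`, `B` in the Lie algebra
of `Gb`. -/
def restrictedField (B : GroupLieAlgebra 𝓘(ℝ, EGb) Gb) (x : G ⧸ Hb.comap ι) :
    AmbientTangent hj x :=
  fundamentalField FMb B (orbitInclusion hj x)

/-- The differential of the left translation by `g : G` on the ambient space, restricted to the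
fibres of `T(Gb ⧸ Hb)|_M` over `x` and over `y`, for `y = g • x`. -/
def translate (g : G) (x y : G ⧸ Hb.comap ι) :
    AmbientTangent hj x →L[ℝ] AmbientTangent hj y :=
  (mfderiv 𝓘(ℝ, FMb) 𝓘(ℝ, FMb) (fun p : Gb ⧸ Hb => ι g • p) (orbitInclusion hj x) :
    FMb →L[ℝ] FMb)

/-- Two elements of `G × T_o(Gb ⧸ Hb)` define the same element of the vector bundle associated to
`G → G ⧸ H`, `H = G ∩ Hb`, and to the isotropy representation of `H` on `T_o(Gb ⧸ Hb)`:
`(g h, v) ∼ (g, (L_h)_* v)`. -/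
def AssociatedRel (a b : G × AmbientTangent hj ((1 : G) : G ⧸ Hb.comap ι)) : Prop :=
  ∃ h ∈ Hb.comap ι, a.1 = b.1 * h ∧
    b.2 = translate hj h ((1 : G) : G ⧸ Hb.comap ι) ((1 : G) : G ⧸ Hb.comap ι) a.2

/-- The associated vector bundle `G ×_H T_o(Gb ⧸ Hb)`. -/
def AssociatedBundle : Type _ := Quot (AssociatedRel hj)

/-- The map `G × T_o(Gb ⧸ Hb) → T(Gb ⧸ Hb)|_M`, `(g, v) ↦ (L_g)_* v`, that induces the
identification of the associated bundle with `T(Gb ⧸ Hb)|_M`. -/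
def frameMap (a : G × FMb) : TotalSpace FMb (AmbientTangent hj) :=
  ⟨(a.1 : G ⧸ Hb.comap ι),
    translate hj a.1 ((1 : G) : G ⧸ Hb.comap ι) (a.1 : G ⧸ Hb.comap ι) a.2⟩

/-- The `H`-equivariant function `f : G → T_o(Gb ⧸ Hb)` that corresponds to a section `s` of the
associated bundle `T(Gb ⧸ Hb)|_M`: `f g = (L_g)_*⁻¹ (s (g H))`, i.e. `s (g H) = [g, f g]`. -/
def equivariantFunction (s : ∀ x : G ⧸ Hb.comap ι, AmbientTangent hj x) (g : G) : FMb :=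
  translate hj g⁻¹ (g : G ⧸ Hb.comap ι) ((1 : G) : G ⧸ Hb.comap ι) (s (g : G ⧸ Hb.comap ι))

/-- The value `[g, df (v^hor)]` at `v ∈ T_{gH} M` of the covariant derivative of a section `s`,
computed at the point `g` of the principal bundle: differentiate the equivariant function `f` of `s`
along the horizontal lift of `v` at `g`. -/
def inducedDerivAt (hor : ∀ g : G, Submodule ℝ (TangentSpace 𝓘(ℝ, EG) g))
    (s : ∀ x : G ⧸ Hb.comap ι, AmbientTangent hj x) (g : G) :
    TangentSpace 𝓘(ℝ, FM) (g : G ⧸ Hb.comap ι) →L[ℝ] AmbientTangent hj (g : G ⧸ Hb.comap ι) :=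
  translate hj g ((1 : G) : G ⧸ Hb.comap ι) (g : G ⧸ Hb.comap ι) ∘L
    (mfderiv 𝓘(ℝ, EG) 𝓘(ℝ, FMb) (equivariantFunction hj s) g :
      TangentSpace 𝓘(ℝ, EG) g →L[ℝ] FMb) ∘L
    horizontalLift (Hb.comap ι) hor g

/-- The linear connection on the associated bundle `T(Gb ⧸ Hb)|_M` induced by the principal
connection `hor`. At `x` it is computed at some point of the principal bundle over `x`. -/
def inducedConnection (hor : ∀ g : G, Submodule ℝ (TangentSpace 𝓘(ℝ, EG) g))
    (s : ∀ x : G ⧸ Hb.comap ι, AmbientTangent hj x) (x : G ⧸ Hb.comap ι) :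
    TangentSpace 𝓘(ℝ, FM) x →L[ℝ] AmbientTangent hj x :=
  Quotient.out_eq x ▸ inducedDerivAt hj hor s (Quotient.out x)

/-- The canonical connection on `T(Gb ⧸ Hb)|_M` of the reductive orbit `M`: the linear connection
induced by the principal connection given by the left-invariant distribution `m`. -/
def canonicalConnection (m : Submodule ℝ (GroupLieAlgebra 𝓘(ℝ, EG) G))
    (s : ∀ x : G ⧸ Hb.comap ι, AmbientTangent hj x) (x : G ⧸ Hb.comap ι) :
    TangentSpace 𝓘(ℝ, FM) x →L[ℝ] AmbientTangent hj x :=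
  inducedConnection hj (leftInvariantDistribution m) s x

/-- `D` is a `G`-connection: along every piecewise smooth curve in `M`, the `D`-parallel transport
is the differential of the left translation by some element of `G`. -/
def IsGConnection [IsManifold 𝓘(ℝ, FMb) 1 (Gb ⧸ Hb)]
    (D : (∀ x : G ⧸ Hb.comap ι, AmbientTangent hj x) →
      ∀ x : G ⧸ Hb.comap ι, TangentSpace 𝓘(ℝ, FM) x →L[ℝ] AmbientTangent hj x) : Prop :=
  ∀ (c : ℝ → G ⧸ Hb.comap ι) (n : ℕ) (t : ℕ → ℝ), IsPiecewiseSmooth (E := FM) c n t →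
    ∃ g : G, g • c (t 0) = c (t n) ∧
      IsParallelTransport FMb D c n t (translate hj g (c (t 0)) (c (t n)))

end Orbit

end ReductiveOrbit

end

open ReductiveOrbit

set_option linter.unusedSectionVars false

namespace ReductiveOrbit

section

open Filter Set
open scoped Topology

/-! ### Local sections and fibre curves of submersions -/

section Submersion

variable {E : Type*} [NormedAddCommGroup E] [NormedSpace ℝ E]
  {N : Type*} [TopologicalSpace N] [ChartedSpace E N]
  {F : Type*} [NormedAddCommGroup F] [NormedSpace ℝ F]
  {M : Type*} [TopologicalSpace M] [ChartedSpace F M]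
  {f : N → M} {x : N}

/-! Left translations trivialize everything in sight. The maps `(L_g)_*` identify the pullback of
`E` to `G` with `G × T_o`, where `T_o` is the tangent space of the ambient homogeneous space at the
base point. A section `s` becomes the function `f_s` on `G`, with `f_s (g h) = (L_h)_*⁻¹ (f_s g)`
for `h ∈ H`. All tangent spaces are copies of the model space, so derivatives are treated as linear
maps of model spaces (`modelDeriv`, `dLeft`, `dAct`). Equalities of base points such as `g * 1 = g`
then require no transport of vectors.

Principal connection: by the local form of a submersion, the velocities at `1` of curves in `H` are
exactly the kernel of `dπ` at `1` (`isVelocityIn_iff`). Left translation carries this kernel and its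
complement `m` to every `g` (`ker_modelDeriv_proj`). The relation `R_h ∘ L_g = L_{gh} ∘ Ad h⁻¹` on
tangent vectors at `1` turns `Ad H`-invariance of `m` into right invariance.

Induced connection: horizontal lifts at `g h` are right translates of those at `g`, and the
equivariance of `f_s` cancels the remaining factor `h` (`modelInducedDeriv_mul`). The representative
`g` may therefore be chosen by a smooth local section of `π`, which gives smoothness.

Parallel transport: along a horizontal lift `γ` of `c`, a field `S` is parallel if and only if
`(L_γ)_*⁻¹ S` is constant (`isParallelOn_iff_of_lift`). Transport from `p` to `q` is thus the
translation by `γ q * (γ p)⁻¹`. Lifts exist locally by Picard–Lindelöf (`exists_isHorizontalLift`),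
and compactness of the interval together with composition of translations does the rest.

At the base point: `f_{B*} g = dπ_1 (Ad g⁻¹ B)`, and the derivative of `g ↦ Ad g⁻¹ B` at `1` along
`X` is `-[X, B]` (`modelDeriv_modelAd_inv`), proved by comparing mixed second derivatives of the
product in a chart. For uniqueness, the difference of two linear connections is tensorial, the
vectors `B*_o` exhaust `T_o`, and the vectors `X*_o` with `X ∈ m` exhaust the tangent space of the
orbit. -/

theorem isSubmersionAt_of_isSubmersion (hf : Manifold.IsSubmersion 𝓘(ℝ, E) 𝓘(ℝ, F) ∞ f) (x : N) :
    Manifold.IsSubmersionAt 𝓘(ℝ, E) 𝓘(ℝ, F) ∞ f x := by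
  obtain ⟨C, i1, i2, h⟩ := hf
  exact ⟨C, i1, i2, h x⟩

/-- A submersion has smooth local sections. -/
theorem exists_local_section (hf : Manifold.IsSubmersionAt 𝓘(ℝ, E) 𝓘(ℝ, F) ∞ f x) :
    ∃ σ : M → N, ContMDiffAt 𝓘(ℝ, F) 𝓘(ℝ, E) ∞ σ (f x) ∧ σ (f x) = x ∧
      ∀ᶠ y in 𝓝 (f x), f (σ y) = y := by
  obtain ⟨C, _, _, h⟩ := hf
  set φ := h.domChart
  set ψ := h.codChart
  have hx : x ∈ φ.source := h.mem_domChart_source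
  have hfx : f x ∈ ψ.source := h.mem_codChart_source
  have hφ : φ ∈ IsManifold.maximalAtlas 𝓘(ℝ, E) ∞ N := h.domChart_mem_maximalAtlas
  have hψ : ψ ∈ IsManifold.maximalAtlas 𝓘(ℝ, F) ∞ M := h.codChart_mem_maximalAtlas
  have hw : ∀ z ∈ φ.target, ψ (f (φ.symm z)) = (h.equiv z).1 := by
    intro z hz
    have hz' : z ∈ (φ.extend 𝓘(ℝ, E)).target := by simpa using hz
    simpa using h.writtenInCharts hz'
  have hsrc := h.source_subset_preimage_source
  have h1 : ψ (f x) = (h.equiv (φ x)).1 := by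
    rw [← hw _ (φ.map_source hx), φ.left_inv hx]
  -- In the charts `f` is the first component of `h.equiv`. Freezing the second component at its
  -- value at `x` makes the section pass through `x`.
  let k : M → E := fun y => h.equiv.symm (ψ y, (h.equiv (φ x)).2)
  have hk : k (f x) = φ x := by
    simp [k, h1]
  have hkc : ContMDiffAt 𝓘(ℝ, F) 𝓘(ℝ, E) ∞ k (f x) := by
    have h2 : ContMDiffAt 𝓘(ℝ, F) 𝓘(ℝ, F) ∞ ψ (f x) := contMDiffAt_of_mem_maximalAtlas hψ hfx
    have h3 : ContDiff ℝ ∞ (fun z : F => h.equiv.symm (z, (h.equiv (φ x)).2)) := by fun_prop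
    exact h3.contMDiff.contMDiffAt.comp (f x) h2
  have hks : ∀ᶠ y in 𝓝 (f x), k y ∈ φ.target := by
    apply hkc.continuousAt.eventually
    rw [hk]
    exact φ.open_target.mem_nhds (φ.map_source hx)
  refine ⟨fun y => φ.symm (k y), ?_, ?_, ?_⟩
  · refine ContMDiffAt.comp (f x) ?_ hkc
    rw [hk]
    exact contMDiffAt_symm_of_mem_maximalAtlas hφ (φ.map_source hx)
  · simp [hk, φ.left_inv hx]
  · filter_upwards [hks, ψ.open_source.mem_nhds hfx] with y hy hy'
    apply ψ.injOn (hsrc (φ.map_target hy)) hy'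
    rw [hw _ hy]
    simp [k]

/-- A tangent vector in the kernel of the derivative of a submersion is the velocity of a curve
in the fibre. -/
theorem exists_curve_in_fibre (hf : Manifold.IsSubmersionAt 𝓘(ℝ, E) 𝓘(ℝ, F) ∞ f x)
    (X : TangentSpace 𝓘(ℝ, E) x) (hX : mfderiv 𝓘(ℝ, E) 𝓘(ℝ, F) f x X = 0) :
    ∃ γ : ℝ → N, γ 0 = x ∧ ContMDiffAt 𝓘(ℝ, ℝ) 𝓘(ℝ, E) ∞ γ 0 ∧
      (mfderiv 𝓘(ℝ, ℝ) 𝓘(ℝ, E) γ 0 : ℝ →L[ℝ] E) 1 = X ∧ ∀ᶠ t in 𝓝 (0 : ℝ), f (γ t) = f x := by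
  have hfc := hf.contMDiffAt
  obtain ⟨C, _, _, h⟩ := hf
  set φ := h.domChart
  set ψ := h.codChart
  have hx : x ∈ φ.source := h.mem_domChart_source
  have hfx : f x ∈ ψ.source := h.mem_codChart_source
  have hφ : φ ∈ IsManifold.maximalAtlas 𝓘(ℝ, E) ∞ N := h.domChart_mem_maximalAtlas
  have hψ : ψ ∈ IsManifold.maximalAtlas 𝓘(ℝ, F) ∞ M := h.codChart_mem_maximalAtlas
  have hw : ∀ z ∈ φ.target, ψ (f (φ.symm z)) = (h.equiv z).1 := by
    intro z hz
    have hz' : z ∈ (φ.extend 𝓘(ℝ, E)).target := by simpa using hz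
    simpa using h.writtenInCharts hz'
  have hsrc := h.source_subset_preimage_source
  have hφs := contMDiffAt_symm_of_mem_maximalAtlas hφ (φ.map_source hx)
  have hφx := contMDiffAt_of_mem_maximalAtlas hφ hx
  have hψx := contMDiffAt_of_mem_maximalAtlas hψ hfx
  let Y : E := mfderiv 𝓘(ℝ, E) 𝓘(ℝ, E) φ x X
  -- The curve is a straight line in the chart, in the direction of `X`. It stays in the fibre once
  -- the first component of `h.equiv Y` vanishes.
  let l : ℝ → E := fun t => φ x + t • Y
  have hl0 : l 0 = φ x := by simp [l]
  have hlc : ContDiff ℝ ∞ l := by fun_prop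
  have hld : HasDerivAt l Y 0 := by
    simpa [l] using ((hasDerivAt_id (0 : ℝ)).smul_const Y).const_add (φ x)
  have hγ0 : φ.symm (l 0) = x := by rw [hl0, φ.left_inv hx]
  have hφs' : ContMDiffAt 𝓘(ℝ, E) 𝓘(ℝ, E) ∞ φ.symm (l 0) := by rw [hl0]; exact hφs
  have hγc : ContMDiffAt 𝓘(ℝ, ℝ) 𝓘(ℝ, E) ∞ (fun t => φ.symm (l t)) 0 :=
    ContMDiffAt.comp (0 : ℝ) hφs' hlc.contMDiff.contMDiffAt
  have hev : ∀ᶠ t in 𝓝 (0 : ℝ), l t ∈ φ.target := by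
    apply hlc.continuous.continuousAt.eventually
    rw [hl0]
    exact φ.open_target.mem_nhds (φ.map_source hx)
  have hlm : HasMFDerivAt 𝓘(ℝ, ℝ) 𝓘(ℝ, E) l 0 (ContinuousLinearMap.toSpanSingleton ℝ Y) :=
    hld.hasFDerivAt.hasMFDerivAt
  have hγd : (mfderiv 𝓘(ℝ, ℝ) 𝓘(ℝ, E) (fun t => φ.symm (l t)) 0 : ℝ →L[ℝ] E) 1 = X := by
    have h1 := ((hφs'.mdifferentiableAt (by simp)).hasMFDerivAt.comp (0 : ℝ) hlm).mfderiv
    have h2 : HasMFDerivAt 𝓘(ℝ, E) 𝓘(ℝ, E) (φ.symm ∘ φ) x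
        (ContinuousLinearMap.id ℝ (TangentSpace 𝓘(ℝ, E) x)) := by
      refine (hasMFDerivAt_id x).congr_of_eventuallyEq ?_
      filter_upwards [φ.open_source.mem_nhds hx] with y hy using φ.left_inv hy
    have h3 := (hφs.mdifferentiableAt (by simp)).hasMFDerivAt.comp x
      (hφx.mdifferentiableAt (by simp)).hasMFDerivAt
    have h4 := hasMFDerivAt_unique h2 h3
    have h5 := congrArg (fun A => A X) h4
    have h6 : (mfderiv 𝓘(ℝ, ℝ) 𝓘(ℝ, E) (fun t => φ.symm (l t)) 0 : ℝ →L[ℝ] E) 1 =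
      (mfderiv 𝓘(ℝ, E) 𝓘(ℝ, E) φ.symm (l 0) : E →L[ℝ] E) ((1 : ℝ) • Y) :=
      congrArg (fun A : ℝ →L[ℝ] E => A 1) h1
    rw [h6, one_smul, hl0]
    exact h5.symm
  -- The first component along the line is `f` along the curve, read in the chart `ψ`; its velocity
  -- at `0` is the image of `df X = 0`.
  have hLY : (h.equiv Y).1 = 0 := by
    have h1 : HasMFDerivAt 𝓘(ℝ, ℝ) 𝓘(ℝ, F) (fun t => (h.equiv (l t)).1) 0
        (ContinuousLinearMap.toSpanSingleton ℝ ((h.equiv Y).1)) := by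
      have : HasDerivAt (fun t => (h.equiv (l t)).1) (h.equiv Y).1 0 :=
        (((ContinuousLinearMap.fst ℝ F C).comp
          (h.equiv : E →L[ℝ] F × C)).hasFDerivAt (x := l 0)).comp_hasDerivAt 0 hld
      exact this.hasFDerivAt.hasMFDerivAt
    have h2 : (fun t => (h.equiv (l t)).1) =ᶠ[𝓝 (0 : ℝ)] fun t => ψ (f (φ.symm (l t))) := by
      filter_upwards [hev] with t ht using (hw _ ht).symm
    have h3 := h1.congr_of_eventuallyEq h2.symm
    have hfγ : MDifferentiableAt 𝓘(ℝ, E) 𝓘(ℝ, F) f (φ.symm (l 0)) := by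
      rw [hγ0]; exact hfc.mdifferentiableAt (by simp)
    have hψγ : MDifferentiableAt 𝓘(ℝ, F) 𝓘(ℝ, F) ψ (f (φ.symm (l 0))) := by
      rw [hγ0]; exact hψx.mdifferentiableAt (by simp)
    have h4 := hψγ.hasMFDerivAt.comp (0 : ℝ) (hfγ.hasMFDerivAt.comp (0 : ℝ)
      (hγc.mdifferentiableAt (by simp)).hasMFDerivAt)
    have h5 := hasMFDerivAt_unique h3 h4
    have h6 : (h.equiv Y).1 = (mfderiv 𝓘(ℝ, F) 𝓘(ℝ, F) ψ (f (φ.symm (l 0))) : F →L[ℝ] F)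
        ((mfderiv 𝓘(ℝ, E) 𝓘(ℝ, F) f (φ.symm (l 0)) : E →L[ℝ] F)
          ((mfderiv 𝓘(ℝ, ℝ) 𝓘(ℝ, E) (fun t => φ.symm (l t)) 0 : ℝ →L[ℝ] E) 1)) := by
      have := congrArg (fun A : ℝ →L[ℝ] F => A 1) h5
      refine Eq.trans ?_ this
      change _ = (1 : ℝ) • (h.equiv Y).1
      simp
    rw [h6, hγd, hγ0]
    have : (mfderiv 𝓘(ℝ, E) 𝓘(ℝ, F) f x : E →L[ℝ] F) X = 0 := hX
    rw [this]
    exact map_zero (mfderiv 𝓘(ℝ, F) 𝓘(ℝ, F) ψ (f x) : F →L[ℝ] F)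
  refine ⟨fun t => φ.symm (l t), hγ0, hγc, hγd, ?_⟩
  filter_upwards [hev] with t ht
  apply ψ.injOn (hsrc (φ.map_target ht)) hfx
  have h1 : ψ (f x) = (h.equiv (φ x)).1 := by
    rw [← hw _ (φ.map_source hx), φ.left_inv hx]
  rw [hw _ ht, h1]
  simp [l, hLY]

/-- The derivative of a local section is a right inverse of the derivative of the submersion. -/
theorem surjective_mfderiv_of_isSubmersionAt
    (hf : Manifold.IsSubmersionAt 𝓘(ℝ, E) 𝓘(ℝ, F) ∞ f x) (v : TangentSpace 𝓘(ℝ, F) (f x)) :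
    ∃ w : TangentSpace 𝓘(ℝ, E) x, mfderiv 𝓘(ℝ, E) 𝓘(ℝ, F) f x w = v := by
  obtain ⟨σ, hσ, hσx, hσf⟩ := exists_local_section hf
  have h1 : HasMFDerivAt 𝓘(ℝ, F) 𝓘(ℝ, F) (f ∘ σ) (f x)
      (ContinuousLinearMap.id ℝ (TangentSpace 𝓘(ℝ, F) (f x))) :=
    (hasMFDerivAt_id (f x)).congr_of_eventuallyEq hσf
  have h2 : MDifferentiableAt 𝓘(ℝ, E) 𝓘(ℝ, F) f (σ (f x)) := by
    rw [hσx]; exact hf.contMDiffAt.mdifferentiableAt (by simp)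
  have h3 := h2.hasMFDerivAt.comp (f x) (hσ.mdifferentiableAt (by simp)).hasMFDerivAt
  have h4 := congrArg (fun A : F →L[ℝ] F => A v) (hasMFDerivAt_unique h1 h3)
  refine ⟨(mfderiv 𝓘(ℝ, F) 𝓘(ℝ, E) σ (f x) : F →L[ℝ] E) v, ?_⟩
  have h5 : v = (mfderiv 𝓘(ℝ, E) 𝓘(ℝ, F) f (σ (f x)) : E →L[ℝ] F)
    ((mfderiv 𝓘(ℝ, F) 𝓘(ℝ, E) σ (f x) : F →L[ℝ] E) v) := h4
  rw [hσx] at h5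
  exact h5.symm

end Submersion

/-! ### Smoothness of the action on a homogeneous space and of its differential -/

section SmoothAction

variable {E : Type*} [NormedAddCommGroup E] [NormedSpace ℝ E]
  {G : Type*} [TopologicalSpace G] [ChartedSpace E G]
  {F : Type*} [NormedAddCommGroup F] [NormedSpace ℝ F]

/-- A Lie group acts smoothly on its homogeneous spaces. -/
theorem contMDiffSMul_quotient [Group G] [LieGroup 𝓘(ℝ, E) ∞ G] (K : Subgroup G)
    [ChartedSpace F (G ⧸ K)]
    (hπ : Manifold.IsSubmersion 𝓘(ℝ, E) 𝓘(ℝ, F) ∞ (fun g : G => (g : G ⧸ K))) :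
    ContMDiffSMul 𝓘(ℝ, E) 𝓘(ℝ, F) ∞ G (G ⧸ K) where
  contMDiff_smul := by
    rintro ⟨g₀, p₀⟩
    obtain ⟨x₀, rfl⟩ := QuotientGroup.mk_surjective p₀
    obtain ⟨σ, hσ, hσx, hσf⟩ := exists_local_section (isSubmersionAt_of_isSubmersion hπ x₀)
    -- Near `p₀` the action is `(g, p) ↦ π (g * σ p)` for a smooth local section `σ`.
    have h1 : ContMDiffAt (𝓘(ℝ, E).prod 𝓘(ℝ, F)) 𝓘(ℝ, E) ∞
        (fun q : G × (G ⧸ K) => q.1 * σ q.2) (g₀, (x₀ : G ⧸ K)) :=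
      contMDiffAt_fst.mul (ContMDiffAt.comp (g₀, (x₀ : G ⧸ K)) hσ contMDiffAt_snd)
    have h2 := ContMDiffAt.comp (g₀, (x₀ : G ⧸ K))
      (isSubmersionAt_of_isSubmersion hπ (g₀ * σ (x₀ : G ⧸ K))).contMDiffAt h1
    refine h2.congr_of_eventuallyEq ?_
    have h3 : ∀ᶠ q in 𝓝 (g₀, (x₀ : G ⧸ K)), ((σ q.2 : G) : G ⧸ K) = q.2 :=
      (continuous_snd.tendsto (g₀, (x₀ : G ⧸ K))).eventually hσf
    filter_upwards [h3] with q hq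
    change q.1 • q.2 = ((q.1 * σ q.2 : G) : G ⧸ K)
    conv_lhs => rw [← hq]
    rfl

variable {M : Type*} [TopologicalSpace M] [ChartedSpace F M] [IsManifold 𝓘(ℝ, F) ∞ M]

/-- The differential of a smooth action is smooth. -/
theorem contMDiff_tangent_smul [IsManifold 𝓘(ℝ, E) ∞ G] [SMul G M]
    [ContMDiffSMul 𝓘(ℝ, E) 𝓘(ℝ, F) ∞ G M] :
    ContMDiff (𝓘(ℝ, E).prod (𝓘(ℝ, F).prod 𝓘(ℝ, F))) (𝓘(ℝ, F).prod 𝓘(ℝ, F)) ∞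
      (fun q : G × TangentBundle 𝓘(ℝ, F) M =>
        (⟨q.1 • q.2.1, mfderiv 𝓘(ℝ, F) 𝓘(ℝ, F) (fun p : M => q.1 • p) q.2.1 q.2.2⟩ :
          TangentBundle 𝓘(ℝ, F) M)) := by
  intro q₀
  have hM1 : IsManifold 𝓘(ℝ, F) 1 M := inferInstance
  have hproj : ContMDiff (𝓘(ℝ, E).prod (𝓘(ℝ, F).prod 𝓘(ℝ, F))) 𝓘(ℝ, F) ∞
      (fun q : G × TangentBundle 𝓘(ℝ, F) M => q.2.1) :=
    (contMDiff_proj (TangentSpace 𝓘(ℝ, F) : M → Type _)).comp contMDiff_snd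
  have hs : ContMDiff (𝓘(ℝ, E).prod 𝓘(ℝ, F)) 𝓘(ℝ, F) ∞ (fun q : G × M => q.1 • q.2) :=
    contMDiff_smul
  have h1 := ContMDiffAt.mfderiv (x₀ := q₀) (m := ∞) (n := ∞) (J := 𝓘(ℝ, E).prod (𝓘(ℝ, F).prod 𝓘(ℝ, F)))
    (I := 𝓘(ℝ, F)) (I' := 𝓘(ℝ, F))
    (fun (q : G × TangentBundle 𝓘(ℝ, F) M) (p : M) => q.1 • p) (fun q => q.2.1)
    (hs.comp ((contMDiff_fst.comp contMDiff_fst).prodMk contMDiff_snd)).contMDiffAt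
    hproj.contMDiffAt (by simp)
  exact ContMDiffAt.clm_apply_of_inCoordinates (F₁ := F) (F₂ := F)
    (E₁ := (TangentSpace 𝓘(ℝ, F) : M → Type _)) (E₂ := (TangentSpace 𝓘(ℝ, F) : M → Type _))
    (ϕ := fun q : G × TangentBundle 𝓘(ℝ, F) M =>
      mfderiv 𝓘(ℝ, F) 𝓘(ℝ, F) (fun p : M => q.1 • p) q.2.1)
    (v := fun q => q.2.2) h1 contMDiffAt_snd
    (hs.comp (contMDiff_fst.prodMk hproj)).contMDiffAt

end SmoothAction

/-! ### Inverting a surjection on a complement of its kernel -/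

section RestrictedInverse

variable {E F : Type*} [NormedAddCommGroup E] [NormedSpace ℝ E] [FiniteDimensional ℝ E]
  [NormedAddCommGroup F] [NormedSpace ℝ F]

/-- Finite dimension makes the algebraic inverse continuous. Invertibility is what gives meaning to
`ContinuousLinearMap.inverse` in `horizontalLift`, since that inverse takes the value `0` on
non-invertible maps. -/
theorem isInvertible_comp_subtypeL {A : E →L[ℝ] F} {S : Submodule ℝ E}
    (hc : IsCompl A.ker S) (hs : Function.Surjective A) :
    (A ∘L S.subtypeL).IsInvertible := by
  have hb : Function.Bijective (A ∘L S.subtypeL : S →L[ℝ] F).toLinearMap := by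
    constructor
    · rw [← LinearMap.ker_eq_bot, LinearMap.ker_eq_bot']
      rintro ⟨x, hx⟩ h
      have h1 : x ∈ A.ker := h
      have := (Submodule.disjoint_def.mp hc.disjoint) x h1 hx
      exact Subtype.ext this
    · intro y
      obtain ⟨x, rfl⟩ := hs y
      have hx : x ∈ A.ker ⊔ S := by rw [hc.sup_eq_top]; trivial
      obtain ⟨a, ha, b, hb, rfl⟩ := Submodule.mem_sup.mp hx
      refine ⟨⟨b, hb⟩, ?_⟩
      have ha' : A a = 0 := ha
      change A b = A (a + b)
      rw [map_add, ha', zero_add]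
  exact ⟨(LinearEquiv.ofBijective _ hb).toContinuousLinearEquiv, by ext x; rfl⟩

theorem subtypeL_inverse_apply {A : E →L[ℝ] F} {S : Submodule ℝ E}
    (hc : IsCompl A.ker S) (hs : Function.Surjective A) {w : E} (hw : w ∈ S) :
    (S.subtypeL ∘L (A ∘L S.subtypeL).inverse) (A w) = w := by
  obtain ⟨e, he⟩ := isInvertible_comp_subtypeL hc hs
  have h1 : A w = e ⟨w, hw⟩ := by
    have : (e : S →L[ℝ] F) ⟨w, hw⟩ = (A ∘L S.subtypeL) ⟨w, hw⟩ := by rw [he]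
    exact this.symm
  rw [← he, ContinuousLinearMap.inverse_equiv, h1]
  simp

theorem apply_subtypeL_inverse {A : E →L[ℝ] F} {S : Submodule ℝ E}
    (hc : IsCompl A.ker S) (hs : Function.Surjective A) (v : F) :
    A ((S.subtypeL ∘L (A ∘L S.subtypeL).inverse) v) = v := by
  obtain ⟨e, he⟩ := isInvertible_comp_subtypeL hc hs
  have h1 : ∀ z : S, A z = e z := fun z => by
    have : (e : S →L[ℝ] F) z = (A ∘L S.subtypeL) z := by rw [he]
    exact this.symm
  rw [← he, ContinuousLinearMap.inverse_equiv]
  change A ((e.symm v : S) : E) = v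
  rw [h1, e.apply_symm_apply]

end RestrictedInverse

/-! ### Derivatives as linear maps of model spaces -/

section ModelDeriv

variable (E : Type*) [NormedAddCommGroup E] [NormedSpace ℝ E]
  {M : Type*} [TopologicalSpace M] [ChartedSpace E M]
  {E' : Type*} [NormedAddCommGroup E'] [NormedSpace ℝ E']
  {M' : Type*} [TopologicalSpace M'] [ChartedSpace E' M']
  (E'' : Type*) [NormedAddCommGroup E''] [NormedSpace ℝ E'']
  {M'' : Type*} [TopologicalSpace M''] [ChartedSpace E'' M'']

/-- The manifold derivative, as a linear map between the model spaces. -/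
noncomputable def modelDeriv (f : M → M'') (x : M) : E →L[ℝ] E'' := mfderiv 𝓘(ℝ, E) 𝓘(ℝ, E'') f x

variable {E E''}

theorem modelDeriv_comp {g : M' → M''} {f : M → M'} {x : M} {y : M'}
    (hg : MDifferentiableAt 𝓘(ℝ, E') 𝓘(ℝ, E'') g y) (hf : MDifferentiableAt 𝓘(ℝ, E) 𝓘(ℝ, E') f x)
    (hy : f x = y) :
    modelDeriv E E'' (g ∘ f) x = modelDeriv E' E'' g y ∘L modelDeriv E E' f x := by
  subst hy
  exact mfderiv_comp x hg hf

theorem modelDeriv_comp_apply {g : M' → M''} {f : M → M'} {x : M} {y : M'}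
    (hg : MDifferentiableAt 𝓘(ℝ, E') 𝓘(ℝ, E'') g y) (hf : MDifferentiableAt 𝓘(ℝ, E) 𝓘(ℝ, E') f x)
    (hy : f x = y) (v : E) :
    modelDeriv E E'' (g ∘ f) x v = modelDeriv E' E'' g y (modelDeriv E E' f x v) := by
  rw [modelDeriv_comp hg hf hy]
  rfl

theorem modelDeriv_id (x : M) : modelDeriv E E (id : M → M) x = ContinuousLinearMap.id ℝ E :=
  mfderiv_id

theorem modelDeriv_const (x : M) (c : M'') : modelDeriv E E'' (fun _ : M => c) x = 0 :=
  mfderiv_const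

end ModelDeriv

/-! ### Translations, the adjoint representation and the vertical spaces -/

section LieGroup

variable {E : Type*} [NormedAddCommGroup E] [NormedSpace ℝ E]
  {G : Type*} [TopologicalSpace G] [ChartedSpace E G] [Group G]

/-- The differential at `1` of the left translation by `g`, as a map of model spaces. -/
noncomputable def dLeft (g : G) : E →L[ℝ] E := modelDeriv E E (fun x : G => g * x) 1

theorem dLeft_one : dLeft (E := E) (1 : G) = ContinuousLinearMap.id ℝ E := by
  have : (fun x : G => 1 * x) = id := by funext x; simp
  unfold dLeft
  rw [this, modelDeriv_id]

variable [LieGroup 𝓘(ℝ, E) ∞ G]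

theorem contMDiff_left (g : G) : ContMDiff 𝓘(ℝ, E) 𝓘(ℝ, E) ∞ (fun x : G => g * x) :=
  contMDiff_mul_left

theorem contMDiff_right (g : G) : ContMDiff 𝓘(ℝ, E) 𝓘(ℝ, E) ∞ (fun x : G => x * g) :=
  contMDiff_mul_right

theorem mdifferentiable_left (g : G) : MDifferentiable 𝓘(ℝ, E) 𝓘(ℝ, E) (fun x : G => g * x) :=
  (contMDiff_left g).mdifferentiable (by simp)

theorem mdifferentiable_right (g : G) : MDifferentiable 𝓘(ℝ, E) 𝓘(ℝ, E) (fun x : G => x * g) :=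
  (contMDiff_right g).mdifferentiable (by simp)

theorem modelDeriv_left_dLeft (g x : G) (v : E) :
    modelDeriv E E (fun y : G => g * y) x (dLeft x v) = dLeft (g * x) v := by
  have h3 : (fun y : G => g * x * y) = (fun y : G => g * y) ∘ (fun y : G => x * y) := by
    funext y; simp [mul_assoc]
  rw [dLeft, dLeft, h3, modelDeriv_comp_apply (mdifferentiable_left (E := E) g x)
    (mdifferentiable_left (E := E) x 1) (mul_one x)]

theorem modelDeriv_left_inv_dLeft (g : G) (v : E) :
    modelDeriv E E (fun y : G => g⁻¹ * y) g (dLeft g v) = v := by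
  rw [modelDeriv_left_dLeft, inv_mul_cancel, dLeft_one]
  rfl

theorem dLeft_modelDeriv_left_inv (g : G) (v : E) :
    dLeft g (modelDeriv E E (fun y : G => g⁻¹ * y) g v) = v := by
  have h2 : (fun y : G => g * y) ∘ (fun y : G => g⁻¹ * y) = id := by funext y; simp
  rw [dLeft, ← modelDeriv_comp_apply (mdifferentiable_left (E := E) g 1)
    (mdifferentiable_left (E := E) g⁻¹ g) (inv_mul_cancel g), h2, modelDeriv_id]
  rfl

/-- The differential at `1` of the left translation by `g` is invertible. -/
noncomputable def dLeftEquiv (g : G) : E ≃ₗ[ℝ] E where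
  toFun := dLeft g
  map_add' := map_add _
  map_smul' := map_smul _
  invFun := modelDeriv E E (fun y : G => g⁻¹ * y) g
  left_inv := modelDeriv_left_inv_dLeft g
  right_inv := dLeft_modelDeriv_left_inv g

/-- Right translations and left translations are related by the adjoint representation. -/
theorem modelDeriv_right_dLeft (g h : G) (v : E) :
    modelDeriv E E (fun y : G => y * h) g (dLeft g v) =
      dLeft (E := E) (g * h) ((Ad h⁻¹ : E →L[ℝ] E) v) := by
  have hc : MDifferentiable 𝓘(ℝ, E) 𝓘(ℝ, E) (fun x : G => h⁻¹ * x * h⁻¹⁻¹) :=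
    (mdifferentiable_right (E := E) h⁻¹⁻¹).comp (mdifferentiable_left (E := E) h⁻¹)
  have h6 : (fun y : G => g * h * y) ∘ (fun x : G => h⁻¹ * x * h⁻¹⁻¹) =
      (fun y : G => y * h) ∘ (fun y : G => g * y) := by
    funext y; simp [mul_assoc]
  have h7 := modelDeriv_comp_apply (mdifferentiable_left (E := E) (g * h) 1) (hc 1) (by simp) v
  rw [h6, modelDeriv_comp_apply (mdifferentiable_right (E := E) h g)
    (mdifferentiable_left (E := E) g 1) (mul_one g)] at h7
  exact h7

variable {F : Type*} [NormedAddCommGroup F] [NormedSpace ℝ F]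
  {K : Subgroup G} [ChartedSpace F (G ⧸ K)]
  (hπ : Manifold.IsSubmersion 𝓘(ℝ, E) 𝓘(ℝ, F) ∞ (fun g : G => (g : G ⧸ K)))

include hπ

omit [LieGroup 𝓘(ℝ, E) ∞ G] in
theorem contMDiff_proj_quotient : ContMDiff 𝓘(ℝ, E) 𝓘(ℝ, F) ∞ (fun g : G => (g : G ⧸ K)) :=
  fun g => (isSubmersionAt_of_isSubmersion hπ g).contMDiffAt

omit [LieGroup 𝓘(ℝ, E) ∞ G] in
theorem mdifferentiable_proj_quotient :
    MDifferentiable 𝓘(ℝ, E) 𝓘(ℝ, F) (fun g : G => (g : G ⧸ K)) :=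
  (contMDiff_proj_quotient hπ).mdifferentiable (by simp)

omit [LieGroup 𝓘(ℝ, E) ∞ G] in
theorem surjective_modelDeriv_proj (g : G) :
    Function.Surjective (modelDeriv E F (fun g : G => (g : G ⧸ K)) g) := fun v =>
  surjective_mfderiv_of_isSubmersionAt (isSubmersionAt_of_isSubmersion hπ g) v

theorem contMDiff_smul_quotient (g : G) :
    ContMDiff 𝓘(ℝ, F) 𝓘(ℝ, F) ∞ (fun p : G ⧸ K => g • p) := by
  have := contMDiffSMul_quotient K hπ
  exact ContMDiffSMul.contMDiff_const_smul (I := 𝓘(ℝ, E)) (n := ∞) g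

theorem mdifferentiable_smul_quotient (g : G) :
    MDifferentiable 𝓘(ℝ, F) 𝓘(ℝ, F) (fun p : G ⧸ K => g • p) :=
  (contMDiff_smul_quotient hπ g).mdifferentiable (by simp)

theorem modelDeriv_smul_smul (g h : G) (p : G ⧸ K) (v : F) :
    modelDeriv F F (fun q : G ⧸ K => g • q) (h • p) (modelDeriv F F (fun q : G ⧸ K => h • q) p v) =
      modelDeriv F F (fun q : G ⧸ K => (g * h) • q) p v := by
  have : (fun q : G ⧸ K => (g * h) • q) = (fun q => g • q) ∘ (fun q => h • q) := by
    funext q; simp [mul_smul]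
  rw [this, modelDeriv_comp_apply (mdifferentiable_smul_quotient hπ g _)
    (mdifferentiable_smul_quotient hπ h p) rfl]

omit [LieGroup 𝓘(ℝ, E) ∞ G] hπ in
theorem modelDeriv_one_smul (p : G ⧸ K) :
    modelDeriv F F (fun q : G ⧸ K => (1 : G) • q) p = ContinuousLinearMap.id ℝ F := by
  have : (fun q : G ⧸ K => (1 : G) • q) = id := by funext q; simp
  rw [this, modelDeriv_id]

theorem modelDeriv_proj_left (g x : G) (w : E) :
    modelDeriv E F (fun g : G => (g : G ⧸ K)) (g * x) (modelDeriv E E (fun y : G => g * y) x w) =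
      modelDeriv F F (fun p : G ⧸ K => g • p) (x : G ⧸ K)
        (modelDeriv E F (fun g : G => (g : G ⧸ K)) x w) := by
  rw [← modelDeriv_comp_apply (mdifferentiable_proj_quotient hπ (g * x))
    (mdifferentiable_left (E := E) g x) rfl, ← modelDeriv_comp_apply
    (mdifferentiable_smul_quotient hπ g (x : G ⧸ K)) (mdifferentiable_proj_quotient hπ x) rfl]
  rfl

theorem modelDeriv_proj_dLeft (g : G) (w : E) :
    modelDeriv E F (fun g : G => (g : G ⧸ K)) g (dLeft g w) =
      modelDeriv F F (fun p : G ⧸ K => g • p) ((1 : G) : G ⧸ K)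
        (modelDeriv E F (fun g : G => (g : G ⧸ K)) 1 w) := by
  have := modelDeriv_proj_left hπ g 1 w
  rwa [mul_one] at this

theorem modelDeriv_proj_right (g : G) {h : G} (hh : h ∈ K) (w : E) :
    modelDeriv E F (fun g : G => (g : G ⧸ K)) (g * h)
        (modelDeriv E E (fun y : G => y * h) g w) =
      modelDeriv E F (fun g : G => (g : G ⧸ K)) g w := by
  have h3 : (fun g : G => (g : G ⧸ K)) ∘ (fun y : G => y * h) = fun g : G => (g : G ⧸ K) := by
    funext y
    exact QuotientGroup.mk_mul_of_mem y hh
  rw [← modelDeriv_comp_apply (mdifferentiable_proj_quotient hπ (g * h))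
    (mdifferentiable_right (E := E) h g) rfl, h3]

omit [LieGroup 𝓘(ℝ, E) ∞ G] in
/-- The Lie algebra of a closed subgroup is the vertical space at `1`. -/
theorem isVelocityIn_iff (X : E) :
    IsVelocityIn (E := E) K X ↔ modelDeriv E F (fun g : G => (g : G ⧸ K)) 1 X = 0 := by
  constructor
  · rintro ⟨γ, h0, hK, hγ, hX⟩
    have h3 : (fun g : G => (g : G ⧸ K)) ∘ γ = fun _ => ((1 : G) : G ⧸ K) := by
      funext t
      exact QuotientGroup.eq.mpr (by simpa using hK t)
    have h2 := modelDeriv_comp_apply (mdifferentiable_proj_quotient hπ 1)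
      (hγ.mdifferentiableAt (by simp)) h0 1
    rw [h3, modelDeriv_const] at h2
    rw [← hX]
    exact h2.symm
  · intro hX
    obtain ⟨γ, h0, hγ, hd, hf⟩ := exists_curve_in_fibre (isSubmersionAt_of_isSubmersion hπ 1) X hX
    classical
    -- `IsVelocityIn` asks for a curve in `K` at all times, while `γ` is known to lie in `K` only
    -- near time `0`. Replacing the other values by `1` does not change the germ at `0`.
    let δ : ℝ → G := fun t => if γ t ∈ K then γ t else 1
    have he : δ =ᶠ[𝓝 (0 : ℝ)] γ := by
      filter_upwards [hf] with t ht
      have : γ t ∈ K := by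
        have := QuotientGroup.eq.mp ht
        simpa using this
      simp [δ, this]
    refine ⟨δ, ?_, ?_, hγ.congr_of_eventuallyEq he, ?_⟩
    · rw [he.eq_of_nhds, h0]
    · intro t
      by_cases h : γ t ∈ K <;> simp [δ, h]
    · rw [← hd]
      exact congrArg (fun A : ℝ →L[ℝ] E => A 1) he.mfderiv_eq

omit [LieGroup 𝓘(ℝ, E) ∞ G] hπ [TopologicalSpace G] in
theorem inv_smul_mk (g : G) : g⁻¹ • (g : G ⧸ K) = ((1 : G) : G ⧸ K) := by
  change ((g⁻¹ * g : G) : G ⧸ K) = _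
  rw [inv_mul_cancel]

omit [LieGroup 𝓘(ℝ, E) ∞ G] hπ [TopologicalSpace G] in
theorem smul_mk_one (g : G) : g • ((1 : G) : G ⧸ K) = (g : G ⧸ K) := by
  change ((g * 1 : G) : G ⧸ K) = _
  rw [mul_one]

theorem modelDeriv_smul_inv (g : G) (v : F) :
    modelDeriv F F (fun p : G ⧸ K => g • p) ((1 : G) : G ⧸ K)
      (modelDeriv F F (fun p : G ⧸ K => g⁻¹ • p) (g : G ⧸ K) v) = v := by
  rw [← inv_smul_mk (K := K) g, modelDeriv_smul_smul hπ, mul_inv_cancel, modelDeriv_one_smul]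
  rfl

theorem modelDeriv_inv_smul (g : G) (v : F) :
    modelDeriv F F (fun p : G ⧸ K => g⁻¹ • p) (g : G ⧸ K)
      (modelDeriv F F (fun p : G ⧸ K => g • p) ((1 : G) : G ⧸ K) v) = v := by
  rw [← smul_mk_one (K := K) g, modelDeriv_smul_smul hπ, inv_mul_cancel, modelDeriv_one_smul]
  rfl

/-- Since `π ∘ L_g = L_g ∘ π` and `g` acts invertibly on the quotient, `dπ_g` and `dπ_1` have
corresponding kernels under left translation. -/
theorem ker_modelDeriv_proj (g : G) :
    (modelDeriv E F (fun g : G => (g : G ⧸ K)) g).ker =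
      (modelDeriv E F (fun g : G => (g : G ⧸ K)) 1).ker.map (dLeftEquiv g : E ≃ₗ[ℝ] E).toLinearMap := by
  have key : ∀ w : E, modelDeriv E F (fun g : G => (g : G ⧸ K)) g (dLeft g w) = 0 ↔
      modelDeriv E F (fun g : G => (g : G ⧸ K)) 1 w = 0 := by
    intro w
    rw [modelDeriv_proj_dLeft hπ]
    constructor
    · intro h
      rw [← modelDeriv_inv_smul hπ g (modelDeriv E F (fun g : G => (g : G ⧸ K)) 1 w), h, map_zero]
    · intro h
      rw [h, map_zero]
  ext w
  constructor
  · intro hw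
    refine ⟨(dLeftEquiv g).symm w, ?_, (dLeftEquiv g).apply_symm_apply w⟩
    apply (key _).mp
    have : dLeft g ((dLeftEquiv g).symm w) = w := (dLeftEquiv g).apply_symm_apply w
    rw [this]
    exact hw
  · rintro ⟨v, hv, rfl⟩
    exact (key v).mpr hv

end LieGroup

/-! ### The principal connection and its horizontal lifts -/

section PrincipalConnection

variable {E : Type*} [NormedAddCommGroup E] [NormedSpace ℝ E]
  {G : Type*} [TopologicalSpace G] [ChartedSpace E G] [Group G] [LieGroup 𝓘(ℝ, E) ∞ G]
  {F : Type*} [NormedAddCommGroup F] [NormedSpace ℝ F]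
  {K : Subgroup G} [ChartedSpace F (G ⧸ K)]

/-- The value at `g` of the left-invariant distribution generated by `m`, as a subspace of the
model space. -/
noncomputable def modelDistribution (m : Submodule ℝ E) (g : G) : Submodule ℝ E :=
  m.map (dLeft g).toLinearMap

theorem contMDiff_leftInvariant (X : E) :
    ContMDiff 𝓘(ℝ, E) (𝓘(ℝ, E).prod 𝓘(ℝ, E)) ∞
      (fun x : G => (⟨x, dLeft (E := E) x X⟩ : TangentBundle 𝓘(ℝ, E) G)) := by
  have h1 := contMDiff_tangent_smul (E := E) (G := G) (F := E) (M := G)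
  have h2 : ContMDiff 𝓘(ℝ, E) (𝓘(ℝ, E).prod (𝓘(ℝ, E).prod 𝓘(ℝ, E))) ∞
      (fun x : G => (x, (⟨1, X⟩ : TangentBundle 𝓘(ℝ, E) G))) :=
    contMDiff_id.prodMk contMDiff_const
  convert! h1.comp h2 using 2 with x
  simp only [Function.comp_def]
  -- The base point obtained from the action is `x • 1`, which equals `x` only propositionally; for
  -- a variable `y` the equality can be substituted.
  have : ∀ y : G, y = x → (⟨x, dLeft (E := E) x X⟩ : TangentBundle 𝓘(ℝ, E) G) = ⟨y, dLeft (E := E) x X⟩ := by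
    rintro y rfl; rfl
  exact this (x • 1) (by simp)

variable [FiniteDimensional ℝ E]
  (hπ : Manifold.IsSubmersion 𝓘(ℝ, E) 𝓘(ℝ, F) ∞ (fun g : G => (g : G ⧸ K)))
  {m : Submodule ℝ E} (hm : IsReductiveDecomposition (E := E) K m)

include hπ hm

omit [LieGroup 𝓘(ℝ, E) ∞ G] [FiniteDimensional ℝ E] in
-- The summand complementary to `m` consists of the velocities at `1` of curves in `K`, and by
-- `isVelocityIn_iff` it is the vertical space at `1`.
theorem isCompl_ker_one : IsCompl (modelDeriv E F (fun g : G => (g : G ⧸ K)) 1).ker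
    m := by
  obtain ⟨k, hk, hc⟩ := hm.decomposition
  have : (modelDeriv E F (fun g : G => (g : G ⧸ K)) 1).ker = k := by
    ext X
    exact ((hk X).trans (isVelocityIn_iff hπ X)).symm
  rw [this]
  exact hc

omit [FiniteDimensional ℝ E] in
-- Left translation by `g` is a linear isomorphism that carries both the vertical space and `m` from
-- `1` to `g`, so the complement at `1` gives one at `g`.
theorem isCompl_ker_modelDeriv_proj (g : G) :
    IsCompl (modelDeriv E F (fun g : G => (g : G ⧸ K)) g).ker
      (modelDistribution m g) := by
  rw [ker_modelDeriv_proj hπ g]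
  exact (Submodule.orderIsoMapComap (dLeftEquiv (E := E) g)).isCompl (isCompl_ker_one hπ hm)

omit [FiniteDimensional ℝ E] hπ in
-- A horizontal vector at `g` is the left translate of some `X ∈ m`; its right translate by `h` is
-- the left translate by `g * h` of `Ad h⁻¹ X`, which is again in `m`.
theorem modelDeriv_right_mem (g : G) {h : G} (hh : h ∈ K) {w : E}
    (hw : w ∈ (modelDistribution m g)) :
    modelDeriv E E (fun x : G => x * h) g w ∈
      (modelDistribution m (g * h)) := by
  obtain ⟨X, hX, rfl⟩ := hw
  exact ⟨_, hm.ad_invariant h⁻¹ (K.inv_mem hh) X hX, (modelDeriv_right_dLeft (E := E) g h X).symm⟩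

/-- A reductive complement generates a principal connection. -/
theorem isPrincipalConnection_leftInvariantDistribution :
    IsPrincipalConnection (E := E) F K (leftInvariantDistribution (E := E) m) where
  smooth g := by
    let b : Module.Basis (Fin (Module.finrank ℝ m)) ℝ m :=
      Module.finBasis ℝ m
    refine ⟨_, fun i x => dLeft (E := E) x (b i : E), fun i => contMDiff_leftInvariant _ g,
      Eventually.of_forall fun x => ⟨?_, ?_⟩⟩
    · have h1 : LinearIndependent ℝ (fun i => (b i : E)) :=
        b.linearIndependent.map' m.subtype (Submodule.ker_subtype _)
      exact h1.map' (dLeftEquiv (E := E) x : E ≃ₗ[ℝ] E).toLinearMap (LinearEquiv.ker _)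
    · have h1 : Submodule.span ℝ (Set.range fun i => (b i : E)) =
          m := by
        have := congrArg (Submodule.map m.subtype) b.span_eq
        rw [Submodule.map_span, ← Set.range_comp, Submodule.map_subtype_top] at this
        exact this
      have h2 : modelDistribution m x = Submodule.span ℝ
          (Set.range fun i => dLeft (E := E) x (b i : E)) := by
        have := congrArg (Submodule.map (dLeft (E := E) x).toLinearMap) h1
        rw [Submodule.map_span, ← Set.range_comp] at this
        exact this.symm
      exact h2
  isCompl_vertical g := isCompl_ker_modelDeriv_proj hπ hm g
  right_invariant g h hh w hw := modelDeriv_right_mem hm g hh hw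

omit hπ hm in
/-- The horizontal lift for the distribution generated by `m`, as a map of model spaces. -/
noncomputable def hLift (F : Type*) [NormedAddCommGroup F] [NormedSpace ℝ F]
    (K : Subgroup G) [ChartedSpace F (G ⧸ K)] (m : Submodule ℝ E)
    (g : G) : F →L[ℝ] E :=
  horizontalLift (E := E) K (leftInvariantDistribution (E := E) m) g

theorem hLift_proj {g : G} {w : E}
    (hw : w ∈ (modelDistribution m g)) :
    hLift F K m g (modelDeriv E F (fun g : G => (g : G ⧸ K)) g w) = w :=
  subtypeL_inverse_apply (isCompl_ker_modelDeriv_proj hπ hm g) (surjective_modelDeriv_proj hπ g) hw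

theorem proj_hLift (g : G) (v : F) :
    modelDeriv E F (fun g : G => (g : G ⧸ K)) g (hLift F K m g v) = v :=
  apply_subtypeL_inverse (isCompl_ker_modelDeriv_proj hπ hm g) (surjective_modelDeriv_proj hπ g) v

omit [LieGroup 𝓘(ℝ, E) ∞ G] [FiniteDimensional ℝ E] hπ hm in
theorem hLift_mem (g : G) (v : F) :
    hLift F K m g v ∈ (modelDistribution m g) :=
  Submodule.coe_mem (p := (modelDistribution m g))
    (((modelDeriv E F (fun g : G => (g : G ⧸ K)) g ∘L
      (modelDistribution m g).subtypeL).inverse) v)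

theorem hLift_eq {g : G} {v : F} {w : E}
    (hw : w ∈ (modelDistribution m g))
    (h : modelDeriv E F (fun g : G => (g : G ⧸ K)) g w = v) : hLift F K m g v = w := by
  rw [← h, hLift_proj hπ hm hw]

omit [LieGroup 𝓘(ℝ, E) ∞ G] [FiniteDimensional ℝ E] hπ hm in
theorem mem_modelDistribution_one (w : E) :
    w ∈ (modelDistribution m (1 : G)) ↔ w ∈ m := by
  rw [modelDistribution, dLeft_one]
  simp

/-- The horizontal lift is left-invariant. -/
theorem hLift_eq_dLeft (g : G) (v : F) :
    hLift F K m g v =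
      dLeft g (hLift F K m 1 (modelDeriv F F (fun p : G ⧸ K => g⁻¹ • p) (g : G ⧸ K) v)) := by
  apply hLift_eq hπ hm
  · rw [modelDistribution]
    exact ⟨_, (mem_modelDistribution_one _).mp (hLift_mem 1 _), rfl⟩
  · rw [modelDeriv_proj_dLeft hπ, proj_hLift hπ hm, modelDeriv_smul_inv hπ]

/-- The right translate by `h` of the lift at `g` is horizontal and has the same projection, and
these two properties characterize the lift. -/
theorem hLift_mul (g : G) {h : G} (hh : h ∈ K) (v : F) :
    hLift F K m (g * h) v = modelDeriv E E (fun x : G => x * h) g (hLift F K m g v) := by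
  apply hLift_eq hπ hm
  · exact modelDeriv_right_mem hm g hh (hLift_mem g v)
  · rw [modelDeriv_proj_right hπ g hh, proj_hLift hπ hm]

end PrincipalConnection

/-! ### Regularity in tangent bundles over a fixed base point and in pulled back bundles -/

section TangentBundle

variable {F : Type*} [NormedAddCommGroup F] [NormedSpace ℝ F]
  {M : Type*} [TopologicalSpace M] [ChartedSpace F M]

theorem tangentBundle_mk_congr {p q : M} (h : p = q) (v : F) :
    (⟨p, v⟩ : TangentBundle 𝓘(ℝ, F) M) = ⟨q, v⟩ := by
  subst h; rfl

variable [IsManifold 𝓘(ℝ, F) 1 M]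

/-- The preferred chart at `p` has the identity as its derivative at `p`, so the trivialization at
`p` does not alter vectors over `p`. Regularity of a map into a single tangent space is thereby
regularity of a map into the model space. -/
theorem trivializationAt_tangentBundle_self (p : M) (v : F) :
    (trivializationAt F (TangentSpace 𝓘(ℝ, F) : M → Type _) p
      (⟨p, v⟩ : TangentBundle 𝓘(ℝ, F) M)).2 = v := by
  have h1 := TangentBundle.continuousLinearMapAt_trivializationAt (I := 𝓘(ℝ, F))
    (x₀ := p) (x := p) (mem_chart_source F p)
  rw [mfderiv_extChartAt_self] at h1
  have h2 := congrArg (fun A : F →L[ℝ] F => A v) h1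
  have h3 : p ∈ (trivializationAt F (TangentSpace 𝓘(ℝ, F) : M → Type _) p).baseSet :=
    mem_baseSet_trivializationAt F (TangentSpace 𝓘(ℝ, F) : M → Type _) p
  have h4 := Trivialization.continuousLinearMapAt_apply_of_mem (R := ℝ)
    (trivializationAt F (TangentSpace 𝓘(ℝ, F) : M → Type _) p) h3 v
  exact h4.symm.trans h2

variable {E' : Type*} [NormedAddCommGroup E'] [NormedSpace ℝ E']
  {H' : Type*} [TopologicalSpace H'] {I : ModelWithCorners ℝ E' H'}
  {N : Type*} [TopologicalSpace N] [ChartedSpace H' N]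

theorem contMDiffAt_tangentBundle_const_base {p : M} {f : N → F} {x : N} {n : ℕ∞ω}:
    ContMDiffAt I (𝓘(ℝ, F).prod 𝓘(ℝ, F)) n
      (fun y => (⟨p, f y⟩ : TangentBundle 𝓘(ℝ, F) M)) x ↔ ContMDiffAt I 𝓘(ℝ, F) n f x := by
  rw [contMDiffAt_totalSpace]
  constructor
  · rintro ⟨-, h⟩
    refine h.congr_of_eventuallyEq (Eventually.of_forall fun y => ?_)
    exact (trivializationAt_tangentBundle_self p (f y)).symm
  · intro h
    refine ⟨contMDiffAt_const, h.congr_of_eventuallyEq (Eventually.of_forall fun y => ?_)⟩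
    exact trivializationAt_tangentBundle_self p (f y)

theorem mdifferentiableAt_tangentBundle_const_base {p : M} {f : N → F} {x : N} :
    MDifferentiableAt I (𝓘(ℝ, F).prod 𝓘(ℝ, F))
      (fun y => (⟨p, f y⟩ : TangentBundle 𝓘(ℝ, F) M)) x ↔
      MDifferentiableAt I 𝓘(ℝ, F) f x := by
  rw [mdifferentiableAt_totalSpace]
  constructor
  · rintro ⟨-, h⟩
    refine h.congr_of_eventuallyEq (Eventually.of_forall fun y => ?_)
    exact (trivializationAt_tangentBundle_self p (f y)).symm
  · intro h
    refine ⟨mdifferentiableAt_const, h.congr_of_eventuallyEq (Eventually.of_forall fun y => ?_)⟩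
    exact trivializationAt_tangentBundle_self p (f y)

variable {E'' : Type*} [NormedAddCommGroup E''] [NormedSpace ℝ E'']
  {B : Type*} [TopologicalSpace B] [ChartedSpace E'' B]
  (φ : ContMDiffMap 𝓘(ℝ, E'') 𝓘(ℝ, F) B M ∞)

/-- The trivializations of the pulled back bundle are those of the tangent bundle along `φ`, so the
fibre components coincide. The base components differ by `φ`, which is smooth. -/
theorem mdifferentiableAt_pullback_iff
    {f : N → TotalSpace F (φ *ᵖ (TangentSpace 𝓘(ℝ, F) : M → Type _))} {x : N} :
    MDifferentiableAt I (𝓘(ℝ, E'').prod 𝓘(ℝ, F)) f x ↔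
      MDifferentiableAt I 𝓘(ℝ, E'') (fun y => (f y).1) x ∧
      MDifferentiableAt I (𝓘(ℝ, F).prod 𝓘(ℝ, F))
        (fun y => (⟨φ (f y).1, (f y).2⟩ : TangentBundle 𝓘(ℝ, F) M)) x := by
  rw [mdifferentiableAt_totalSpace, mdifferentiableAt_totalSpace]
  constructor
  · rintro ⟨h1, h2⟩
    exact ⟨h1, (φ.contMDiff.mdifferentiable (by simp) _).comp x h1, h2⟩
  · rintro ⟨h1, -, h2⟩
    exact ⟨h1, h2⟩

theorem contMDiffAt_pullback_iff
    {f : N → TotalSpace F (φ *ᵖ (TangentSpace 𝓘(ℝ, F) : M → Type _))} {x : N} :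
    ContMDiffAt I (𝓘(ℝ, E'').prod 𝓘(ℝ, F)) ∞ f x ↔
      ContMDiffAt I 𝓘(ℝ, E'') ∞ (fun y => (f y).1) x ∧
      ContMDiffAt I (𝓘(ℝ, F).prod 𝓘(ℝ, F)) ∞
        (fun y => (⟨φ (f y).1, (f y).2⟩ : TangentBundle 𝓘(ℝ, F) M)) x := by
  rw [contMDiffAt_totalSpace, contMDiffAt_totalSpace]
  constructor
  · rintro ⟨h1, h2⟩
    exact ⟨h1, (φ.contMDiff _).comp x h1, h2⟩
  · rintro ⟨h1, -, h2⟩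
    exact ⟨h1, h2⟩

end TangentBundle

/-! ### The associated bundle and equivariant functions -/

section Orbit

variable {EGb : Type*} [NormedAddCommGroup EGb] [NormedSpace ℝ EGb]
  {Gb : Type*} [TopologicalSpace Gb] [ChartedSpace EGb Gb] [Group Gb]
  {Hb : Subgroup Gb}
  {FMb : Type*} [NormedAddCommGroup FMb] [NormedSpace ℝ FMb]
  [ChartedSpace FMb (Gb ⧸ Hb)]
  {EG : Type*} [NormedAddCommGroup EG] [NormedSpace ℝ EG]
  {G : Type*} [TopologicalSpace G] [ChartedSpace EG G] [Group G]
  {ι : G →* Gb}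
  {FM : Type*} [NormedAddCommGroup FM] [NormedSpace ℝ FM]
  [ChartedSpace FM (G ⧸ Hb.comap ι)]

omit [TopologicalSpace Gb] [TopologicalSpace G] in
theorem orbitMap_mk (g : G) : orbitMap ι Hb (g : G ⧸ Hb.comap ι) = ((ι g : Gb) : Gb ⧸ Hb) := rfl

omit [TopologicalSpace Gb] [TopologicalSpace G] in
theorem orbitMap_smul (g : G) (x : G ⧸ Hb.comap ι) :
    orbitMap ι Hb (g • x) = ι g • orbitMap ι Hb x := by
  obtain ⟨x, rfl⟩ := QuotientGroup.mk_surjective x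
  change orbitMap ι Hb ((g * x : G) : G ⧸ Hb.comap ι) = _
  rw [orbitMap_mk, map_mul]
  rfl

variable (hj : Manifold.IsSmoothEmbedding 𝓘(ℝ, FM) 𝓘(ℝ, FMb) ∞ (orbitMap ι Hb))

/-- The differential of the left translation by `ι g` on the ambient homogeneous space, as a map of
model spaces. -/
noncomputable def dAct (FMb : Type*) [NormedAddCommGroup FMb] [NormedSpace ℝ FMb] (ι : G →* Gb)
    {Hb : Subgroup Gb} [ChartedSpace FMb (Gb ⧸ Hb)] (g : G) (p : Gb ⧸ Hb) : FMb →L[ℝ] FMb :=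
  modelDeriv FMb FMb (fun q : Gb ⧸ Hb => ι g • q) p

omit [TopologicalSpace G] [ChartedSpace EGb Gb] in
theorem dAct_one (p : Gb ⧸ Hb) : dAct FMb ι (1 : G) p = ContinuousLinearMap.id ℝ FMb := by
  have : (fun q : Gb ⧸ Hb => ι (1 : G) • q) = id := by funext q; simp
  rw [dAct, this, modelDeriv_id]

variable [LieGroup 𝓘(ℝ, EGb) ∞ Gb]
  (hπb : Manifold.IsSubmersion 𝓘(ℝ, EGb) 𝓘(ℝ, FMb) ∞ (fun g : Gb => (g : Gb ⧸ Hb)))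

include hπb in
omit [TopologicalSpace G] in
theorem dAct_dAct (g h : G) (p q : Gb ⧸ Hb) (hq : ι h • p = q) (v : FMb) :
    dAct FMb ι g q (dAct FMb ι h p v) = dAct FMb ι (g * h) p v := by
  subst hq
  rw [dAct, dAct, dAct, modelDeriv_smul_smul hπb, map_mul]

include hπb in
omit [TopologicalSpace G] in
theorem dAct_inv_dAct (g : G) (p q : Gb ⧸ Hb) (hq : ι g • p = q) (v : FMb) :
    dAct FMb ι g⁻¹ q (dAct FMb ι g p v) = v := by
  rw [dAct_dAct hπb _ _ _ _ hq, inv_mul_cancel, dAct_one]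
  rfl

include hπb in
omit [TopologicalSpace G] in
theorem dAct_dAct_inv (g : G) (p q : Gb ⧸ Hb) (hq : ι g • p = q) (v : FMb) :
    dAct FMb ι g p (dAct FMb ι g⁻¹ q v) = v := by
  rw [dAct_dAct hπb _ _ _ _ (by rw [← hq]; simp), mul_inv_cancel, dAct_one]
  rfl

omit [TopologicalSpace Gb] [TopologicalSpace G] in
theorem smul_orbitMap_one (g : G) :
    ι g • orbitMap ι Hb ((1 : G) : G ⧸ Hb.comap ι) = orbitMap ι Hb (g : G ⧸ Hb.comap ι) := by
  rw [← orbitMap_smul, smul_mk_one]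

omit [TopologicalSpace Gb] [TopologicalSpace G] in
theorem inv_smul_orbitMap (g : G) :
    ι g⁻¹ • orbitMap ι Hb (g : G ⧸ Hb.comap ι) = orbitMap ι Hb ((1 : G) : G ⧸ Hb.comap ι) := by
  rw [← orbitMap_smul, inv_smul_mk]

variable [LieGroup 𝓘(ℝ, EG) ∞ G] [IsManifold 𝓘(ℝ, FMb) ∞ (Gb ⧸ Hb)]
  (hι' : Manifold.IsImmersion 𝓘(ℝ, EG) 𝓘(ℝ, EGb) ∞ ι)
  (hπ : Manifold.IsSubmersion 𝓘(ℝ, EG) 𝓘(ℝ, FM) ∞ (fun g : G => (g : G ⧸ Hb.comap ι)))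

section Smooth

include hπb hι'

omit [LieGroup 𝓘(ℝ, EG) ∞ G] in
/-- The differential of the action of `G` on the ambient homogeneous space is smooth. -/
theorem contMDiff_tangent_act :
    ContMDiff (𝓘(ℝ, EG).prod (𝓘(ℝ, FMb).prod 𝓘(ℝ, FMb))) (𝓘(ℝ, FMb).prod 𝓘(ℝ, FMb)) ∞
      (fun q : G × TangentBundle 𝓘(ℝ, FMb) (Gb ⧸ Hb) =>
        (⟨ι q.1 • q.2.1, dAct FMb ι q.1 q.2.1 q.2.2⟩ :
          TangentBundle 𝓘(ℝ, FMb) (Gb ⧸ Hb))) := by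
  have := contMDiffSMul_quotient Hb hπb
  have h1 := contMDiff_tangent_smul (E := EGb) (G := Gb) (F := FMb) (M := Gb ⧸ Hb)
  exact h1.comp ((hι'.contMDiff.comp contMDiff_fst).prodMk contMDiff_snd)

include hπ

/-- The frame map is smooth. -/
theorem contMDiff_frameMap :
    ContMDiff (𝓘(ℝ, EG).prod 𝓘(ℝ, FMb)) (𝓘(ℝ, FM).prod 𝓘(ℝ, FMb)) ∞ (frameMap hj) := by
  have h0 : ContMDiff (𝓘(ℝ, EG).prod 𝓘(ℝ, FMb)) (𝓘(ℝ, FMb).prod 𝓘(ℝ, FMb)) ∞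
      (fun a : G × FMb => (⟨orbitMap ι Hb ((1 : G) : G ⧸ Hb.comap ι), a.2⟩ :
        TangentBundle 𝓘(ℝ, FMb) (Gb ⧸ Hb))) := by
    have h : ContMDiff 𝓘(ℝ, FMb) (𝓘(ℝ, FMb).prod 𝓘(ℝ, FMb)) ∞
      (fun a : FMb => (⟨orbitMap ι Hb ((1 : G) : G ⧸ Hb.comap ι), a⟩ :
        TangentBundle 𝓘(ℝ, FMb) (Gb ⧸ Hb))) := fun x =>
      contMDiffAt_tangentBundle_const_base.mpr contMDiffAt_id
    exact h.comp contMDiff_snd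
  have h1 := (contMDiff_tangent_act (EG := EG) hπb hι').comp (contMDiff_fst.prodMk h0)
  intro a
  refine (contMDiffAt_pullback_iff (orbitInclusion hj)).mpr
    ⟨(contMDiff_proj_quotient hπ).comp contMDiff_fst a, (h1 a).congr_of_eventuallyEq
      (Eventually.of_forall fun b => ?_)⟩
  exact (tangentBundle_mk_congr (smul_orbitMap_one b.1) _).symm

end Smooth

section Associated

include hπb

theorem frameMap_eq_of_associatedRel (a b : G × FMb)
    (h : AssociatedRel hj a b) : frameMap hj a = frameMap hj b := by
  obtain ⟨g, v⟩ := a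
  obtain ⟨g', v'⟩ := b
  obtain ⟨h, hh, h1, h2⟩ := h
  dsimp only at h1 h2
  subst h1
  have h3 : v' = dAct FMb ι h (orbitMap ι Hb ((1 : G) : G ⧸ Hb.comap ι)) v := h2
  have h4 : ((g' * h : G) : G ⧸ Hb.comap ι) = g' := QuotientGroup.mk_mul_of_mem g' hh
  have h5 : dAct FMb ι (g' * h) (orbitMap ι Hb ((1 : G) : G ⧸ Hb.comap ι)) v =
      dAct FMb ι g' (orbitMap ι Hb ((1 : G) : G ⧸ Hb.comap ι)) v' := by
    rw [h3, dAct_dAct hπb]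
    rw [smul_orbitMap_one, ← mul_one h, orbitMap_mk, orbitMap_mk]
    rw [map_one]
    exact QuotientGroup.eq.mpr (by simpa using hh)
  have key : ∀ (p q : G ⧸ Hb.comap ι) (v w : FMb), p = q → v = w →
      (⟨p, v⟩ : TotalSpace FMb (AmbientTangent hj)) = ⟨q, w⟩ := by
    rintro p q v w rfl rfl; rfl
  exact key _ _ _ _ h4 h5

/-- The identification of the associated bundle with the restricted tangent bundle. -/
theorem exists_equiv_associatedBundle :
    ∃ Φ : AssociatedBundle hj ≃ TotalSpace FMb (AmbientTangent hj),
      ∀ (g : G) (v : FMb), Φ (Quot.mk _ (g, v)) = frameMap hj (g, v) := by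
  let Φ : AssociatedBundle hj → TotalSpace FMb (AmbientTangent hj) :=
    Quot.lift (frameMap hj) (frameMap_eq_of_associatedRel hj hπb)
  have hΦ : Function.Bijective Φ := by
    constructor
    · rintro ⟨⟨g, (v : FMb)⟩⟩ ⟨⟨g', (v' : FMb)⟩⟩ h
      replace h : frameMap hj (g, v) = frameMap hj (g', v') := h
      have h1 : (g : G ⧸ Hb.comap ι) = g' := congrArg (fun p => p.1) h
      have h2 : dAct FMb ι g (orbitMap ι Hb ((1 : G) : G ⧸ Hb.comap ι)) v =
        dAct FMb ι g' (orbitMap ι Hb ((1 : G) : G ⧸ Hb.comap ι)) v' :=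
        congrArg (fun p => (p.2 : FMb)) h
      -- The element `h = g'⁻¹ * g` is forced by `g = g' * h`; it lies in `H` because both pairs
      -- have the same base point.
      refine Quot.sound ⟨g'⁻¹ * g, QuotientGroup.eq.mp h1.symm, by simp, ?_⟩
      change v' = dAct FMb ι (g'⁻¹ * g) (orbitMap ι Hb ((1 : G) : G ⧸ Hb.comap ι)) v
      rw [← dAct_dAct hπb _ _ _ _ (smul_orbitMap_one g), h2,
        dAct_inv_dAct hπb _ _ _ ((smul_orbitMap_one g').trans (by rw [h1]))]
    · rintro ⟨x, v⟩
      obtain ⟨g, rfl⟩ := QuotientGroup.mk_surjective x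
      refine ⟨Quot.mk _ (g, dAct FMb ι g⁻¹ (orbitMap ι Hb (g : G ⧸ Hb.comap ι)) v), ?_⟩
      have : dAct FMb ι g (orbitMap ι Hb ((1 : G) : G ⧸ Hb.comap ι))
          (dAct FMb ι g⁻¹ (orbitMap ι Hb (g : G ⧸ Hb.comap ι)) v) = v :=
        dAct_dAct_inv hπb _ _ _ (smul_orbitMap_one g) _
      exact congrArg (TotalSpace.mk (F := FMb) (E := AmbientTangent hj) (g : G ⧸ Hb.comap ι)) this
  exact ⟨Equiv.ofBijective Φ hΦ, fun g v => rfl⟩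

end Associated

section EquivariantFunction

variable (s : ∀ x : G ⧸ Hb.comap ι, AmbientTangent hj x)

/-- A section of the restricted tangent bundle, with values in the model space. -/
def modelSection (x : G ⧸ Hb.comap ι) : FMb := s x

theorem equivariantFunction_eq (g : G) :
    equivariantFunction hj s g =
      dAct FMb ι g⁻¹ (orbitMap ι Hb (g : G ⧸ Hb.comap ι)) (modelSection hj s g) := rfl

include hπb in
theorem dAct_equivariantFunction (g : G) :
    dAct FMb ι g (orbitMap ι Hb ((1 : G) : G ⧸ Hb.comap ι)) (equivariantFunction hj s g) =
      modelSection hj s g := by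
  rw [equivariantFunction_eq, dAct_dAct_inv hπb _ _ _ (smul_orbitMap_one g)]

include hπb in
theorem equivariantFunction_mul (g : G) {h : G} (hh : h ∈ Hb.comap ι) :
    equivariantFunction hj s (g * h) =
      dAct FMb ι h⁻¹ (orbitMap ι Hb ((1 : G) : G ⧸ Hb.comap ι)) (equivariantFunction hj s g) := by
  have h4 : ((g * h : G) : G ⧸ Hb.comap ι) = g := QuotientGroup.mk_mul_of_mem g hh
  rw [equivariantFunction_eq, equivariantFunction_eq, h4,
    dAct_dAct hπb _ _ _ _ (inv_smul_orbitMap g), mul_inv_rev]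

theorem mdifferentiableAt_section_iff {x : G ⧸ Hb.comap ι} :
    MDifferentiableAt 𝓘(ℝ, FM) (𝓘(ℝ, FM).prod 𝓘(ℝ, FMb))
        (fun x => (⟨x, s x⟩ : TotalSpace FMb (AmbientTangent hj))) x ↔
      MDifferentiableAt 𝓘(ℝ, FM) (𝓘(ℝ, FMb).prod 𝓘(ℝ, FMb))
        (fun x => (⟨orbitMap ι Hb x, s x⟩ : TangentBundle 𝓘(ℝ, FMb) (Gb ⧸ Hb))) x := by
  rw [mdifferentiableAt_pullback_iff (orbitInclusion hj)]
  exact ⟨fun h => h.2, fun h => ⟨mdifferentiableAt_id, h⟩⟩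

theorem contMDiffAt_section_iff {x : G ⧸ Hb.comap ι} :
    ContMDiffAt 𝓘(ℝ, FM) (𝓘(ℝ, FM).prod 𝓘(ℝ, FMb)) ∞
        (fun x => (⟨x, s x⟩ : TotalSpace FMb (AmbientTangent hj))) x ↔
      ContMDiffAt 𝓘(ℝ, FM) (𝓘(ℝ, FMb).prod 𝓘(ℝ, FMb)) ∞
        (fun x => (⟨orbitMap ι Hb x, s x⟩ : TangentBundle 𝓘(ℝ, FMb) (Gb ⧸ Hb))) x := by
  rw [contMDiffAt_pullback_iff (orbitInclusion hj)]
  exact ⟨fun h => h.2, fun h => ⟨contMDiffAt_id, h⟩⟩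

include hπb hι' hπ

/-- The function is the smooth differential of the action evaluated at `g⁻¹` and `s (g H)`. Its base
point is constantly `o`, so only the fibre component matters. -/
theorem mdifferentiableAt_equivariantFunction {s} {g : G}
    (hs : MDifferentiableAt 𝓘(ℝ, FM) (𝓘(ℝ, FM).prod 𝓘(ℝ, FMb))
        (fun x => (⟨x, s x⟩ : TotalSpace FMb (AmbientTangent hj))) (g : G ⧸ Hb.comap ι)) :
    MDifferentiableAt 𝓘(ℝ, EG) 𝓘(ℝ, FMb) (equivariantFunction hj s) g := by
  rw [← mdifferentiableAt_tangentBundle_const_base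
    (p := orbitMap ι Hb ((1 : G) : G ⧸ Hb.comap ι))]
  rw [mdifferentiableAt_section_iff] at hs
  have h0 := hs.comp g (mdifferentiable_proj_quotient hπ g)
  have hinv : MDifferentiableAt 𝓘(ℝ, EG) 𝓘(ℝ, EG) (fun x : G => x⁻¹) g :=
    (contMDiff_inv 𝓘(ℝ, EG) ∞).mdifferentiable (by simp) g
  have h1 := ((contMDiff_tangent_act (EG := EG) (Hb := Hb) hπb hι').mdifferentiable (by simp)
    (g⁻¹, ⟨orbitMap ι Hb (g : G ⧸ Hb.comap ι), s g⟩)).comp g (hinv.prodMk h0)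
  refine h1.congr_of_eventuallyEq (Eventually.of_forall fun b => ?_)
  exact (tangentBundle_mk_congr (inv_smul_orbitMap b) _).symm

theorem contMDiffAt_equivariantFunction {s} {g : G}
    (hs : ContMDiffAt 𝓘(ℝ, FM) (𝓘(ℝ, FM).prod 𝓘(ℝ, FMb)) ∞
        (fun x => (⟨x, s x⟩ : TotalSpace FMb (AmbientTangent hj))) (g : G ⧸ Hb.comap ι)) :
    ContMDiffAt 𝓘(ℝ, EG) 𝓘(ℝ, FMb) ∞ (equivariantFunction hj s) g := by
  rw [← contMDiffAt_tangentBundle_const_base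
    (p := orbitMap ι Hb ((1 : G) : G ⧸ Hb.comap ι))]
  rw [contMDiffAt_section_iff] at hs
  have h0 := hs.comp g (contMDiff_proj_quotient hπ g)
  have h1 := (contMDiff_tangent_act (EG := EG) (Hb := Hb) hπb hι'
    (g⁻¹, ⟨orbitMap ι Hb (g : G ⧸ Hb.comap ι), s g⟩)).comp g
      (((contMDiff_inv 𝓘(ℝ, EG) ∞) g).prodMk h0)
  refine h1.congr_of_eventuallyEq (Eventually.of_forall fun b => ?_)
  exact (tangentBundle_mk_congr (inv_smul_orbitMap b) _).symm

end EquivariantFunction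
end Orbit

/-! ### Sum, product and linear composition rules -/

section ModelDeriv

variable {E : Type*} [NormedAddCommGroup E] [NormedSpace ℝ E]
  {M : Type*} [TopologicalSpace M] [ChartedSpace E M]
  {E' : Type*} [NormedAddCommGroup E'] [NormedSpace ℝ E']

theorem modelDeriv_add {f g : M → E'} {x : M} (hf : MDifferentiableAt 𝓘(ℝ, E) 𝓘(ℝ, E') f x)
    (hg : MDifferentiableAt 𝓘(ℝ, E) 𝓘(ℝ, E') g x) :
    modelDeriv E E' (fun y => f y + g y) x = modelDeriv E E' f x + modelDeriv E E' g x :=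
  (hf.hasMFDerivAt.add hg.hasMFDerivAt).mfderiv

theorem hasMFDerivAt_smul {k : M → ℝ} {f : M → E'} {x : M}
    (hk : MDifferentiableAt 𝓘(ℝ, E) 𝓘(ℝ, ℝ) k x)
    (hf : MDifferentiableAt 𝓘(ℝ, E) 𝓘(ℝ, E') f x) :
    HasMFDerivAt 𝓘(ℝ, E) 𝓘(ℝ, E') (fun y => k y • f y) x
      (k x • modelDeriv E E' f x + (modelDeriv E ℝ k x).smulRight (f x) : E →L[ℝ] E') := by
  refine ⟨hk.continuousAt.smul hf.continuousAt, ?_⟩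
  have h1 := hk.hasMFDerivAt.2.smul hf.hasMFDerivAt.2
  have hx : writtenInExtChartAt 𝓘(ℝ, E) 𝓘(ℝ, ℝ) x k (extChartAt 𝓘(ℝ, E) x x) = k x := by
    simp [writtenInExtChartAt, chartAt_self_eq]
  have hx' : writtenInExtChartAt 𝓘(ℝ, E) 𝓘(ℝ, E') x f (extChartAt 𝓘(ℝ, E) x x) = f x := by
    simp [writtenInExtChartAt, chartAt_self_eq]
  rw [hx, hx'] at h1
  exact h1

theorem modelDeriv_smul {k : M → ℝ} {f : M → E'} {x : M}
    (hk : MDifferentiableAt 𝓘(ℝ, E) 𝓘(ℝ, ℝ) k x)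
    (hf : MDifferentiableAt 𝓘(ℝ, E) 𝓘(ℝ, E') f x) :
    modelDeriv E E' (fun y => k y • f y) x =
      k x • modelDeriv E E' f x + (modelDeriv E ℝ k x).smulRight (f x) :=
  (hasMFDerivAt_smul hk hf).mfderiv

/-- A continuous linear map, as a map of manifolds, is its own derivative. -/
theorem modelDeriv_clm_comp {E'' : Type*} [NormedAddCommGroup E''] [NormedSpace ℝ E'']
    (A : E' →L[ℝ] E'') {f : M → E'} {x : M}
    (hf : MDifferentiableAt 𝓘(ℝ, E) 𝓘(ℝ, E') f x) :
    modelDeriv E E'' (fun y => A (f y)) x = A ∘L modelDeriv E E' f x := by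
  have : HasMFDerivAt 𝓘(ℝ, E') 𝓘(ℝ, E'') A (f x) A := A.hasFDerivAt.hasMFDerivAt
  exact (this.comp x hf.hasMFDerivAt).mfderiv

end ModelDeriv

/-! ### Independence of the representative, and the Leibniz rule -/

section Connection

variable {EGb : Type*} [NormedAddCommGroup EGb] [NormedSpace ℝ EGb]
  {Gb : Type*} [TopologicalSpace Gb] [ChartedSpace EGb Gb] [Group Gb]
  {Hb : Subgroup Gb}
  {FMb : Type*} [NormedAddCommGroup FMb] [NormedSpace ℝ FMb]
  [ChartedSpace FMb (Gb ⧸ Hb)]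
  {EG : Type*} [NormedAddCommGroup EG] [NormedSpace ℝ EG]
  {G : Type*} [TopologicalSpace G] [ChartedSpace EG G] [Group G]
  {ι : G →* Gb}
  {FM : Type*} [NormedAddCommGroup FM] [NormedSpace ℝ FM]
  [ChartedSpace FM (G ⧸ Hb.comap ι)]
  (hj : Manifold.IsSmoothEmbedding 𝓘(ℝ, FM) 𝓘(ℝ, FMb) ∞ (orbitMap ι Hb))
  (m : Submodule ℝ EG)
  (s : ∀ x : G ⧸ Hb.comap ι, AmbientTangent hj x)

/-- The covariant derivative of the section `s`, computed at the point `g` of the principal bundle,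
as a map of model spaces. -/
noncomputable def modelInducedDeriv (g : G) : FM →L[ℝ] FMb :=
  dAct FMb ι g (orbitMap ι Hb ((1 : G) : G ⧸ Hb.comap ι)) ∘L
    modelDeriv EG FMb (equivariantFunction hj s) g ∘L hLift FM (Hb.comap ι) m g

/-- The canonical connection, as a map of model spaces. -/
noncomputable def modelConnection (x : G ⧸ Hb.comap ι) : FM →L[ℝ] FMb :=
  canonicalConnection (EG := EG) hj m s x

/-- The transport along `Quotient.out_eq x` in `inducedConnection` is invisible once both sides are
maps of model spaces. -/
theorem modelConnection_eq_out (x : G ⧸ Hb.comap ι) :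
    modelConnection hj m s x = modelInducedDeriv hj m s (Quotient.out x) := by
  have key : ∀ (y : G ⧸ Hb.comap ι) (h : y = x)
      (A : TangentSpace 𝓘(ℝ, FM) y →L[ℝ] AmbientTangent hj y),
      ((h ▸ A : TangentSpace 𝓘(ℝ, FM) x →L[ℝ] AmbientTangent hj x) : FM →L[ℝ] FMb) = A := by
    rintro y rfl A; rfl
  exact key _ (Quotient.out_eq x) (inducedDerivAt (EG := EG) hj (leftInvariantDistribution (E := EG) m) s (Quotient.out x))

variable [LieGroup 𝓘(ℝ, EGb) ∞ Gb] [IsManifold 𝓘(ℝ, FMb) ∞ (Gb ⧸ Hb)]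
  (hπb : Manifold.IsSubmersion 𝓘(ℝ, EGb) 𝓘(ℝ, FMb) ∞ (fun g : Gb => (g : Gb ⧸ Hb)))
  [LieGroup 𝓘(ℝ, EG) ∞ G] [FiniteDimensional ℝ EG]
  (hι' : Manifold.IsImmersion 𝓘(ℝ, EG) 𝓘(ℝ, EGb) ∞ ι)
  (hπ : Manifold.IsSubmersion 𝓘(ℝ, EG) 𝓘(ℝ, FM) ∞ (fun g : G => (g : G ⧸ Hb.comap ι)))
  {m} (hm : IsReductiveDecomposition (E := EG) (Hb.comap ι) m)

include hπb hι' hπ hm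

/-- The lift at `g * h` is the right translate of the lift at `g`, and `f_s ∘ R_h = (L_h)_*⁻¹ f_s`.
The factor `(L_h)_*⁻¹` then cancels against the frame `(L_{gh})_*`. -/
theorem modelInducedDeriv_mul {s} {g : G}
    (hs : MDifferentiableAt 𝓘(ℝ, FM) (𝓘(ℝ, FM).prod 𝓘(ℝ, FMb))
        (fun x => (⟨x, s x⟩ : TotalSpace FMb (AmbientTangent hj))) (g : G ⧸ Hb.comap ι))
    {h : G} (hh : h ∈ Hb.comap ι) :
    modelInducedDeriv hj m s (g * h) = modelInducedDeriv hj m s g := by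
  have h4 : ((g * h : G) : G ⧸ Hb.comap ι) = g := QuotientGroup.mk_mul_of_mem g hh
  have hf := mdifferentiableAt_equivariantFunction hj hπb hι' hπ hs
  have hf' := mdifferentiableAt_equivariantFunction (s := s) (g := g * h) hj hπb hι' hπ
    (by rw [h4]; exact hs)
  have ho : ι h • orbitMap ι Hb ((1 : G) : G ⧸ Hb.comap ι) =
      orbitMap ι Hb ((1 : G) : G ⧸ Hb.comap ι) := by
    rw [← orbitMap_smul, smul_mk_one, ← one_mul h, QuotientGroup.mk_mul_of_mem 1 hh]
  have h5 : equivariantFunction hj s ∘ (fun x : G => x * h) = fun x =>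
      dAct FMb ι h⁻¹ (orbitMap ι Hb ((1 : G) : G ⧸ Hb.comap ι)) (equivariantFunction hj s x) := by
    funext x
    exact equivariantFunction_mul hj hπb s x hh
  have h6 := modelDeriv_comp hf' (mdifferentiable_right (E := EG) h g) rfl
  rw [h5, modelDeriv_clm_comp _ hf] at h6
  ext v
  have h7 := congrArg (fun A : EG →L[ℝ] FMb => A (hLift FM (Hb.comap ι) m g v)) h6
  simp only [ContinuousLinearMap.comp_apply] at h7
  simp only [modelInducedDeriv, ContinuousLinearMap.comp_apply]
  rw [hLift_mul hπ hm g hh, ← h7, dAct_dAct hπb _ _ _ _ (by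
    rw [map_inv, inv_smul_eq_iff, ho]), mul_assoc, mul_inv_cancel, mul_one]

/-- The canonical connection can be computed at each point of the principal bundle. -/
theorem modelConnection_eq {s} {g : G} {x : G ⧸ Hb.comap ι} (hx : (g : G ⧸ Hb.comap ι) = x)
    (hs : MDifferentiableAt 𝓘(ℝ, FM) (𝓘(ℝ, FM).prod 𝓘(ℝ, FMb))
        (fun x => (⟨x, s x⟩ : TotalSpace FMb (AmbientTangent hj))) x) :
    modelConnection hj m s x = modelInducedDeriv hj m s g := by
  subst hx
  rw [modelConnection_eq_out]
  obtain ⟨h, hh⟩ := QuotientGroup.mk_out_eq_mul (Hb.comap ι) g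
  have : (Quotient.out (g : G ⧸ Hb.comap ι) : G) = g * h := hh
  rw [this, modelInducedDeriv_mul hj hπb hι' hπ hm hs h.2]

theorem canonicalConnection_eq_inducedDerivAt {s} {g : G}
    (hs : MDifferentiableAt 𝓘(ℝ, FM) (𝓘(ℝ, FM).prod 𝓘(ℝ, FMb))
        (fun x => (⟨x, s x⟩ : TotalSpace FMb (AmbientTangent hj))) (g : G ⧸ Hb.comap ι)) :
    canonicalConnection (EG := EG) hj m s (g : G ⧸ Hb.comap ι) =
        inducedDerivAt (EG := EG) hj (leftInvariantDistribution (E := EG) m) s g :=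
  modelConnection_eq hj hπb hι' hπ hm rfl hs

/-- The canonical connection is a covariant derivative. -/
theorem isCovariantDerivativeOn_canonicalConnection [IsManifold 𝓘(ℝ, FM) ∞ (G ⧸ Hb.comap ι)] :
    IsCovariantDerivativeOn (I := 𝓘(ℝ, FM)) FMb (canonicalConnection (EG := EG) hj m) Set.univ where
  add {σ σ' x} hσ hσ' _ := by
    obtain ⟨g, rfl⟩ := QuotientGroup.mk_surjective x
    have hf := mdifferentiableAt_equivariantFunction hj hπb hι' hπ hσ
    have hf' := mdifferentiableAt_equivariantFunction hj hπb hι' hπ hσ'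
    have h1 := modelConnection_eq hj hπb hι' hπ hm rfl hσ
    have h2 := modelConnection_eq hj hπb hι' hπ hm rfl hσ'
    have hadd := mdifferentiableAt_add_section hσ hσ'
    have h3 := modelConnection_eq hj hπb hι' hπ hm rfl hadd
    have h4 : equivariantFunction hj (σ + σ') = fun g =>
        equivariantFunction hj σ g + equivariantFunction hj σ' g := by
      funext g
      exact map_add (dAct FMb ι g⁻¹ (orbitMap ι Hb (g : G ⧸ Hb.comap ι)))
        (modelSection hj σ g) (modelSection hj σ' g)
    have h5 : modelConnection hj m (σ + σ') (g : G ⧸ Hb.comap ι) = modelConnection hj m σ g +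
        modelConnection hj m σ' g := by
      rw [h1, h2, h3, modelInducedDeriv, h4, modelDeriv_add hf hf', modelInducedDeriv,
        modelInducedDeriv, ContinuousLinearMap.add_comp, ContinuousLinearMap.comp_add]
    exact h5
  leibniz {σ k x} hσ hk _ := by
    obtain ⟨g, rfl⟩ := QuotientGroup.mk_surjective x
    have hf := mdifferentiableAt_equivariantFunction hj hπb hι' hπ hσ
    have h1 := modelConnection_eq hj hπb hι' hπ hm rfl hσ
    have hadd := MDifferentiableAt.smul_section hk hσ
    have h3 := modelConnection_eq hj hπb hι' hπ hm rfl hadd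
    have h4 : equivariantFunction hj (k • σ) = fun g =>
        (k ∘ fun g : G => (g : G ⧸ Hb.comap ι)) g • equivariantFunction hj σ g := by
      funext g
      exact map_smul (dAct FMb ι g⁻¹ (orbitMap ι Hb (g : G ⧸ Hb.comap ι)))
        (k g) (modelSection hj σ g)
    have hp := mdifferentiable_proj_quotient hπ g
    have h5 : modelConnection hj m (k • σ) (g : G ⧸ Hb.comap ι) =
        k g • modelConnection hj m σ g +
        (modelDeriv FM ℝ k g).smulRight (modelSection hj σ g) := by
      rw [h1, h3, modelInducedDeriv, h4, modelDeriv_smul (hk.comp g hp) hf, modelInducedDeriv,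
        modelDeriv_comp hk hp rfl]
      -- The derivative of `k ∘ π` along the lift of `v` is `dk v`, because the lift projects to
      -- `v`; applying `(L_g)_*` turns `f_σ g` back into the value of `σ`.
      ext v
      simp only [ContinuousLinearMap.comp_apply, _root_.add_apply,
        _root_.smul_apply, ContinuousLinearMap.smulRight_apply, map_add, map_smul,
        proj_hLift hπ hm, dAct_equivariantFunction hj hπb, Function.comp_apply]
    exact h5

end Connection

/-! ### Smoothness criteria for sections of bundles of homomorphisms -/

section Smooth

variable {E' : Type*} [NormedAddCommGroup E'] [NormedSpace ℝ E']
  {H' : Type*} [TopologicalSpace H'] {I : ModelWithCorners ℝ E' H'}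
  {N : Type*} [TopologicalSpace N] [ChartedSpace H' N]

/-- A map into a space of linear maps with finite-dimensional source is smooth if it is so
pointwise. -/
theorem contMDiffAt_clm_of_apply {F F' : Type*} [NormedAddCommGroup F] [NormedSpace ℝ F]
    [FiniteDimensional ℝ F] [NormedAddCommGroup F'] [NormedSpace ℝ F'] {n : ℕ∞ω}
    {A : N → F →L[ℝ] F'} {x : N} (h : ∀ v, ContMDiffAt I 𝓘(ℝ, F') n (fun y => A y v) x) :
    ContMDiffAt I 𝓘(ℝ, F →L[ℝ] F') n A x := by
  let b := Module.finBasis ℝ F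
  -- In a basis `b`, the map `A y` is the sum of the rank-one maps sending `v` to `b.coord i v • A y
  -- (b i)`, each depending on `A y (b i)` through a fixed continuous linear map.
  have h1 : A = fun y => ∑ i, ContinuousLinearMap.smulRightL ℝ F F'
      (LinearMap.toContinuousLinearMap (b.coord i)) (A y (b i)) := by
    funext y
    ext v
    have h2 : A y v = A y (∑ i, b.repr v i • b i) := by rw [b.sum_repr v]
    rw [h2, map_sum]
    simp
  rw [h1]
  refine contMDiffAt_finsetSum fun i _ => ?_
  exact (ContinuousLinearMap.contMDiff
    (ContinuousLinearMap.smulRightL ℝ F F' (LinearMap.toContinuousLinearMap (b.coord i)))).contMDiffAt.comp x (h (b i))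

variable {E : Type*} [NormedAddCommGroup E] [NormedSpace ℝ E]
  {M : Type*} [TopologicalSpace M] [ChartedSpace E M]

theorem contMDiffAt_tangentBundle_symm [IsManifold 𝓘(ℝ, E) ∞ M] (x : M) (v : E) :
    ContMDiffAt (𝓘(ℝ, E).prod 𝓘(ℝ, E)) (𝓘(ℝ, E).prod 𝓘(ℝ, E)) ∞
      (fun p : M × E => (⟨p.1, (trivializationAt E (TangentSpace 𝓘(ℝ, E) : M → Type _) x).symm
        p.1 p.2⟩ : TangentBundle 𝓘(ℝ, E) M)) (x, v) := by
  have h0 : (trivializationAt E (TangentSpace 𝓘(ℝ, E) : M → Type _) x).target ∈ 𝓝 (x, v) := by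
    refine (trivializationAt E (TangentSpace 𝓘(ℝ, E) : M → Type _) x).open_target.mem_nhds ?_
    rw [Trivialization.mem_target]
    exact mem_baseSet_trivializationAt E (TangentSpace 𝓘(ℝ, E) : M → Type _) x
  have h1 := (Bundle.Trivialization.contMDiffOn_symm (IB := 𝓘(ℝ, E)) (n := ∞)
    (trivializationAt E (TangentSpace 𝓘(ℝ, E) : M → Type _) x)).contMDiffAt h0
  refine h1.congr_of_eventuallyEq ?_
  filter_upwards [h0] with p hp
  rw [Trivialization.mem_target] at hp
  exact Trivialization.mk_symm _ hp p.2

/-- A section of a bundle of homomorphisms is smooth if it maps smooth vector fields to smooth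
sections. -/
theorem contMDiffAt_hom_of_apply [FiniteDimensional ℝ E] [IsManifold 𝓘(ℝ, E) ∞ M]
    {F : Type*} [NormedAddCommGroup F] [NormedSpace ℝ F]
    {V : M → Type*} [TopologicalSpace (TotalSpace F V)]
    [∀ x, AddCommGroup (V x)] [∀ x, Module ℝ (V x)]
    [∀ x : M, TopologicalSpace (V x)] [∀ x, IsTopologicalAddGroup (V x)]
    [∀ x, ContinuousSMul ℝ (V x)] [FiberBundle F V] [VectorBundle ℝ F V]
    (A : ∀ x : M, TangentSpace 𝓘(ℝ, E) x →L[ℝ] V x) (x : M)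
    (h : ∀ W : ∀ x : M, TangentSpace 𝓘(ℝ, E) x,
      ContMDiffAt 𝓘(ℝ, E) (𝓘(ℝ, E).prod 𝓘(ℝ, E)) ∞
        (fun y => (⟨y, W y⟩ : TangentBundle 𝓘(ℝ, E) M)) x →
      ContMDiffAt 𝓘(ℝ, E) (𝓘(ℝ, E).prod 𝓘(ℝ, F)) ∞
        (fun y => (⟨y, A y (W y)⟩ : TotalSpace F V)) x) :
    ContMDiffAt 𝓘(ℝ, E) (𝓘(ℝ, E).prod 𝓘(ℝ, E →L[ℝ] F)) ∞
      (fun y => (⟨y, A y⟩ : TotalSpace (E →L[ℝ] F) fun x => TangentSpace 𝓘(ℝ, E) x →L[ℝ] V x))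
      x := by
  rw [contMDiffAt_hom_bundle]
  refine ⟨contMDiffAt_id, contMDiffAt_clm_of_apply fun v => ?_⟩
  -- The test vector fields have the constant value `v` in the trivialization at `x`; they give the
  -- value at `v` of the coordinate expression of `A`.
  have h1 := h _ ((contMDiffAt_tangentBundle_symm x v).comp x
    (contMDiffAt_id.prodMk contMDiffAt_const))
  rw [contMDiffAt_totalSpace] at h1
  refine h1.2.congr_of_eventuallyEq ?_
  filter_upwards [(trivializationAt F V x).open_baseSet.mem_nhds
    (mem_baseSet_trivializationAt F V x),
    (trivializationAt E (TangentSpace 𝓘(ℝ, E) : M → Type _) x).open_baseSet.mem_nhds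
    (mem_baseSet_trivializationAt E (TangentSpace 𝓘(ℝ, E) : M → Type _) x)] with y hy hy'
  simp only [ContinuousLinearMap.inCoordinates, ContinuousLinearMap.comp_apply,
    Trivialization.symmL_apply (R := ℝ) _ hy']
  exact Trivialization.continuousLinearMapAt_apply_of_mem (R := ℝ) (trivializationAt F V x) hy
    (A y ((trivializationAt E (TangentSpace 𝓘(ℝ, E) : M → Type _) x).symm y v))

/-- The derivative of a vector-valued function along a smooth family of tangent vectors. -/
theorem contMDiffAt_modelDeriv_apply {F : Type*} [NormedAddCommGroup F] [NormedSpace ℝ F]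
    [IsManifold 𝓘(ℝ, E) 1 M] {f : M → F} (hf : ContMDiff 𝓘(ℝ, E) 𝓘(ℝ, F) ∞ f)
    {p : N → M} {u : N → E} {x : N}
    (hu : ContMDiffAt I (𝓘(ℝ, E).prod 𝓘(ℝ, E)) ∞
      (fun y => (⟨p y, u y⟩ : TangentBundle 𝓘(ℝ, E) M)) x) :
    ContMDiffAt I 𝓘(ℝ, F) ∞ (fun y => modelDeriv E F f (p y) (u y)) x := by
  have h1 : ContMDiff (𝓘(ℝ, E).prod 𝓘(ℝ, E)) (𝓘(ℝ, F).prod 𝓘(ℝ, F)) ∞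
    (tangentMap 𝓘(ℝ, E) 𝓘(ℝ, F) f) := hf.contMDiff_tangentMap (by simp)
  exact ((contMDiff_snd_tangentBundle_modelSpace F 𝓘(ℝ, F)).comp h1).contMDiffAt.comp x hu

end Smooth

/-! ### Smoothness of horizontal lifts -/

section HorizontalLift

variable {E' : Type*} [NormedAddCommGroup E'] [NormedSpace ℝ E']
  {H' : Type*} [TopologicalSpace H'] {I : ModelWithCorners ℝ E' H'}
  {N : Type*} [TopologicalSpace N] [ChartedSpace H' N]
  {E : Type*} [NormedAddCommGroup E] [NormedSpace ℝ E] [FiniteDimensional ℝ E]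
  {G : Type*} [TopologicalSpace G] [ChartedSpace E G] [Group G] [LieGroup 𝓘(ℝ, E) ∞ G]
  {F : Type*} [NormedAddCommGroup F] [NormedSpace ℝ F]
  {K : Subgroup G} [ChartedSpace F (G ⧸ K)] [IsManifold 𝓘(ℝ, F) ∞ (G ⧸ K)]
  (hπ : Manifold.IsSubmersion 𝓘(ℝ, E) 𝓘(ℝ, F) ∞ (fun g : G => (g : G ⧸ K)))
  {m : Submodule ℝ E} (hm : IsReductiveDecomposition (E := E) K m)

include hπ hm

/-- The horizontal lift of a smooth family of tangent vectors is smooth. -/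
theorem contMDiffAt_hLift {g : N → G} {w : N → F} {x : N}
    (hg : ContMDiffAt I 𝓘(ℝ, E) ∞ g x)
    (hw : ContMDiffAt I (𝓘(ℝ, F).prod 𝓘(ℝ, F)) ∞
      (fun y => (⟨(g y : G ⧸ K), w y⟩ : TangentBundle 𝓘(ℝ, F) (G ⧸ K))) x) :
    ContMDiffAt I (𝓘(ℝ, E).prod 𝓘(ℝ, E)) ∞
      (fun y => (⟨g y, hLift F K m (g y) (w y)⟩ : TangentBundle 𝓘(ℝ, E) G)) x := by
  have := contMDiffSMul_quotient K hπ
  -- By left invariance the lift factors into three smooth operations: move the vector to `o` by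
  -- `g⁻¹`, apply the fixed linear map `hLift F K m 1`, and translate back by `g`.
  have h1 := (contMDiff_tangent_smul (E := E) (G := G) (F := F) (M := G ⧸ K)
    ((g x)⁻¹, ⟨(g x : G ⧸ K), w x⟩)).comp x (hg.inv.prodMk hw)
  have h2 : ContMDiffAt I (𝓘(ℝ, F).prod 𝓘(ℝ, F)) ∞ (fun y => (⟨((1 : G) : G ⧸ K),
      modelDeriv F F (fun p : G ⧸ K => (g y)⁻¹ • p) (g y : G ⧸ K) (w y)⟩ :
      TangentBundle 𝓘(ℝ, F) (G ⧸ K))) x :=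
    h1.congr_of_eventuallyEq (Eventually.of_forall fun y =>
      (tangentBundle_mk_congr (inv_smul_mk (g y)) _).symm)
  rw [contMDiffAt_tangentBundle_const_base] at h2
  have h3 := (hLift F K m 1).contMDiff.contMDiffAt.comp x h2
  have h4 : ContMDiffAt I (𝓘(ℝ, E).prod 𝓘(ℝ, E)) ∞ (fun y => (⟨(1 : G), hLift F K m 1
      (modelDeriv F F (fun p : G ⧸ K => (g y)⁻¹ • p) (g y : G ⧸ K) (w y))⟩ :
      TangentBundle 𝓘(ℝ, E) G)) x := contMDiffAt_tangentBundle_const_base.mpr h3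
  have h5 := (contMDiff_tangent_smul (E := E) (G := G) (F := E) (M := G) (g x, _)).comp x
    (hg.prodMk h4)
  refine h5.congr_of_eventuallyEq (Eventually.of_forall fun y => ?_)
  dsimp only
  rw [hLift_eq_dLeft hπ hm]
  exact (tangentBundle_mk_congr (mul_one (g y)) _).symm

end HorizontalLift

/-! ### Smoothness of the canonical connection -/

section Connection

variable {EGb : Type*} [NormedAddCommGroup EGb] [NormedSpace ℝ EGb]
  {Gb : Type*} [TopologicalSpace Gb] [ChartedSpace EGb Gb] [Group Gb]
  {Hb : Subgroup Gb}
  {FMb : Type*} [NormedAddCommGroup FMb] [NormedSpace ℝ FMb]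
  [ChartedSpace FMb (Gb ⧸ Hb)]
  {EG : Type*} [NormedAddCommGroup EG] [NormedSpace ℝ EG]
  {G : Type*} [TopologicalSpace G] [ChartedSpace EG G] [Group G]
  {ι : G →* Gb}
  {FM : Type*} [NormedAddCommGroup FM] [NormedSpace ℝ FM] [FiniteDimensional ℝ FM]
  [ChartedSpace FM (G ⧸ Hb.comap ι)] [IsManifold 𝓘(ℝ, FM) ∞ (G ⧸ Hb.comap ι)]
  (hj : Manifold.IsSmoothEmbedding 𝓘(ℝ, FM) 𝓘(ℝ, FMb) ∞ (orbitMap ι Hb))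
  [LieGroup 𝓘(ℝ, EGb) ∞ Gb] [IsManifold 𝓘(ℝ, FMb) ∞ (Gb ⧸ Hb)]
  (hπb : Manifold.IsSubmersion 𝓘(ℝ, EGb) 𝓘(ℝ, FMb) ∞ (fun g : Gb => (g : Gb ⧸ Hb)))
  [LieGroup 𝓘(ℝ, EG) ∞ G] [FiniteDimensional ℝ EG]
  (hι' : Manifold.IsImmersion 𝓘(ℝ, EG) 𝓘(ℝ, EGb) ∞ ι)
  (hπ : Manifold.IsSubmersion 𝓘(ℝ, EG) 𝓘(ℝ, FM) ∞ (fun g : G => (g : G ⧸ Hb.comap ι)))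
  {m : Submodule ℝ EG} (hm : IsReductiveDecomposition (E := EG) (Hb.comap ι) m)

include hπb hι' hπ hm

/-- The canonical connection is smooth. -/
theorem contMDiffCovariantDerivativeOn_canonicalConnection :
    ContMDiffCovariantDerivativeOn (I := 𝓘(ℝ, FM)) FMb ∞ (canonicalConnection (EG := EG) hj m)
      Set.univ where
  contMDiff {s} hs := by
    rw [contMDiffOn_univ] at hs ⊢
    replace hs : ContMDiff 𝓘(ℝ, FM) (𝓘(ℝ, FM).prod 𝓘(ℝ, FMb)) ∞
      (fun x => (⟨x, s x⟩ : TotalSpace FMb (AmbientTangent hj))) := hs.of_le (by simp)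
    intro x
    refine contMDiffAt_hom_of_apply _ x fun W hW => ?_
    obtain ⟨g, rfl⟩ := QuotientGroup.mk_surjective x
    -- `Quotient.out` need not be continuous. Independence of the representative allows the
    -- connection to be computed at `σ y` for a smooth local section `σ`.
    obtain ⟨σ, hσ, hσx, hσf⟩ := exists_local_section (isSubmersionAt_of_isSubmersion hπ g)
    have hf : ContMDiff 𝓘(ℝ, EG) 𝓘(ℝ, FMb) ∞ (equivariantFunction hj s) := fun g =>
      contMDiffAt_equivariantFunction hj hπb hι' hπ (hs g)
    have h1 : ContMDiffAt 𝓘(ℝ, FM) (𝓘(ℝ, FM).prod 𝓘(ℝ, FM)) ∞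
        (fun y => (⟨(σ y : G ⧸ Hb.comap ι), W y⟩ : TangentBundle 𝓘(ℝ, FM) (G ⧸ Hb.comap ι))) g := by
      refine hW.congr_of_eventuallyEq ?_
      filter_upwards [hσf] with y hy
      exact tangentBundle_mk_congr hy _
    have h2 := contMDiffAt_modelDeriv_apply hf (contMDiffAt_hLift hπ hm hσ h1)
    have h3 := (contMDiff_frameMap hj hπb hι' hπ).contMDiffAt.comp (g : G ⧸ Hb.comap ι)
      (hσ.prodMk h2)
    refine h3.congr_of_eventuallyEq ?_
    filter_upwards [hσf] with y hy
    have h4 := modelConnection_eq hj hπb hι' hπ hm hy (hs.mdifferentiable (by simp) y)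
    have key : ∀ (p q : G ⧸ Hb.comap ι) (v w : FMb), p = q → v = w →
        (⟨p, v⟩ : TotalSpace FMb (AmbientTangent hj)) = ⟨q, w⟩ := by
      rintro p q v w rfl rfl; rfl
    exact key _ _ _ _ hy.symm (congrArg (fun A : FM →L[ℝ] FMb => A (W y)) h4)

end Connection

/-! ### Derivatives of a smooth family of maps at a common fixed point -/

section Family

variable {E' : Type*} [NormedAddCommGroup E'] [NormedSpace ℝ E']
  {H' : Type*} [TopologicalSpace H'] {I : ModelWithCorners ℝ E' H'}
  {N : Type*} [TopologicalSpace N] [ChartedSpace H' N] [IsManifold I ∞ N]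
  {F : Type*} [NormedAddCommGroup F] [NormedSpace ℝ F]
  {M : Type*} [TopologicalSpace M] [ChartedSpace F M] [IsManifold 𝓘(ℝ, F) ∞ M]

/-- The derivatives at a point of a smooth family of maps that all fix this point form a smooth
family of linear maps. -/
theorem contMDiffAt_mfderiv_of_fixed {f : N → M → M} {p : M} {x : N} (v : F)
    (hf : ContMDiffAt (I.prod 𝓘(ℝ, F)) 𝓘(ℝ, F) ∞ (Function.uncurry f) (x, p))
    (hp : ∀ y, f y p = p) :
    ContMDiffAt I 𝓘(ℝ, F) ∞ (fun y => modelDeriv F F (f y) p v) x := by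
  have h1 := ContMDiffAt.mfderiv (x₀ := x) (m := ∞) (n := ∞) f (fun _ => p) hf
    contMDiffAt_const (by simp)
  have hc : ContMDiffAt I (𝓘(ℝ, F).prod 𝓘(ℝ, F)) ∞
      (fun _ : N => (⟨p, v⟩ : TangentBundle 𝓘(ℝ, F) M)) x := contMDiffAt_const
  have h3 : ContMDiffAt I (𝓘(ℝ, F).prod 𝓘(ℝ, F)) ∞
      (fun y => (⟨f y p, modelDeriv F F (f y) p v⟩ : TangentBundle 𝓘(ℝ, F) M)) x :=
    ContMDiffAt.clm_apply_of_inCoordinates (F₁ := F) (F₂ := F)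
      (E₁ := (TangentSpace 𝓘(ℝ, F) : M → Type _)) (E₂ := (TangentSpace 𝓘(ℝ, F) : M → Type _))
      (ϕ := fun y => mfderiv 𝓘(ℝ, F) 𝓘(ℝ, F) (f y) p)
      (v := fun _ => v) h1 (b₁ := fun _ => p) (b₂ := fun y => f y p)
      hc
      (contMDiffAt_const (c := p) |>.congr_of_eventuallyEq (Eventually.of_forall hp))
  exact contMDiffAt_tangentBundle_const_base.mp (h3.congr_of_eventuallyEq
    (Eventually.of_forall fun y => (tangentBundle_mk_congr (hp y) _).symm))

end Family

/-! ### The Lie bracket and the derivative of the adjoint representation -/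

section Bracket

variable {E : Type*} [NormedAddCommGroup E] [NormedSpace ℝ E]
  {G : Type*} [TopologicalSpace G] [ChartedSpace E G] [Group G] [LieGroup 𝓘(ℝ, E) ∞ G]

/-- The adjoint representation as a map of model spaces. -/
noncomputable def modelAd (g : G) : E →L[ℝ] E := Ad g

theorem modelAd_one : modelAd (E := E) (1 : G) = ContinuousLinearMap.id ℝ E := by
  have : (fun x : G => 1 * x * 1⁻¹) = id := by funext x; simp
  change modelDeriv E E (fun x : G => 1 * x * 1⁻¹) 1 = _
  rw [this, modelDeriv_id]

theorem contMDiff_modelAd_inv (w : E) :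
    ContMDiff 𝓘(ℝ, E) 𝓘(ℝ, E) ∞ (fun g : G => modelAd (E := E) g⁻¹ w) := fun g => by
  refine contMDiffAt_mfderiv_of_fixed (f := fun (g x : G) => g⁻¹ * x * g⁻¹⁻¹) (p := (1 : G)) w
    (ContMDiff.contMDiffAt ?_) (fun y => by simp)
  have h1 : ContMDiff (𝓘(ℝ, E).prod 𝓘(ℝ, E)) 𝓘(ℝ, E) ∞ (fun q : G × G => q.1⁻¹) :=
    contMDiff_fst.inv
  exact (h1.mul contMDiff_snd).mul h1.inv

variable (G) in
/-- The product of the group in the chart at `1`. -/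
noncomputable def chartMul (p : E × E) : E :=
  extChartAt 𝓘(ℝ, E) (1 : G)
    ((extChartAt 𝓘(ℝ, E) (1 : G)).symm p.1 * (extChartAt 𝓘(ℝ, E) (1 : G)).symm p.2)

theorem contMDiffAt_extChartAt_symm_of_mem {y : E}
    (hy : y ∈ (extChartAt 𝓘(ℝ, E) (1 : G)).target) :
    ContMDiffAt 𝓘(ℝ, E) 𝓘(ℝ, E) ∞ (extChartAt 𝓘(ℝ, E) (1 : G)).symm y :=
  (contMDiffOn_extChartAt_symm (1 : G)).contMDiffAt
    ((isOpen_extChartAt_target (1 : G)).mem_nhds hy)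

theorem contMDiffAt_extChartAt_of_mem {g : G}
    (hy : g ∈ (extChartAt 𝓘(ℝ, E) (1 : G)).source) :
    ContMDiffAt 𝓘(ℝ, E) 𝓘(ℝ, E) ∞ (extChartAt 𝓘(ℝ, E) (1 : G)) g :=
  contMDiffAt_extChartAt' (by simpa using hy)

theorem contDiffAt_chartMul {y z : E} (hy : y ∈ (extChartAt 𝓘(ℝ, E) (1 : G)).target)
    (hz : z ∈ (extChartAt 𝓘(ℝ, E) (1 : G)).target)
    (h : (extChartAt 𝓘(ℝ, E) (1 : G)).symm y * (extChartAt 𝓘(ℝ, E) (1 : G)).symm z ∈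
      (extChartAt 𝓘(ℝ, E) (1 : G)).source) :
    ContDiffAt ℝ ∞ (chartMul (E := E) G) (y, z) := by
  have h1 : ContMDiffAt (𝓘(ℝ, E).prod 𝓘(ℝ, E)) 𝓘(ℝ, E) ∞
      (fun p : E × E => (extChartAt 𝓘(ℝ, E) (1 : G)).symm p.1) (y, z) :=
    ContMDiffAt.comp (y, z) (contMDiffAt_extChartAt_symm_of_mem hy) contMDiffAt_fst
  have h2 : ContMDiffAt (𝓘(ℝ, E).prod 𝓘(ℝ, E)) 𝓘(ℝ, E) ∞
      (fun p : E × E => (extChartAt 𝓘(ℝ, E) (1 : G)).symm p.2) (y, z) :=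
    ContMDiffAt.comp (y, z) (contMDiffAt_extChartAt_symm_of_mem hz) contMDiffAt_snd
  have h3 : ContMDiffAt (𝓘(ℝ, E).prod 𝓘(ℝ, E)) 𝓘(ℝ, E) ∞ (chartMul (E := E) G) (y, z) :=
    ContMDiffAt.comp (y, z) (contMDiffAt_extChartAt_of_mem h) (h1.mul h2)
  rw [← modelWithCornersSelf_prod, chartedSpaceSelf_prod] at h3
  exact h3.contDiffAt

theorem modelDeriv_extChartAt_symm_self :
    modelDeriv E E (extChartAt 𝓘(ℝ, E) (1 : G)).symm (extChartAt 𝓘(ℝ, E) (1 : G) 1) =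
      ContinuousLinearMap.id ℝ E := by
  have h := mfderivWithin_range_extChartAt_symm (I := 𝓘(ℝ, E)) (x := (1 : G))
  rw [ModelWithCorners.range_eq_univ, mfderivWithin_univ] at h
  exact h

theorem modelDeriv_extChartAt_self :
    modelDeriv E E (extChartAt 𝓘(ℝ, E) (1 : G)) 1 = ContinuousLinearMap.id ℝ E :=
  mfderiv_extChartAt_self

theorem extChartAt_symm_one :
    (extChartAt 𝓘(ℝ, E) (1 : G)).symm (extChartAt 𝓘(ℝ, E) (1 : G) 1) = 1 := by simp

/-- With `g` the point of coordinate `y`, the map `z ↦ chartMul G (y, z)` is left translation by `g`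
in coordinates. Its derivative at the coordinate of `1` is therefore the left-invariant field
generated by `v`, read in the chart. -/
theorem fderiv_chartMul_right {y : E} (hy : y ∈ (extChartAt 𝓘(ℝ, E) (1 : G)).target) (v : E) :
    fderiv ℝ (chartMul (E := E) G) (y, extChartAt 𝓘(ℝ, E) (1 : G) 1) (0, v) =
      modelDeriv E E (extChartAt 𝓘(ℝ, E) (1 : G)) ((extChartAt 𝓘(ℝ, E) (1 : G)).symm y)
        (dLeft ((extChartAt 𝓘(ℝ, E) (1 : G)).symm y) v) := by
  set e := extChartAt 𝓘(ℝ, E) (1 : G) 1 with he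
  set g := (extChartAt 𝓘(ℝ, E) (1 : G)).symm y with hg
  have hgs : g ∈ (extChartAt 𝓘(ℝ, E) (1 : G)).source := (extChartAt 𝓘(ℝ, E) (1 : G)).map_target hy
  have het : e ∈ (extChartAt 𝓘(ℝ, E) (1 : G)).target := mem_extChartAt_target (1 : G)
  have h1 := HasFDerivAt.comp (g := chartMul G) (f := fun z => (y, z)) e
    ((contDiffAt_chartMul (G := G) hy het (by
      rw [extChartAt_symm_one, mul_one]; exact hgs)).differentiableAt
        (by simp)).hasFDerivAt (hasFDerivAt_prodMk_right y e)
  have h2 : (chartMul G ∘ fun z => (y, z)) = extChartAt 𝓘(ℝ, E) (1 : G) ∘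
      ((fun x => g * x) ∘ (extChartAt 𝓘(ℝ, E) (1 : G)).symm) := rfl
  have hd := (contMDiffAt_extChartAt_symm_of_mem het).mdifferentiableAt (by simp)
  have h4 := modelDeriv_comp_apply (y := g)
    ((contMDiffAt_extChartAt_of_mem hgs).mdifferentiableAt (by simp))
    ((mdifferentiable_left (E := E) g _).comp e hd)
    (by simp [he]) v
  rw [modelDeriv_comp_apply (mdifferentiable_left (E := E) g 1) hd extChartAt_symm_one,
    modelDeriv_extChartAt_symm_self, ← h2] at h4
  have h5 : modelDeriv E E (chartMul G ∘ fun z => (y, z)) e = fderiv ℝ (chartMul G ∘ fun z => (y, z)) e :=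
    mfderiv_eq_fderiv
  rw [h5, h1.fderiv] at h4
  simpa using! h4

/-- This is `dR_g = dL_g ∘ Ad g⁻¹` at `1`, in coordinates. It holds throughout the chart, so it can
be differentiated in `y`, which produces the derivative of `Ad`. -/
theorem fderiv_chartMul_left {y : E} (hy : y ∈ (extChartAt 𝓘(ℝ, E) (1 : G)).target) (w : E) :
    fderiv ℝ (chartMul (E := E) G) (extChartAt 𝓘(ℝ, E) (1 : G) 1, y) (w, 0) =
      fderiv ℝ (chartMul (E := E) G) (y, extChartAt 𝓘(ℝ, E) (1 : G) 1)
        (0, modelAd (E := E) ((extChartAt 𝓘(ℝ, E) (1 : G)).symm y)⁻¹ w) := by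
  rw [fderiv_chartMul_right hy]
  set e := extChartAt 𝓘(ℝ, E) (1 : G) 1 with he
  set g := (extChartAt 𝓘(ℝ, E) (1 : G)).symm y with hg
  have hgs : g ∈ (extChartAt 𝓘(ℝ, E) (1 : G)).source := (extChartAt 𝓘(ℝ, E) (1 : G)).map_target hy
  have het : e ∈ (extChartAt 𝓘(ℝ, E) (1 : G)).target := mem_extChartAt_target (1 : G)
  have h1 := HasFDerivAt.comp (g := chartMul G) (f := fun z => (z, y)) e
    ((contDiffAt_chartMul (G := G) het hy (by
      rw [extChartAt_symm_one, one_mul]; exact hgs)).differentiableAt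
        (by simp)).hasFDerivAt (hasFDerivAt_prodMk_left e y)
  have h2 : (chartMul G ∘ fun z => (z, y)) = extChartAt 𝓘(ℝ, E) (1 : G) ∘
      ((fun x => x * g) ∘ (extChartAt 𝓘(ℝ, E) (1 : G)).symm) := rfl
  have hd := (contMDiffAt_extChartAt_symm_of_mem het).mdifferentiableAt (by simp)
  have h4 := modelDeriv_comp_apply (y := g)
    ((contMDiffAt_extChartAt_of_mem hgs).mdifferentiableAt (by simp))
    ((mdifferentiable_right (E := E) g _).comp e hd)
    (by simp [he]) w
  rw [modelDeriv_comp_apply (mdifferentiable_right (E := E) g 1) hd extChartAt_symm_one,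
    modelDeriv_extChartAt_symm_self, ← h2] at h4
  have h5 : modelDeriv E E (chartMul G ∘ fun z => (z, y)) e = fderiv ℝ (chartMul G ∘ fun z => (z, y)) e :=
    mfderiv_eq_fderiv
  have h6 := modelDeriv_right_dLeft (E := E) (1 : G) g w
  rw [dLeft_one, one_mul] at h6
  rw [h5, h1.fderiv] at h4
  have h7 : modelDeriv E E (fun y : G => y * g) 1 w = dLeft g (modelAd (E := E) g⁻¹ w) := h6
  rw [← h7]
  simpa using! h4

theorem hasFDerivAt_fderiv_chartMul :
    HasFDerivAt (fderiv ℝ (chartMul (E := E) G))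
      (fderiv ℝ (fderiv ℝ (chartMul (E := E) G))
        (extChartAt 𝓘(ℝ, E) (1 : G) 1, extChartAt 𝓘(ℝ, E) (1 : G) 1))
      (extChartAt 𝓘(ℝ, E) (1 : G) 1, extChartAt 𝓘(ℝ, E) (1 : G) 1) := by
  have het := mem_extChartAt_target (I := 𝓘(ℝ, E)) (1 : G)
  have h1 := contDiffAt_chartMul (G := G) het het (by
    rw [extChartAt_symm_one, mul_one]; exact mem_extChartAt_source (1 : G))
  exact ((h1.fderiv_right (m := 1) (by norm_cast)).differentiableAt (by simp)).hasFDerivAt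

theorem hasFDerivAt_fderiv_chartMul_right (v : E) :
    HasFDerivAt (fun y => fderiv ℝ (chartMul (E := E) G) (y, extChartAt 𝓘(ℝ, E) (1 : G) 1) (0, v))
      (((ContinuousLinearMap.apply ℝ E ((0, v) : E × E)) ∘L (fderiv ℝ (fderiv ℝ (chartMul (E := E) G))
        (extChartAt 𝓘(ℝ, E) (1 : G) 1, extChartAt 𝓘(ℝ, E) (1 : G) 1))) ∘L
        ContinuousLinearMap.inl ℝ E E)
      (extChartAt 𝓘(ℝ, E) (1 : G) 1) :=
  HasFDerivAt.comp (f := fun y => (y, extChartAt 𝓘(ℝ, E) (1 : G) 1))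
    (g := fun p => fderiv ℝ (chartMul (E := E) G) p (0, v)) _
    ((ContinuousLinearMap.apply ℝ E ((0, v) : E × E)).hasFDerivAt.comp _
      hasFDerivAt_fderiv_chartMul) (hasFDerivAt_prodMk_left _ _)

theorem hasFDerivAt_fderiv_chartMul_left (w : E) :
    HasFDerivAt (fun y => fderiv ℝ (chartMul (E := E) G) (extChartAt 𝓘(ℝ, E) (1 : G) 1, y) (w, 0))
      (((ContinuousLinearMap.apply ℝ E ((w, 0) : E × E)) ∘L (fderiv ℝ (fderiv ℝ (chartMul (E := E) G))
        (extChartAt 𝓘(ℝ, E) (1 : G) 1, extChartAt 𝓘(ℝ, E) (1 : G) 1))) ∘L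
        ContinuousLinearMap.inr ℝ E E)
      (extChartAt 𝓘(ℝ, E) (1 : G) 1) :=
  HasFDerivAt.comp (f := fun y => (extChartAt 𝓘(ℝ, E) (1 : G) 1, y))
    (g := fun p => fderiv ℝ (chartMul (E := E) G) p (w, 0)) _
    ((ContinuousLinearMap.apply ℝ E ((w, 0) : E × E)).hasFDerivAt.comp _
      hasFDerivAt_fderiv_chartMul) (hasFDerivAt_prodMk_right _ _)

variable (G) in
/-- The bracket of the Lie algebra as a map of model spaces. -/
noncomputable def modelBracket (v w : E) : E :=
  Bracket.bracket (L := GroupLieAlgebra 𝓘(ℝ, E) G) (M := GroupLieAlgebra 𝓘(ℝ, E) G) v w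

/-- The bracket of the Lie algebra is the antisymmetrization of the second derivative of the
product in the chart at `1`. -/
theorem modelBracket_eq (v w : E) :
    modelBracket G v w =
      fderiv ℝ (fderiv ℝ (chartMul (E := E) G))
        (extChartAt 𝓘(ℝ, E) (1 : G) 1, extChartAt 𝓘(ℝ, E) (1 : G) 1) (v, 0) (0, w) -
      fderiv ℝ (fderiv ℝ (chartMul (E := E) G))
        (extChartAt 𝓘(ℝ, E) (1 : G) 1, extChartAt 𝓘(ℝ, E) (1 : G) 1) (w, 0) (0, v) := by
  set e := extChartAt 𝓘(ℝ, E) (1 : G) 1 with he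
  -- The bracket is computed from the left-invariant fields pulled back to the chart, and near `e`
  -- these are partial derivatives of the product in its second variable.
  have hfield : ∀ u : E, (VectorField.mpullbackWithin 𝓘(ℝ, E) 𝓘(ℝ, E)
      (extChartAt 𝓘(ℝ, E) (1 : G)).symm
      (mulInvariantVectorField (I := 𝓘(ℝ, E)) (G := G) u) (range 𝓘(ℝ, E)) : E → E) =ᶠ[𝓝 e]
      fun y => fderiv ℝ (chartMul (E := E) G) (y, e) (0, u) := by
    intro u
    filter_upwards [(isOpen_extChartAt_target (1 : G)).mem_nhds
      (mem_extChartAt_target (I := 𝓘(ℝ, E)) (1 : G))] with y hy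
    rw [fderiv_chartMul_right hy]
    have h1 := ContinuousLinearMap.inverse_eq
      (mfderivWithin_extChartAt_symm_comp_mfderiv_extChartAt (I := 𝓘(ℝ, E)) hy)
      (mfderiv_extChartAt_comp_mfderivWithin_extChartAt_symm (I := 𝓘(ℝ, E)) hy)
    rw [VectorField.mpullbackWithin_apply, h1]
    rfl
  have hval : ∀ u : E, fderiv ℝ (chartMul (E := E) G) (e, e) (0, u) = u := by
    intro u
    rw [fderiv_chartMul_right (mem_extChartAt_target (1 : G)), extChartAt_symm_one,
      modelDeriv_extChartAt_self, dLeft_one]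
    rfl
  have hd : ∀ u x : E, fderiv ℝ (fun y => fderiv ℝ (chartMul (E := E) G) (y, e) (0, u)) e x =
      fderiv ℝ (fderiv ℝ (chartMul (E := E) G)) (e, e) (x, 0) (0, u) := by
    intro u x
    rw [(hasFDerivAt_fderiv_chartMul_right u).fderiv]
    rfl
  let V : E → E → E := fun u => VectorField.mpullbackWithin 𝓘(ℝ, E) 𝓘(ℝ, E)
      (extChartAt 𝓘(ℝ, E) (1 : G)).symm
      (mulInvariantVectorField (I := 𝓘(ℝ, E)) (G := G) u) (range 𝓘(ℝ, E))
  have h1 : modelBracket G v w = (modelDeriv E E (extChartAt 𝓘(ℝ, E) (1 : G)) 1).inverse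
      (VectorField.lieBracketWithin ℝ (V v) (V w)
      ((extChartAt 𝓘(ℝ, E) (1 : G)).symm ⁻¹' univ ∩ range 𝓘(ℝ, E)) e) :=
    VectorField.mlieBracketWithin_apply
  have h2 : (extChartAt 𝓘(ℝ, E) (1 : G)).symm ⁻¹' univ ∩ range 𝓘(ℝ, E) = univ := by simp
  have h3 : VectorField.lieBracketWithin ℝ (V v) (V w) univ e = VectorField.lieBracketWithin ℝ
      (fun y => fderiv ℝ (chartMul (E := E) G) (y, e) (0, v))
      (fun y => fderiv ℝ (chartMul (E := E) G) (y, e) (0, w)) univ e :=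
    (hfield v).lieBracketWithin_vectorField_eq_nhds (hfield w)
  rw [h1, h2, h3, VectorField.lieBracketWithin_univ, VectorField.lieBracket,
    modelDeriv_extChartAt_self]
  rw [hd, hd, hval, hval]
  have : (ContinuousLinearMap.id ℝ E).inverse = ContinuousLinearMap.id ℝ E :=
    ContinuousLinearMap.inverse_id
  rw [this]
  rfl

/-- The derivative of `g ↦ Ad g⁻¹ w` at `1` is the negative of the bracket. -/
theorem modelDeriv_modelAd_inv (v w : E) :
    modelDeriv E E (fun g : G => modelAd (E := E) g⁻¹ w) 1 v = -modelBracket G v w := by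
  set e := extChartAt 𝓘(ℝ, E) (1 : G) 1 with he
  have het : e ∈ (extChartAt 𝓘(ℝ, E) (1 : G)).target := mem_extChartAt_target (1 : G)
  have hsm : ContDiffAt ℝ ∞ (chartMul (E := E) G) (e, e) := contDiffAt_chartMul het het (by
    rw [extChartAt_symm_one, mul_one]; exact mem_extChartAt_source (1 : G))
  set Φ : E → E := (fun g : G => modelAd (E := E) g⁻¹ w) ∘ (extChartAt 𝓘(ℝ, E) (1 : G)).symm with hΦ
  have hψ := (contMDiffAt_extChartAt_symm_of_mem het).mdifferentiableAt (by simp)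
  have hA : MDifferentiableAt 𝓘(ℝ, E) 𝓘(ℝ, E) (fun g : G => modelAd (E := E) g⁻¹ w) 1 :=
    (contMDiff_modelAd_inv w).mdifferentiable (by simp) 1
  have hΦd : DifferentiableAt ℝ Φ e := by
    rw [← mdifferentiableAt_iff_differentiableAt]
    refine MDifferentiableAt.comp e ?_ hψ
    rw [extChartAt_symm_one]
    exact hA
  have h1 : fderiv ℝ Φ e v = modelDeriv E E (fun g : G => modelAd (E := E) g⁻¹ w) 1 v := by
    have h2 := modelDeriv_comp_apply hA hψ extChartAt_symm_one v
    rw [modelDeriv_extChartAt_symm_self] at h2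
    have h3 : modelDeriv E E Φ e = fderiv ℝ Φ e := mfderiv_eq_fderiv
    rw [← h3]
    exact h2
  have hΦe : Φ e = w := by
    rw [hΦ, Function.comp_apply, extChartAt_symm_one, inv_one, modelAd_one]
    rfl
  have hval : ∀ u : E, fderiv ℝ (chartMul (E := E) G) (e, e) (0, u) = u := by
    intro u
    rw [fderiv_chartMul_right (mem_extChartAt_target (1 : G)), extChartAt_symm_one,
      modelDeriv_extChartAt_self, dLeft_one]
    rfl
  -- Write `μ` for the product in the chart. Differentiating this identity at `e` along `v` gives
  -- `D²μ (0, v) (w, 0)` on the left, and `D²μ (v, 0) (0, w) + Φ' v` on the right by the product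
  -- rule and `hval`. Symmetry of `D²μ` then identifies `Φ' v` with the negative of the bracket in
  -- `modelBracket_eq`.
  have hev : (fun y => fderiv ℝ (chartMul (E := E) G) (e, y) (w, 0)) =ᶠ[𝓝 e]
      fun y => fderiv ℝ (chartMul (E := E) G) (y, e) (0, Φ y) := by
    filter_upwards [(isOpen_extChartAt_target (1 : G)).mem_nhds
      (mem_extChartAt_target (I := 𝓘(ℝ, E)) (1 : G))] with y hy
    exact fderiv_chartMul_left hy w
  have hl := (hasFDerivAt_fderiv_chartMul_left (G := G) w).fderiv
  have h4 : HasFDerivAt (fun y => fderiv ℝ (chartMul (E := E) G) (y, e))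
      (fderiv ℝ (fderiv ℝ (chartMul (E := E) G)) (e, e) ∘L ContinuousLinearMap.inl ℝ E E) e :=
    HasFDerivAt.comp (f := fun y => (y, e)) (g := fderiv ℝ (chartMul (E := E) G)) e
      hasFDerivAt_fderiv_chartMul (hasFDerivAt_prodMk_left _ _)
  have h5 : HasFDerivAt (fun y => ((0 : E), Φ y)) _ e :=
    (hasFDerivAt_const (0 : E) e).prodMk hΦd.hasFDerivAt
  have h6 := (h4.clm_apply h5).fderiv
  rw [← hev.fderiv_eq, hl] at h6
  have h7 := congrArg (fun A : E →L[ℝ] E => A v) h6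
  have hsymm := (hsm.isSymmSndFDerivAt (by rw [minSmoothness_of_isRCLikeNormedField]; norm_cast)) (0, v) (w, 0)
  simp only [ContinuousLinearMap.comp_apply, _root_.add_apply, ContinuousLinearMap.flip_apply,
    hΦe, ContinuousLinearMap.inr_apply, ContinuousLinearMap.inl_apply,
    ContinuousLinearMap.apply_apply, ContinuousLinearMap.prod_apply,
    _root_.zero_apply, hval, h1] at h7
  rw [modelBracket_eq, ← he, ← hsymm]
  rw [← he, ← sub_eq_iff_eq_add] at h7
  rw [← h7, neg_sub]

end Bracket

/-! ### The formula at the base point and uniqueness -/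

section Connection

variable {EGb : Type*} [NormedAddCommGroup EGb] [NormedSpace ℝ EGb]
  {Gb : Type*} [TopologicalSpace Gb] [ChartedSpace EGb Gb] [Group Gb]
  {Hb : Subgroup Gb}
  {FMb : Type*} [NormedAddCommGroup FMb] [NormedSpace ℝ FMb]
  [ChartedSpace FMb (Gb ⧸ Hb)]
  {EG : Type*} [NormedAddCommGroup EG] [NormedSpace ℝ EG]
  {G : Type*} [TopologicalSpace G] [ChartedSpace EG G] [Group G]
  {ι : G →* Gb}
  {FM : Type*} [NormedAddCommGroup FM] [NormedSpace ℝ FM] [FiniteDimensional ℝ FM]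
  [ChartedSpace FM (G ⧸ Hb.comap ι)] [IsManifold 𝓘(ℝ, FM) ∞ (G ⧸ Hb.comap ι)]
  (hj : Manifold.IsSmoothEmbedding 𝓘(ℝ, FM) 𝓘(ℝ, FMb) ∞ (orbitMap ι Hb))
  [LieGroup 𝓘(ℝ, EGb) ∞ Gb] [IsManifold 𝓘(ℝ, FMb) ∞ (Gb ⧸ Hb)]
  (hπb : Manifold.IsSubmersion 𝓘(ℝ, EGb) 𝓘(ℝ, FMb) ∞ (fun g : Gb => (g : Gb ⧸ Hb)))
  [LieGroup 𝓘(ℝ, EG) ∞ G] [FiniteDimensional ℝ EG]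
  (hι' : Manifold.IsImmersion 𝓘(ℝ, EG) 𝓘(ℝ, EGb) ∞ ι)
  (hπ : Manifold.IsSubmersion 𝓘(ℝ, EG) 𝓘(ℝ, FM) ∞ (fun g : G => (g : G ⧸ Hb.comap ι)))
  {m : Submodule ℝ EG} (hm : IsReductiveDecomposition (E := EG) (Hb.comap ι) m)

include hπb in
/-- The equivariant function of the restriction of a fundamental vector field. -/
theorem equivariantFunction_restrictedField (B : EGb) (g : G) :
    equivariantFunction hj (restrictedField (EGb := EGb) hj B) g =
      modelDeriv EGb FMb (fun g : Gb => (g : Gb ⧸ Hb)) 1 (modelAd (E := EGb) (ι g)⁻¹ B) := by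
  set a : Gb := ι g with ha
  -- Translating the orbit map `x ↦ x a Hb` back by `a⁻¹` gives the projection of the conjugate `a⁻¹
  -- x a`; differentiating at `1` brings in `Ad a⁻¹`.
  have h1 : (fun p : Gb ⧸ Hb => a⁻¹ • p) ∘ (fun γ : Gb => γ • (a : Gb ⧸ Hb)) =
      (fun g : Gb => (g : Gb ⧸ Hb)) ∘ (fun x : Gb => a⁻¹ * x * a⁻¹⁻¹) := by
    funext x
    change ((a⁻¹ * (x * a) : Gb) : Gb ⧸ Hb) = ((a⁻¹ * x * a⁻¹⁻¹ : Gb) : Gb ⧸ Hb)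
    rw [inv_inv, mul_assoc]
  have h2 : (fun γ : Gb => γ • (a : Gb ⧸ Hb)) = (fun g : Gb => (g : Gb ⧸ Hb)) ∘ (fun x => x * a) := rfl
  have hd : MDifferentiableAt 𝓘(ℝ, EGb) 𝓘(ℝ, FMb) (fun γ : Gb => γ • (a : Gb ⧸ Hb)) 1 := by
    rw [h2]
    exact (mdifferentiable_proj_quotient hπb _).comp 1 (mdifferentiable_right (E := EGb) a 1)
  have hc : MDifferentiable 𝓘(ℝ, EGb) 𝓘(ℝ, EGb) (fun x : Gb => a⁻¹ * x * a⁻¹⁻¹) :=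
    (mdifferentiable_right (E := EGb) a⁻¹⁻¹).comp (mdifferentiable_left (E := EGb) a⁻¹)
  have h3 := modelDeriv_comp_apply (mdifferentiable_smul_quotient hπb a⁻¹ (a : Gb ⧸ Hb))
    hd (one_smul _ _) B
  rw [h1, modelDeriv_comp_apply (mdifferentiable_proj_quotient hπb 1) (hc 1) (by simp)] at h3
  have h4 : equivariantFunction hj (restrictedField (EGb := EGb) hj B) g =
      modelDeriv FMb FMb (fun p : Gb ⧸ Hb => ι g⁻¹ • p) (a : Gb ⧸ Hb)
        (modelDeriv EGb FMb (fun γ : Gb => γ • (a : Gb ⧸ Hb)) 1 B) := rfl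
  rw [h4, map_inv, ← ha, ← h3]
  rfl

include hπb hι' hπ

/-- A section with smooth equivariant function is smooth. -/
theorem contMDiffAt_section_of_equivariantFunction {s : ∀ x : G ⧸ Hb.comap ι, AmbientTangent hj x}
    {g : G} (hs : ContMDiffAt 𝓘(ℝ, EG) 𝓘(ℝ, FMb) ∞ (equivariantFunction hj s) g) :
    ContMDiffAt 𝓘(ℝ, FM) (𝓘(ℝ, FM).prod 𝓘(ℝ, FMb)) ∞
      (fun x => (⟨x, s x⟩ : TotalSpace FMb (AmbientTangent hj))) (g : G ⧸ Hb.comap ι) := by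
  obtain ⟨σ, hσ, hσx, hσf⟩ := exists_local_section (isSubmersionAt_of_isSubmersion hπ g)
  have h3 := (contMDiff_frameMap hj hπb hι' hπ).contMDiffAt.comp (g : G ⧸ Hb.comap ι)
    (hσ.prodMk (ContMDiffAt.comp (g : G ⧸ Hb.comap ι) (by rw [hσx]; exact hs) hσ))
  refine h3.congr_of_eventuallyEq ?_
  filter_upwards [hσf] with y hy
  have key : ∀ (p q : G ⧸ Hb.comap ι) (w : FMb), p = q → modelSection hj s q = w →
      (⟨p, s p⟩ : TotalSpace FMb (AmbientTangent hj)) = ⟨q, w⟩ := by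
    rintro p q w rfl rfl; rfl
  exact key _ _ _ hy.symm (dAct_equivariantFunction hj hπb s (σ y)).symm

theorem contMDiff_restrictedField (B : EGb) :
    ContMDiff 𝓘(ℝ, FM) (𝓘(ℝ, FM).prod 𝓘(ℝ, FMb)) ∞
      (fun x => (⟨x, restrictedField (EGb := EGb) hj B x⟩ :
        TotalSpace FMb (AmbientTangent hj))) := by
  intro x
  obtain ⟨g, rfl⟩ := QuotientGroup.mk_surjective x
  apply contMDiffAt_section_of_equivariantFunction hj hπb hι' hπ
  have h1 := (contMDiff_modelAd_inv (E := EGb) B).comp hι'.contMDiff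
  refine (((modelDeriv EGb FMb (fun g : Gb => (g : Gb ⧸ Hb)) 1).contMDiff.comp h1) g).congr_of_eventuallyEq
    (Eventually.of_forall fun g => equivariantFunction_restrictedField hj hπb B g)

include hm

/-- At the representative `1` the frame is the identity, and the lift of the velocity of `X` is `X`
itself because `X ∈ m`. What remains is the derivative along `X` of `g ↦ dπ_1 (Ad (ι g)⁻¹ B)`. -/
theorem modelConnection_restrictedField {X : EG} (hX : X ∈ m) (B : EGb) :
    modelConnection hj m (restrictedField (EGb := EGb) hj B) ((1 : G) : G ⧸ Hb.comap ι)
      (modelDeriv EG FM (fun g : G => (g : G ⧸ Hb.comap ι)) 1 X) =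
    -modelDeriv EGb FMb (fun g : Gb => (g : Gb ⧸ Hb)) 1
      (modelBracket Gb (modelDeriv EG EGb ι 1 X) B) := by
  have h1 := modelConnection_eq hj hπb hι' hπ hm (g := 1) rfl
    ((contMDiff_restrictedField hj hπb hι' hπ B).mdifferentiable (by simp)
      ((1 : G) : G ⧸ Hb.comap ι))
  have h2 : equivariantFunction hj (restrictedField (EGb := EGb) hj B) = fun g =>
      modelDeriv EGb FMb (fun g : Gb => (g : Gb ⧸ Hb)) 1
        (((fun γ : Gb => modelAd (E := EGb) γ⁻¹ B) ∘ ι) g) :=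
    funext fun g => equivariantFunction_restrictedField hj hπb B g
  have h3 : MDifferentiableAt 𝓘(ℝ, EGb) 𝓘(ℝ, EGb) (fun γ : Gb => modelAd (E := EGb) γ⁻¹ B) 1 :=
    (contMDiff_modelAd_inv (E := EGb) B).mdifferentiable (by simp) 1
  have h4 : MDifferentiableAt 𝓘(ℝ, EG) 𝓘(ℝ, EGb) ι 1 := hι'.contMDiff.mdifferentiable (by simp) 1
  have h5 := modelDeriv_comp h3 h4 (map_one ι)
  have h6 : MDifferentiableAt 𝓘(ℝ, EG) 𝓘(ℝ, EGb)
      ((fun γ : Gb => modelAd (E := EGb) γ⁻¹ B) ∘ ι) 1 :=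
    MDifferentiableAt.comp 1 (by rw [map_one]; exact h3) h4
  rw [h1, modelInducedDeriv, h2, modelDeriv_clm_comp _ h6, h5, dAct_one]
  simp only [ContinuousLinearMap.comp_apply]
  rw [hLift_proj hπ hm ((mem_modelDistribution_one X).mpr hX), modelDeriv_modelAd_inv, map_neg]
  rfl

omit hm hπb hι' hπ in
theorem fundamentalField_one_eq (X : EG) :
    (fundamentalField (E := EG) (G := G) FM X ((1 : G) : G ⧸ Hb.comap ι) : FM) =
      modelDeriv EG FM (fun g : G => (g : G ⧸ Hb.comap ι)) 1 X := by
  have : (fun g : G => g • ((1 : G) : G ⧸ Hb.comap ι)) = fun g : G => (g : G ⧸ Hb.comap ι) :=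
    funext fun g => smul_mk_one g
  rw [← this]
  rfl

omit hm hπb hι' hπ in
theorem restrictedField_one_eq (B : EGb) :
    (restrictedField (EGb := EGb) hj B ((1 : G) : G ⧸ Hb.comap ι) : FMb) =
      modelDeriv EGb FMb (fun g : Gb => (g : Gb ⧸ Hb)) 1 B := by
  have : (fun g : Gb => g • (((ι (1 : G)) : Gb) : Gb ⧸ Hb)) = fun g : Gb => (g : Gb ⧸ Hb) := by
    rw [map_one]
    exact funext fun g => smul_mk_one g
  rw [← this]
  rfl

/-- The canonical connection at the base point. -/
theorem canonicalConnection_restrictedField (X : GroupLieAlgebra 𝓘(ℝ, EG) G) (hX : X ∈ m)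
    (B : GroupLieAlgebra 𝓘(ℝ, EGb) Gb) :
    canonicalConnection (EG := EG) hj m (restrictedField hj B) ((1 : G) : G ⧸ Hb.comap ι)
          (fundamentalField (E := EG) (G := G) FM X ((1 : G) : G ⧸ Hb.comap ι)) =
        -restrictedField hj ⁅(lieInclusion ι X : GroupLieAlgebra 𝓘(ℝ, EGb) Gb), B⁆
          ((1 : G) : G ⧸ Hb.comap ι) := by
  have h1 := modelConnection_restrictedField hj hπb hι' hπ hm hX B
  have h2 := congrArg (modelConnection hj m (restrictedField (EGb := EGb) hj B)
    ((1 : G) : G ⧸ Hb.comap ι)) (fundamentalField_one_eq (EG := EG) (FM := FM) (Hb := Hb) (ι := ι) X)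
  have h3 := restrictedField_one_eq hj (modelBracket Gb (modelDeriv EG EGb ι 1 X) B)
  exact h2.trans (h1.trans (congrArg (fun w : FMb => -w) h3).symm)

/-- The canonical connection is determined at the base point by its values on the fundamental
vector fields. -/
theorem eq_canonicalConnection_of_restrictedField [FiniteDimensional ℝ FMb]
    (D' : CovariantDerivative 𝓘(ℝ, FM) FMb (AmbientTangent hj))
    (h : ∀ X : GroupLieAlgebra 𝓘(ℝ, EG) G, X ∈ m → ∀ B : GroupLieAlgebra 𝓘(ℝ, EGb) Gb,
        D' (restrictedField hj B) ((1 : G) : G ⧸ Hb.comap ι)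
            (fundamentalField (E := EG) (G := G) FM X ((1 : G) : G ⧸ Hb.comap ι)) =
          -restrictedField hj ⁅(lieInclusion (EG := EG) ι X : GroupLieAlgebra 𝓘(ℝ, EGb) Gb), B⁆
            ((1 : G) : G ⧸ Hb.comap ι))
    (s : ∀ x : G ⧸ Hb.comap ι, AmbientTangent hj x)
    (hs : MDifferentiableAt 𝓘(ℝ, FM) (𝓘(ℝ, FM).prod 𝓘(ℝ, FMb))
      (fun x => (⟨x, s x⟩ : TotalSpace FMb (AmbientTangent hj))) ((1 : G) : G ⧸ Hb.comap ι)) :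
    D' s ((1 : G) : G ⧸ Hb.comap ι) =
      canonicalConnection (EG := EG) hj m s ((1 : G) : G ⧸ Hb.comap ι) := by
  have hvb : ContMDiffVectorBundle 1 FMb (AmbientTangent hj) 𝓘(ℝ, FM) := inferInstance
  have hD := isCovariantDerivativeOn_canonicalConnection hj hπb hι' hπ hm
  have hD' := D'.isCovariantDerivativeOnUniv
  -- The ambient group acts transitively, so some fundamental field `B*` agrees with `s` at `o`.
  obtain ⟨B, hB⟩ := surjective_modelDeriv_proj hπb 1 (modelSection hj s ((1 : G) : G ⧸ Hb.comap ι))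
  have hBs : restrictedField (EGb := EGb) hj B ((1 : G) : G ⧸ Hb.comap ι) =
      s ((1 : G) : G ⧸ Hb.comap ι) := (restrictedField_one_eq hj B).trans hB
  have hBd := (contMDiff_restrictedField hj hπb hι' hπ B).mdifferentiable (by simp)
      ((1 : G) : G ⧸ Hb.comap ι)
  -- The difference of two covariant derivatives is tensorial: at `o` it sees only the value of the
  -- section there, and `s` may be replaced by `B*`.
  have h1 := IsCovariantDerivativeOn.difference_apply hD' hD (mem_univ _) hs
  have h2 := IsCovariantDerivativeOn.difference_apply hD' hD (mem_univ _) hBd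
  rw [hBs, h1] at h2
  have h3 : D' (restrictedField (EGb := EGb) hj B) ((1 : G) : G ⧸ Hb.comap ι) =
      canonicalConnection (EG := EG) hj m (restrictedField (EGb := EGb) hj B)
        ((1 : G) : G ⧸ Hb.comap ι) := by
    apply ContinuousLinearMap.ext
    intro v
    -- Every vector tangent to the orbit at `o` is `X*_o` for some `X ∈ m`, namely its horizontal
    -- lift at `1`.
    have hv := proj_hLift hπ hm 1 v
    have hmem := (mem_modelDistribution_one _).mp (hLift_mem (F := FM) (K := Hb.comap ι) (m := m) 1 v)
    replace hv := (fundamentalField_one_eq (EG := EG) (FM := FM) (Hb := Hb) (ι := ι) _).trans hv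
    rw [← hv]
    exact (h _ hmem B).trans (canonicalConnection_restrictedField hj hπb hι' hπ hm _ hmem B).symm
  exact sub_eq_zero.mp (h2.trans (sub_eq_zero.mpr h3))

end Connection

/-! ### Velocities and parallel fields on subintervals -/

section Parallel

variable {E : Type*} [NormedAddCommGroup E] [NormedSpace ℝ E]
  {M : Type*} [TopologicalSpace M] [ChartedSpace E M]
  {F : Type*} [NormedAddCommGroup F] [NormedSpace ℝ F]

/-- The velocity of a curve within a set. -/
noncomputable def velocityWithin (E : Type*) [NormedAddCommGroup E] [NormedSpace ℝ E]
    {M : Type*} [TopologicalSpace M] [ChartedSpace E M] (c : ℝ → M) (J : Set ℝ) (t : ℝ) : E :=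
  (mfderivWithin 𝓘(ℝ, ℝ) 𝓘(ℝ, E) c J t : ℝ →L[ℝ] E) 1

theorem uniqueMDiffWithinAt_Icc {p q t : ℝ} (h : p < q) (ht : t ∈ Icc p q) :
    UniqueMDiffWithinAt 𝓘(ℝ, ℝ) (Icc p q) t :=
  uniqueMDiffWithinAt_iff_uniqueDiffWithinAt.mpr ((uniqueDiffOn_Icc h) t ht)

theorem velocityWithin_eq {c : ℝ → M} {p q t : ℝ} (h : p < q) (ht : t ∈ Icc p q) {A : ℝ →L[ℝ] E}
    (hc : HasMFDerivWithinAt 𝓘(ℝ, ℝ) 𝓘(ℝ, E) c (Icc p q) t A) :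
    velocityWithin E c (Icc p q) t = A 1 :=
  congrArg (fun B : ℝ →L[ℝ] E => B 1) (hc.mfderivWithin (uniqueMDiffWithinAt_Icc h ht))

theorem velocityWithin_subset {c : ℝ → M} {p q a b t : ℝ} (h : p < q) (ht : t ∈ Icc p q)
    (hsub : Icc p q ⊆ Icc a b) (hc : MDifferentiableWithinAt 𝓘(ℝ, ℝ) 𝓘(ℝ, E) c (Icc a b) t) :
    velocityWithin E c (Icc p q) t = velocityWithin E c (Icc a b) t :=
  velocityWithin_eq h ht (hc.hasMFDerivWithinAt.mono hsub)

/-- On a nondegenerate subinterval the two velocities coincide. On a single point they may differ,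
but there every vector is a derivative, so the equivalence persists. -/
theorem hasDerivWithinAt_velocity_iff {c : ℝ → M} {p q a b t : ℝ} (ht : t ∈ Icc p q)
    (hsub : Icc p q ⊆ Icc a b) (hc : MDifferentiableWithinAt 𝓘(ℝ, ℝ) 𝓘(ℝ, E) c (Icc a b) t)
    (f : ℝ → F) (Ψ : E → F) :
    HasDerivWithinAt f (Ψ (velocityWithin E c (Icc a b) t)) (Icc p q) t ↔
      HasDerivWithinAt f (Ψ (velocityWithin E c (Icc p q) t)) (Icc p q) t := by
  rcases (ht.1.trans ht.2).eq_or_lt with h | h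
  · subst h
    have : t = p := le_antisymm ht.2 ht.1
    subst this
    rw [Icc_self]
    exact ⟨fun _ => HasFDerivWithinAt.of_subsingleton subsingleton_singleton,
      fun _ => HasFDerivWithinAt.of_subsingleton subsingleton_singleton⟩
  · rw [velocityWithin_subset h ht hsub hc]

variable {V : M → Type*} [TopologicalSpace (TotalSpace F V)]
  [∀ x, AddCommGroup (V x)] [∀ x, Module ℝ (V x)]
  [∀ x : M, TopologicalSpace (V x)] [FiberBundle F V]
  {D : (∀ x : M, V x) → ∀ x : M, TangentSpace 𝓘(ℝ, E) x →L[ℝ] V x}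
  {c : ℝ → M}

theorem IsParallelOn.congr {J : Set ℝ} {S S' : ∀ t : ℝ, V (c t)} (h : IsParallelOn F D c J S)
    (hS : ∀ t ∈ J, S' t = S t) : IsParallelOn F D c J S' := by
  intro t₀ ht₀ s hs hst
  refine (h t₀ ht₀ s hs (hst.trans (hS t₀ ht₀))).congr (fun t ht => ?_) ?_
  · rw [hS t ht]
  · rw [hS t₀ ht₀]

theorem IsParallelOn.mono_Icc {a b p q : ℝ} {S : ∀ t : ℝ, V (c t)}
    (h : IsParallelOn F D c (Icc a b) S) (hsub : Icc p q ⊆ Icc a b)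
    (hc : ∀ t ∈ Icc a b, MDifferentiableWithinAt 𝓘(ℝ, ℝ) 𝓘(ℝ, E) c (Icc a b) t) :
    IsParallelOn F D c (Icc p q) S := by
  intro t₀ ht₀ s hs hst
  have h1 := (h t₀ (hsub ht₀) s hs hst).mono hsub
  exact (hasDerivWithinAt_velocity_iff ht₀ hsub (hc t₀ (hsub ht₀)) _
    (fun w => -(trivializationAt F V (c t₀) (⟨c t₀, D s (c t₀) w⟩ : TotalSpace F V)).2)).mp h1

theorem IsParallelOn.union_Icc {a b d : ℝ} {S : ∀ t : ℝ, V (c t)} (hab : a ≤ b) (hbd : b ≤ d)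
    (h₁ : IsParallelOn F D c (Icc a b) S) (h₂ : IsParallelOn F D c (Icc b d) S)
    (hc : ∀ t ∈ Icc a d, MDifferentiableWithinAt 𝓘(ℝ, ℝ) 𝓘(ℝ, E) c (Icc a d) t) :
    IsParallelOn F D c (Icc a d) S := by
  intro t₀ ht₀ s hs hst
  have key : ∀ p q : ℝ, Icc p q ⊆ Icc a d → IsParallelOn F D c (Icc p q) S →
      HasDerivWithinAt
      (fun t => (trivializationAt F V (c t₀) (⟨c t, S t - s (c t)⟩ : TotalSpace F V)).2)
      (-(trivializationAt F V (c t₀)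
        (⟨c t₀, D s (c t₀) (velocityWithin E c (Icc a d) t₀)⟩ : TotalSpace F V)).2)
      (Icc p q) t₀ := by
    intro p q hsub h
    by_cases ht : t₀ ∈ Icc p q
    · exact (hasDerivWithinAt_velocity_iff ht hsub (hc t₀ ht₀) _
        (fun w => -(trivializationAt F V (c t₀) (⟨c t₀, D s (c t₀) w⟩ : TotalSpace F V)).2)).mpr
        (h t₀ ht s hs hst)
    -- Away from the closed piece the condition is empty; thus the two pieces can be united at every
    -- `t₀`, including the common end point.
    · exact HasFDerivWithinAt.of_notMem_closure (by rwa [isClosed_Icc.closure_eq])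
  have h3 := (key a b (Icc_subset_Icc_right hbd) h₁).union (key b d (Icc_subset_Icc_left hab) h₂)
  rw [Icc_union_Icc_eq_Icc hab hbd] at h3
  exact h3

end Parallel

/-- The derivative of the image, under a continuous family of linear maps, of a curve through `0`. -/
theorem hasDerivWithinAt_clm_apply_of_eq_zero {F F' : Type*} [NormedAddCommGroup F]
    [NormedSpace ℝ F] [NormedAddCommGroup F'] [NormedSpace ℝ F'] {K : ℝ → F →L[ℝ] F'} {h : ℝ → F}
    {h' : F} {J : Set ℝ} {t : ℝ} (hK : ContinuousWithinAt K J t) (h0 : h t = 0)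
    (hh : HasDerivWithinAt h h' J t) :
    HasDerivWithinAt (fun r => K r (h r)) (K t h') J t := by
  rw [hasDerivWithinAt_iff_tendsto_slope] at hh ⊢
  -- As `h t = 0`, the difference quotient of `K r (h r)` is `K r` applied to that of `h`.
  -- Continuity of `K` suffices.
  have h1 : slope (fun r => K r (h r)) t = fun r => K r (slope h t r) := by
    funext r
    simp [slope_def_module, h0]
  rw [h1]
  have h2 : Tendsto K (𝓝[J \ {t}] t) (𝓝 (K t)) :=
    Tendsto.mono_left hK (nhdsWithin_mono _ sdiff_subset)
  exact (isBoundedBilinearMap_apply (𝕜 := ℝ) (E := F) (F := F')).continuous.continuousAt.tendsto.comp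
    (h2.prodMk_nhds hh)

/-- `γ` is a horizontal lift of the curve `c` on `[p, q]`. -/
def IsHorizontalLift {E : Type*} [NormedAddCommGroup E] [NormedSpace ℝ E]
    {G : Type*} [TopologicalSpace G] [ChartedSpace E G] [Group G]
    (F : Type*) [NormedAddCommGroup F] [NormedSpace ℝ F]
    {K : Subgroup G} [ChartedSpace F (G ⧸ K)] (m : Submodule ℝ E)
    (γ : ℝ → G) (c : ℝ → G ⧸ K) (p q : ℝ) : Prop :=
  ∀ t ∈ Icc p q, (γ t : G ⧸ K) = c t ∧
    MDifferentiableWithinAt 𝓘(ℝ, ℝ) 𝓘(ℝ, E) γ (Icc p q) t ∧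
    velocityWithin E γ (Icc p q) t =
      hLift F K m (γ t) (velocityWithin F c (Icc p q) t)

/-! ### Parallel fields in the moving frame of a horizontal lift -/

section Lift

variable {EGb : Type*} [NormedAddCommGroup EGb] [NormedSpace ℝ EGb]
  {Gb : Type*} [TopologicalSpace Gb] [ChartedSpace EGb Gb] [Group Gb]
  {Hb : Subgroup Gb}
  {FMb : Type*} [NormedAddCommGroup FMb] [NormedSpace ℝ FMb] [FiniteDimensional ℝ FMb]
  [ChartedSpace FMb (Gb ⧸ Hb)]
  {EG : Type*} [NormedAddCommGroup EG] [NormedSpace ℝ EG]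
  {G : Type*} [TopologicalSpace G] [ChartedSpace EG G] [Group G]
  {ι : G →* Gb}
  {FM : Type*} [NormedAddCommGroup FM] [NormedSpace ℝ FM]
  [ChartedSpace FM (G ⧸ Hb.comap ι)] [IsManifold 𝓘(ℝ, FM) ∞ (G ⧸ Hb.comap ι)]
  (hj : Manifold.IsSmoothEmbedding 𝓘(ℝ, FM) 𝓘(ℝ, FMb) ∞ (orbitMap ι Hb))
  [LieGroup 𝓘(ℝ, EGb) ∞ Gb] [IsManifold 𝓘(ℝ, FMb) ∞ (Gb ⧸ Hb)]
  (hπb : Manifold.IsSubmersion 𝓘(ℝ, EGb) 𝓘(ℝ, FMb) ∞ (fun g : Gb => (g : Gb ⧸ Hb)))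
  [LieGroup 𝓘(ℝ, EG) ∞ G] [FiniteDimensional ℝ EG]
  (hι' : Manifold.IsImmersion 𝓘(ℝ, EG) 𝓘(ℝ, EGb) ∞ ι)
  (hπ : Manifold.IsSubmersion 𝓘(ℝ, EG) 𝓘(ℝ, FM) ∞ (fun g : G => (g : G ⧸ Hb.comap ι)))
  {m : Submodule ℝ EG} (hm : IsReductiveDecomposition (E := EG) (Hb.comap ι) m)

/-- The frame `(L_g)_*`, read in the trivialization at `x`. -/
noncomputable def frameCoord (x : G ⧸ Hb.comap ι) (g : G) : FMb →L[ℝ] FMb :=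
  ((trivializationAt FMb (AmbientTangent hj) x).continuousLinearMapAt ℝ (g : G ⧸ Hb.comap ι)) ∘L
    dAct FMb ι g (orbitMap ι Hb ((1 : G) : G ⧸ Hb.comap ι))

/-- The inverse of the frame `(L_g)_*`, read in the trivialization at `x`. -/
noncomputable def frameCoordSymm (x : G ⧸ Hb.comap ι) (g : G) : FMb →L[ℝ] FMb :=
  dAct FMb ι g⁻¹ (orbitMap ι Hb (g : G ⧸ Hb.comap ι)) ∘L
  ((trivializationAt FMb (AmbientTangent hj) x).symmL ℝ (g : G ⧸ Hb.comap ι))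

include hπb

theorem trivializationAt_eq_frameCoord {x y : G ⧸ Hb.comap ι} {g : G}
    (hg : (g : G ⧸ Hb.comap ι) = y)
    (hy : y ∈ (trivializationAt FMb (AmbientTangent hj) x).baseSet) (w : FMb) :
    (trivializationAt FMb (AmbientTangent hj) x
      (⟨y, w⟩ : TotalSpace FMb (AmbientTangent hj))).2 =
      frameCoord hj x g (dAct FMb ι g⁻¹ (orbitMap ι Hb y) w) := by
  subst hg
  have h1 := Trivialization.continuousLinearMapAt_apply_of_mem (R := ℝ)
    (trivializationAt FMb (AmbientTangent hj) x) hy w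
  rw [← h1]
  have h2 := dAct_dAct_inv (ι := ι) hπb g _ _ (smul_orbitMap_one (ι := ι) g) w
  exact congrArg (fun w : FMb => ((trivializationAt FMb (AmbientTangent hj) x).continuousLinearMapAt ℝ
    (g : G ⧸ Hb.comap ι)) w) h2.symm

theorem frameCoordSymm_frameCoord {x : G ⧸ Hb.comap ι} {g : G}
    (hy : (g : G ⧸ Hb.comap ι) ∈ (trivializationAt FMb (AmbientTangent hj) x).baseSet) (w : FMb) :
    frameCoordSymm hj x g (frameCoord hj x g w) = w := by
  have h1 := Trivialization.symmL_continuousLinearMapAt (R := ℝ)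
    (trivializationAt FMb (AmbientTangent hj) x) hy
    (dAct FMb ι g (orbitMap ι Hb ((1 : G) : G ⧸ Hb.comap ι)) w)
  exact (congrArg (dAct FMb ι g⁻¹ (orbitMap ι Hb (g : G ⧸ Hb.comap ι))) h1).trans
    (dAct_inv_dAct (ι := ι) hπb g _ _ (smul_orbitMap_one (ι := ι) g) w)

theorem frameCoord_frameCoordSymm {x : G ⧸ Hb.comap ι} {g : G}
    (hy : (g : G ⧸ Hb.comap ι) ∈ (trivializationAt FMb (AmbientTangent hj) x).baseSet) (w : FMb) :
    frameCoord hj x g (frameCoordSymm hj x g w) = w := by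
  have h1 := Trivialization.continuousLinearMapAt_symmL (R := ℝ)
    (trivializationAt FMb (AmbientTangent hj) x) hy w
  have h2 := dAct_dAct_inv (ι := ι) hπb g _ _ (smul_orbitMap_one (ι := ι) g)
    ((trivializationAt FMb (AmbientTangent hj) x).symmL ℝ (g : G ⧸ Hb.comap ι) w)
  exact (congrArg (fun w : FMb => ((trivializationAt FMb (AmbientTangent hj) x).continuousLinearMapAt ℝ
    (g : G ⧸ Hb.comap ι)) w) h2).trans h1

include hι' hπ

theorem continuousAt_frameCoord {x : G ⧸ Hb.comap ι} {g : G} (hg : (g : G ⧸ Hb.comap ι) = x) :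
    ContinuousAt (frameCoord hj x) g := by
  suffices h : ContMDiffAt 𝓘(ℝ, EG) 𝓘(ℝ, FMb →L[ℝ] FMb) ∞ (frameCoord hj x) g from h.continuousAt
  refine contMDiffAt_clm_of_apply fun v => ?_
  have h1 := (contMDiff_frameMap hj hπb hι' hπ).contMDiffAt.comp g
    ((contMDiffAt_id (I := 𝓘(ℝ, EG)) (x := g)).prodMk
      (contMDiffAt_const (I' := 𝓘(ℝ, FMb)) (c := v)))
  rw [contMDiffAt_totalSpace] at h1
  have hbase : (trivializationAt FMb (AmbientTangent hj) x).baseSet ∈ 𝓝 x :=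
    (trivializationAt FMb (AmbientTangent hj) x).open_baseSet.mem_nhds
      (mem_baseSet_trivializationAt FMb (AmbientTangent hj) x)
  have hev := (contMDiff_proj_quotient hπ).continuous.continuousAt (x := g)
  subst hg
  refine h1.2.congr_of_eventuallyEq ?_
  filter_upwards [hev hbase] with y hy
  exact Trivialization.continuousLinearMapAt_apply_of_mem (R := ℝ)
    (trivializationAt FMb (AmbientTangent hj) (g : G ⧸ Hb.comap ι)) hy _

/-- Near `g` this map is the inverse of `frameCoord`, and inversion is continuous at invertible
operators of a complete space. -/
theorem continuousAt_frameCoordSymm {x : G ⧸ Hb.comap ι} {g : G} (hg : (g : G ⧸ Hb.comap ι) = x) :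
    ContinuousAt (frameCoordSymm hj x) g := by
  subst hg
  have hbase : (trivializationAt FMb (AmbientTangent hj) (g : G ⧸ Hb.comap ι)).baseSet ∈ 𝓝 (g : G ⧸ Hb.comap ι) :=
    (trivializationAt FMb (AmbientTangent hj) (g : G ⧸ Hb.comap ι)).open_baseSet.mem_nhds
      (mem_baseSet_trivializationAt FMb (AmbientTangent hj) (g : G ⧸ Hb.comap ι))
  have hev := (contMDiff_proj_quotient hπ).continuous.continuousAt (x := g)
  have hinv : ∀ᶠ y in 𝓝 g, frameCoordSymm hj (g : G ⧸ Hb.comap ι) y = (frameCoord hj (g : G ⧸ Hb.comap ι) y).inverse ∧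
      (frameCoord hj (g : G ⧸ Hb.comap ι) y).IsInvertible := by
    filter_upwards [hev hbase] with y hy
    have h1 : frameCoord hj (g : G ⧸ Hb.comap ι) y ∘L frameCoordSymm hj (g : G ⧸ Hb.comap ι) y = ContinuousLinearMap.id ℝ FMb :=
      ContinuousLinearMap.ext (frameCoord_frameCoordSymm hj hπb hy)
    have h2 : frameCoordSymm hj (g : G ⧸ Hb.comap ι) y ∘L frameCoord hj (g : G ⧸ Hb.comap ι) y = ContinuousLinearMap.id ℝ FMb :=
      ContinuousLinearMap.ext (frameCoordSymm_frameCoord hj hπb hy)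
    exact ⟨(ContinuousLinearMap.inverse_eq h1 h2).symm, .of_inverse h1 h2⟩
  obtain ⟨e, he⟩ := hinv.self_of_nhds.2
  have h3 : ContinuousAt ContinuousLinearMap.inverse (frameCoord hj (g : G ⧸ Hb.comap ι) g) := by
    rw [← he]
    exact (contDiffAt_map_inverse (n := 0) e).continuousAt
  refine (h3.comp (continuousAt_frameCoord hj hπb hι' hπ rfl)).congr ?_
  filter_upwards [hinv] with y hy
  exact hy.1.symm

/-- There are smooth local sections with given value. -/
theorem exists_section_apply_eq (x : G ⧸ Hb.comap ι) (v : AmbientTangent hj x) :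
    ∃ s : ∀ x : G ⧸ Hb.comap ι, AmbientTangent hj x,
      ContMDiffAt 𝓘(ℝ, FM) (𝓘(ℝ, FM).prod 𝓘(ℝ, FMb)) ∞
        (fun x => (⟨x, s x⟩ : TotalSpace FMb (AmbientTangent hj))) x ∧ s x = v := by
  obtain ⟨g, rfl⟩ := QuotientGroup.mk_surjective x
  obtain ⟨σ, hσ, hσx, hσf⟩ := exists_local_section (isSubmersionAt_of_isSubmersion hπ g)
  let w : FMb := dAct FMb ι g⁻¹ (orbitMap ι Hb (g : G ⧸ Hb.comap ι)) v
  let s : ∀ x : G ⧸ Hb.comap ι, AmbientTangent hj x := fun x =>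
    dAct FMb ι (σ x) (orbitMap ι Hb ((1 : G) : G ⧸ Hb.comap ι)) w
  refine ⟨s, ?_, ?_⟩
  · have h3 := (contMDiff_frameMap hj hπb hι' hπ).contMDiffAt.comp (g : G ⧸ Hb.comap ι)
      (hσ.prodMk (contMDiffAt_const (I' := 𝓘(ℝ, FMb)) (c := w)))
    refine h3.congr_of_eventuallyEq ?_
    filter_upwards [hσf] with y hy
    have key : ∀ (p q : G ⧸ Hb.comap ι) (w : FMb), p = q →
        (⟨p, w⟩ : TotalSpace FMb (AmbientTangent hj)) = ⟨q, w⟩ := by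
      rintro p q w rfl; rfl
    exact key _ _ _ hy.symm
  · change dAct FMb ι (σ (g : G ⧸ Hb.comap ι)) (orbitMap ι Hb ((1 : G) : G ⧸ Hb.comap ι)) w = v
    rw [hσx]
    exact dAct_dAct_inv (ι := ι) hπb g _ _ (smul_orbitMap_one (ι := ι) g) _

include hm

/-- Along a horizontal lift, a field is parallel if and only if its coordinates in the moving
frame are constant. -/
theorem isParallelOn_iff_of_lift {γ : ℝ → G} {c : ℝ → G ⧸ Hb.comap ι} {p q : ℝ}
    (hγ : IsHorizontalLift FM m γ c p q) (S : ∀ t, AmbientTangent hj (c t)) :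
    IsParallelOn FMb (canonicalConnection (EG := EG) hj m) c (Icc p q) S ↔
      ∀ t ∈ Icc p q, HasDerivWithinAt
        (fun t => dAct FMb ι (γ t)⁻¹ (orbitMap ι Hb (c t)) (S t)) 0 (Icc p q) t := by
  have key : ∀ t₀ ∈ Icc p q, ∀ s : ∀ x : G ⧸ Hb.comap ι, AmbientTangent hj x,
      MDifferentiableAt 𝓘(ℝ, FM) (𝓘(ℝ, FM).prod 𝓘(ℝ, FMb))
        (fun x => (⟨x, s x⟩ : TotalSpace FMb (AmbientTangent hj))) (c t₀) →
      s (c t₀) = S t₀ →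
      (HasDerivWithinAt
        (fun t => (trivializationAt FMb (AmbientTangent hj) (c t₀)
          (⟨c t, S t - s (c t)⟩ : TotalSpace FMb (AmbientTangent hj))).2)
        (-(trivializationAt FMb (AmbientTangent hj) (c t₀)
          (⟨c t₀, canonicalConnection (EG := EG) hj m s (c t₀) (velocityWithin FM c (Icc p q) t₀)⟩ :
            TotalSpace FMb (AmbientTangent hj))).2) (Icc p q) t₀ ↔
      HasDerivWithinAt
        (fun t => dAct FMb ι (γ t)⁻¹ (orbitMap ι Hb (c t)) (S t)) 0 (Icc p q) t₀) := by
    intro t₀ ht₀ s hs hst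
    obtain ⟨hγc, hγd, hγv⟩ := hγ t₀ ht₀
    have hbase : (trivializationAt FMb (AmbientTangent hj) (c t₀)).baseSet ∈ 𝓝 (c t₀) :=
      (trivializationAt FMb (AmbientTangent hj) (c t₀)).open_baseSet.mem_nhds
        (mem_baseSet_trivializationAt FMb (AmbientTangent hj) (c t₀))
    have hev : ∀ᶠ t in 𝓝[Icc p q] t₀,
        (γ t : G ⧸ Hb.comap ι) ∈ (trivializationAt FMb (AmbientTangent hj) (c t₀)).baseSet :=
      ((contMDiff_proj_quotient hπ).continuous.continuousAt.comp_continuousWithinAt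
        hγd.continuousWithinAt) (by
        change _ ∈ 𝓝 (γ t₀ : G ⧸ Hb.comap ι)
        rw [hγc]; exact hbase)
    have hcJ : ∀ᶠ t in 𝓝[Icc p q] t₀, (γ t : G ⧸ Hb.comap ι) = c t :=
      eventually_nhdsWithin_of_forall fun t ht => (hγ t ht).1
    set f := equivariantFunction hj s with hf
    -- The difference `S - s ∘ c` is read in the moving frame as `h` and in the trivialization as
    -- `u`. Each is obtained from the other by a continuous family of linear maps, and both vanish
    -- at `t₀`, so their derivatives correspond without differentiating the families.
    set h : ℝ → FMb := fun t => dAct FMb ι (γ t)⁻¹ (orbitMap ι Hb (c t)) (S t - s (c t)) with hh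
    set u : ℝ → FMb := fun t => (trivializationAt FMb (AmbientTangent hj) (c t₀)
          (⟨c t, S t - s (c t)⟩ : TotalSpace FMb (AmbientTangent hj))).2 with hu
    have hh0 : h t₀ = 0 := by
      have : (S t₀ - s (c t₀) : AmbientTangent hj (c t₀)) = (0 : FMb) := sub_eq_zero.mpr hst.symm
      exact (congrArg (dAct FMb ι (γ t₀)⁻¹ (orbitMap ι Hb (c t₀))) this).trans (map_zero _)
    have hut : ∀ᶠ t in 𝓝[Icc p q] t₀, u t = frameCoord hj (c t₀) (γ t) (h t) := by
      filter_upwards [hev, hcJ] with t h1 h2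
      exact trivializationAt_eq_frameCoord hj hπb h2 (by rw [← h2]; exact h1) _
    have hht : ∀ᶠ t in 𝓝[Icc p q] t₀, h t = frameCoordSymm hj (c t₀) (γ t) (u t) := by
      filter_upwards [hev, hut] with t h1 h2
      rw [h2, frameCoordSymm_frameCoord hj hπb h1]
    have ht0 : t₀ ∈ insert t₀ (Icc p q) := mem_insert _ _
    have hb0 := hev.self_of_nhdsWithin ht₀
    have hDs : (trivializationAt FMb (AmbientTangent hj) (c t₀)
          (⟨c t₀, canonicalConnection (EG := EG) hj m s (c t₀) (velocityWithin FM c (Icc p q) t₀)⟩ :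
            TotalSpace FMb (AmbientTangent hj))).2 =
        frameCoord hj (c t₀) (γ t₀)
          (modelDeriv EG FMb f (γ t₀) (velocityWithin EG γ (Icc p q) t₀)) := by
      have h1 := trivializationAt_eq_frameCoord hj hπb hγc (by rw [← hγc]; exact hb0)
        (modelConnection hj m s (c t₀) (velocityWithin FM c (Icc p q) t₀))
      refine h1.trans (congrArg (frameCoord hj (c t₀) (γ t₀)) ?_)
      have h2 := congrArg (fun A : FM →L[ℝ] FMb => A (velocityWithin FM c (Icc p q) t₀))
        (modelConnection_eq hj hπb hι' hπ hm hγc hs)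
      refine (congrArg (dAct FMb ι (γ t₀)⁻¹ (orbitMap ι Hb (c t₀))) h2).trans ?_
      rw [hγv]
      exact dAct_inv_dAct (ι := ι) hπb _ _ _
        ((smul_orbitMap_one (ι := ι) (γ t₀)).trans (congrArg _ hγc)) _
    set f' : FMb := modelDeriv EG FMb f (γ t₀) (velocityWithin EG γ (Icc p q) t₀) with hf'
    have hfd : HasDerivWithinAt (fun t => f (γ t)) f' (Icc p q) t₀ := by
      have h1 := mdifferentiableAt_equivariantFunction (g := γ t₀) hj hπb hι' hπ
        (by rw [hγc]; exact hs)
      have h2 := h1.hasMFDerivAt.comp_hasMFDerivWithinAt t₀ hγd.hasMFDerivWithinAt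
      have h3 : HasFDerivWithinAt (fun t => f (γ t)) (_ : ℝ →L[ℝ] FMb) (Icc p q) t₀ :=
        HasMFDerivWithinAt.hasFDerivWithinAt h2
      exact h3.hasDerivWithinAt
    have hKc : ContinuousWithinAt (fun t => frameCoord hj (c t₀) (γ t)) (Icc p q) t₀ :=
      (continuousAt_frameCoord hj hπb hι' hπ hγc).comp_continuousWithinAt hγd.continuousWithinAt
    have hKc' : ContinuousWithinAt (fun t => frameCoordSymm hj (c t₀) (γ t)) (Icc p q) t₀ :=
      (continuousAt_frameCoordSymm hj hπb hι' hπ hγc).comp_continuousWithinAt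
        hγd.continuousWithinAt
    have hu0 : u t₀ = 0 := by rw [hut.self_of_nhdsWithin ht₀, hh0, map_zero]
    have hadd : ∀ t ∈ Icc p q, dAct FMb ι (γ t)⁻¹ (orbitMap ι Hb (c t)) (S t) = h t + f (γ t) := by
      intro t ht
      have key : ∀ y : G ⧸ Hb.comap ι, (γ t : G ⧸ Hb.comap ι) = y → f (γ t) =
          dAct FMb ι (γ t)⁻¹ (orbitMap ι Hb y) (modelSection hj s y) := by
        rintro y rfl; rfl
      rw [key _ (hγ t ht).1]
      have h3 : h t = dAct FMb ι (γ t)⁻¹ (orbitMap ι Hb (c t)) (S t) -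
          dAct FMb ι (γ t)⁻¹ (orbitMap ι Hb (c t)) (modelSection hj s (c t)) :=
        map_sub (dAct FMb ι (γ t)⁻¹ (orbitMap ι Hb (c t))) _ _
      rw [h3, sub_add_cancel]
    -- Parallelism at `t₀` now says that the derivative of `h` is `-f'`. By `hadd` the moving-frame
    -- coordinate of `S` is `h + f ∘ γ`, so this is the vanishing of its derivative.
    rw [hDs]
    constructor
    · intro h1
      have h2 := hasDerivWithinAt_clm_apply_of_eq_zero hKc' hu0 h1
      have h3 : HasDerivWithinAt h (-f') (Icc p q) t₀ := by
        rw [map_neg, frameCoordSymm_frameCoord hj hπb hb0] at h2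
        exact h2.congr_of_eventuallyEq hht (hht.self_of_nhdsWithin ht₀)
      have h4 := h3.add hfd
      rw [neg_add_cancel] at h4
      exact h4.congr hadd (hadd t₀ ht₀)
    · intro h1
      have h2 : HasDerivWithinAt h (-f') (Icc p q) t₀ := by
        have := h1.sub hfd
        rw [zero_sub] at this
        exact this.congr (fun t ht => by simp [hadd t ht]) (by simp [hadd t₀ ht₀])
      have h3 := hasDerivWithinAt_clm_apply_of_eq_zero hKc hh0 h2
      rw [map_neg] at h3
      exact h3.congr_of_eventuallyEq hut (hut.self_of_nhdsWithin ht₀)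
  constructor
  · intro h t ht
    -- `IsParallelOn` quantifies over all sections through `S t`; the existence of one is needed to
    -- extract information from it.
    obtain ⟨s, hs, hst⟩ := exists_section_apply_eq hj hπb hι' hπ (c t) (S t)
    have hs' := hs.mdifferentiableAt (by simp)
    exact (key t ht s hs' hst).mp (h t ht s hs' hst)
  · intro h t ht s hs hst
    exact (key t ht s hs hst).mpr (h t ht)

end Lift

/-- Local solutions of `y' = Q (y, u t)` for `Q` of class `C^1` and `u` continuous. -/
theorem exists_hasDerivWithinAt_of_contDiffAt {E F : Type*} [NormedAddCommGroup E]
    [NormedSpace ℝ E] [CompleteSpace E] [NormedAddCommGroup F] [NormedSpace ℝ F]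
    {Q : E × F → E} {u : ℝ → F} {t₀ : ℝ} {y₀ : E}
    (hQ : ContDiffAt ℝ 1 Q (y₀, u t₀)) (hu : Continuous u) :
    ∃ ε > 0, ∃ y : ℝ → E, y t₀ = y₀ ∧ ∀ t ∈ Icc (t₀ - ε) (t₀ + ε),
      HasDerivWithinAt y (Q (y t, u t)) (Icc (t₀ - ε) (t₀ + ε)) t := by
  obtain ⟨K, s, hs, hl⟩ := hQ.exists_lipschitzOnWith
  obtain ⟨r, hr, hrs⟩ := Metric.nhds_basis_closedBall.mem_iff.mp hs
  have hprod : ∀ x v, x ∈ Metric.closedBall y₀ r → v ∈ Metric.closedBall (u t₀) r → (x, v) ∈ s :=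
    fun x v hx hv => hrs (by rw [← closedBall_prod_same]; exact ⟨hx, hv⟩)
  obtain ⟨δ, hδ, hδu⟩ := Metric.nhds_basis_closedBall.mem_iff.mp
    (hu.continuousAt (x := t₀) (Metric.closedBall_mem_nhds _ hr))
  -- The Lipschitz constant `K` on the ball of radius `r` bounds `Q` there by `L`.
  set L : ℝ := K * r + ‖Q (y₀, u t₀)‖ with hL
  have hL0 : 0 ≤ L := by positivity
  -- A solution moves by at most `L * ε ≤ r` and so stays in the ball; the denominator `L + 1` is
  -- positive even if `L = 0`.
  set ε : ℝ := min δ (r / (L + 1)) with hε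
  have hε0 : 0 < ε := lt_min hδ (by positivity)
  have hut : ∀ t ∈ Icc (t₀ - ε) (t₀ + ε), u t ∈ Metric.closedBall (u t₀) r := fun t ht =>
    hδu (by
      rw [Real.closedBall_eq_Icc]
      have : ε ≤ δ := min_le_left _ _
      exact ⟨by linarith [ht.1], by linarith [ht.2]⟩)
  have hpl : IsPicardLindelof (fun t x => Q (x, u t)) (tmin := t₀ - ε) (tmax := t₀ + ε)
      ⟨t₀, by constructor <;> linarith⟩ y₀ ⟨r, hr.le⟩ 0 ⟨L, hL0⟩ K := by
    refine ⟨fun t ht => ?_, fun x hx => ?_, fun t ht x hx => ?_, ?_⟩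
    · refine LipschitzOnWith.of_dist_le_mul fun x hx y hy => ?_
      refine (hl.dist_le_mul _ (hprod x _ hx (hut t ht)) _ (hprod y _ hy (hut t ht))).trans ?_
      rw [Prod.dist_eq, dist_self, max_eq_left dist_nonneg]
    · exact hl.continuousOn.comp (continuousOn_const.prodMk hu.continuousOn)
        fun t ht => hprod x _ hx (hut t ht)
    · have h1 := hl.dist_le_mul _ (hprod x _ hx (hut t ht)) _
        (hprod y₀ (u t₀) (Metric.mem_closedBall_self hr.le) (Metric.mem_closedBall_self hr.le))
      have h2 : dist (x, u t) (y₀, u t₀) ≤ r := by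
        rw [Prod.dist_eq]
        exact max_le hx (hut t ht)
      have h3 := norm_le_norm_sub_add (Q (x, u t)) (Q (y₀, u t₀))
      rw [← dist_eq_norm] at h3
      have h4 : (K : ℝ) * dist (x, u t) (y₀, u t₀) ≤ K * r := by gcongr
      change ‖Q (x, u t)‖ ≤ L
      linarith
    · change L * max (t₀ + ε - t₀) (t₀ - (t₀ - ε)) ≤ r - 0
      rw [add_sub_cancel_left, sub_sub_cancel, max_self, sub_zero]
      have h1 : ε ≤ r / (L + 1) := min_le_right _ _
      rw [le_div_iff₀ (by linarith)] at h1
      nlinarith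
  obtain ⟨y, hy0, hy⟩ := hpl.exists_eq_forall_mem_Icc_hasDerivWithinAt₀
  exact ⟨ε, hε0, y, hy0, hy⟩

theorem eq_of_hasDerivWithinAt_zero {F : Type*} [NormedAddCommGroup F] [NormedSpace ℝ F]
    {f : ℝ → F} {p q s t : ℝ} (hf : ∀ t ∈ Icc p q, HasDerivWithinAt f 0 (Icc p q) t)
    (ht : t ∈ Icc p q) (hs : s ∈ Icc p q) : f t = f s := by
  have h := (convex_Icc p q).norm_image_sub_le_of_norm_hasDerivWithin_le (C := 0) hf
    (fun x _ => by simp) hs ht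
  rwa [zero_mul, norm_le_zero_iff, sub_eq_zero] at h

/-! ### Curves and their velocities read in charts -/

section Chart

variable {E : Type*} [NormedAddCommGroup E] [NormedSpace ℝ E]
  {M : Type*} [TopologicalSpace M] [ChartedSpace E M]

/-- A tangent vector at `x`, read in the chart at `x₀`. -/
noncomputable def chartDeriv (E : Type*) [NormedAddCommGroup E] [NormedSpace ℝ E]
    {M : Type*} [TopologicalSpace M] [ChartedSpace E M] [IsManifold 𝓘(ℝ, E) 1 M]
    (x₀ x : M) : E →L[ℝ] E :=
  (trivializationAt E (TangentSpace 𝓘(ℝ, E) : M → Type _) x₀).continuousLinearMapAt ℝ x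

/-- The tangent vector at `x` given in the chart at `x₀`. -/
noncomputable def chartDerivSymm (E : Type*) [NormedAddCommGroup E] [NormedSpace ℝ E]
    {M : Type*} [TopologicalSpace M] [ChartedSpace E M] [IsManifold 𝓘(ℝ, E) 1 M]
    (x₀ x : M) : E →L[ℝ] E :=
  (trivializationAt E (TangentSpace 𝓘(ℝ, E) : M → Type _) x₀).symmL ℝ x

variable [IsManifold 𝓘(ℝ, E) 1 M]

theorem mem_baseSet_of_mem_chart {x₀ x : M} (hx : x ∈ (extChartAt 𝓘(ℝ, E) x₀).source) :
    x ∈ (trivializationAt E (TangentSpace 𝓘(ℝ, E) : M → Type _) x₀).baseSet := by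
  rwa [extChartAt_source] at hx

theorem chartDeriv_chartDerivSymm {x₀ x : M} (hx : x ∈ (extChartAt 𝓘(ℝ, E) x₀).source) (v : E) :
    chartDeriv E x₀ x (chartDerivSymm E x₀ x v) = v :=
  Trivialization.continuousLinearMapAt_symmL (R := ℝ) _ (mem_baseSet_of_mem_chart hx) v

theorem chartDerivSymm_chartDeriv {x₀ x : M} (hx : x ∈ (extChartAt 𝓘(ℝ, E) x₀).source) (v : E) :
    chartDerivSymm E x₀ x (chartDeriv E x₀ x v) = v :=
  Trivialization.symmL_continuousLinearMapAt (R := ℝ)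
    (trivializationAt E (TangentSpace 𝓘(ℝ, E) : M → Type _) x₀) (mem_baseSet_of_mem_chart hx) v

/-- The derivative of a curve, read in a chart. -/
theorem hasDerivWithinAt_extChartAt_comp {x₀ : M} {c : ℝ → M} {J : Set ℝ} {t : ℝ}
    {A : ℝ →L[ℝ] E} (hc : HasMFDerivWithinAt 𝓘(ℝ, ℝ) 𝓘(ℝ, E) c J t A)
    (hx : c t ∈ (extChartAt 𝓘(ℝ, E) x₀).source) :
    HasDerivWithinAt (fun r => extChartAt 𝓘(ℝ, E) x₀ (c r)) (chartDeriv E x₀ (c t) (A 1)) J t := by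
  rw [extChartAt_source] at hx
  have h1 := (mdifferentiableAt_extChartAt (I := 𝓘(ℝ, E)) hx).hasMFDerivAt.comp_hasMFDerivWithinAt
    t hc
  have h3 : HasFDerivWithinAt (fun r => extChartAt 𝓘(ℝ, E) x₀ (c r)) (_ : ℝ →L[ℝ] E) J t :=
    HasMFDerivWithinAt.hasFDerivWithinAt h1
  refine h3.hasDerivWithinAt.congr_deriv ?_
  exact congrArg (fun B : E →L[ℝ] E => B (A 1))
    (TangentBundle.continuousLinearMapAt_trivializationAt (𝕜 := ℝ) (I := 𝓘(ℝ, E)) hx).symm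

/-- The derivative of a curve given in a chart. -/
theorem hasMFDerivWithinAt_extChartAt_symm_comp {x₀ : M} {y : ℝ → E} {y' : E} {J : Set ℝ} {t : ℝ}
    (hy : HasDerivWithinAt y y' J t) (hx : y t ∈ (extChartAt 𝓘(ℝ, E) x₀).target) :
    HasMFDerivWithinAt 𝓘(ℝ, ℝ) 𝓘(ℝ, E) (fun r => (extChartAt 𝓘(ℝ, E) x₀).symm (y r)) J t
      (ContinuousLinearMap.toSpanSingleton ℝ
        (chartDerivSymm E x₀ ((extChartAt 𝓘(ℝ, E) x₀).symm (y t)) y') : ℝ →L[ℝ] E) := by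
  have h0 := mdifferentiableWithinAt_extChartAt_symm hx
  have h1 : HasMFDerivWithinAt 𝓘(ℝ, ℝ) 𝓘(ℝ, E) y J t
      (ContinuousLinearMap.toSpanSingleton ℝ y' : ℝ →L[ℝ] E) :=
    hy.hasFDerivWithinAt.hasMFDerivWithinAt
  have h2 := h0.hasMFDerivWithinAt.comp t h1 (by rw [ModelWithCorners.range_eq_univ]; simp)
  refine h2.congr_mfderiv ?_
  have hs := (extChartAt 𝓘(ℝ, E) x₀).map_target hx
  rw [extChartAt_source] at hs
  have h3 := TangentBundle.symmL_trivializationAt (𝕜 := ℝ) (I := 𝓘(ℝ, E)) hs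
  rw [(extChartAt 𝓘(ℝ, E) x₀).right_inv hx] at h3
  have h4 : (chartDerivSymm E x₀ ((extChartAt 𝓘(ℝ, E) x₀).symm (y t))) = (mfderivWithin 𝓘(ℝ, E) 𝓘(ℝ, E)
    (extChartAt 𝓘(ℝ, E) x₀).symm (range 𝓘(ℝ, E)) (y t) : E →L[ℝ] E) := h3
  rw [h4]
  have key : ∀ B : E →L[ℝ] E, B ∘L ContinuousLinearMap.toSpanSingleton ℝ y' =
      ContinuousLinearMap.toSpanSingleton ℝ (B y') := fun B => by ext; simp
  exact key _

end Chart

/-! ### Local existence of horizontal lifts -/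

section HorizontalLift

variable {E : Type*} [NormedAddCommGroup E] [NormedSpace ℝ E] [FiniteDimensional ℝ E]
  {G : Type*} [TopologicalSpace G] [ChartedSpace E G] [Group G] [LieGroup 𝓘(ℝ, E) ∞ G]
  {F : Type*} [NormedAddCommGroup F] [NormedSpace ℝ F]
  {K : Subgroup G} [ChartedSpace F (G ⧸ K)] [IsManifold 𝓘(ℝ, F) ∞ (G ⧸ K)]
  (hπ : Manifold.IsSubmersion 𝓘(ℝ, E) 𝓘(ℝ, F) ∞ (fun g : G => (g : G ⧸ K)))
  {m : Submodule ℝ E} (hm : IsReductiveDecomposition (E := E) K m)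

/-- The horizontal lift of a tangent vector at `↑g`, all vectors being read in the charts at `x₀`
and at `g₀`, and `g` in the chart at `g₀`. -/
noncomputable def chartHLift (m : Submodule ℝ E) (g₀ : G) (x₀ : G ⧸ K) (p : E × F) : E :=
  chartDeriv E g₀ ((extChartAt 𝓘(ℝ, E) g₀).symm p.1)
    (hLift F K m ((extChartAt 𝓘(ℝ, E) g₀).symm p.1)
      (chartDerivSymm F x₀ (((extChartAt 𝓘(ℝ, E) g₀).symm p.1 : G) : G ⧸ K) p.2))

include hπ hm

theorem contDiffAt_chartHLift {g₀ : G} {x₀ : G ⧸ K} (h₀ : (g₀ : G ⧸ K) = x₀) (v : F) :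
    ContDiffAt ℝ ∞ (chartHLift (F := F) m g₀ x₀) (extChartAt 𝓘(ℝ, E) g₀ g₀, v) := by
  subst h₀
  have hs : (extChartAt 𝓘(ℝ, E) g₀).symm (extChartAt 𝓘(ℝ, E) g₀ g₀) = g₀ := extChartAt_to_inv _
  have h1 : ContMDiffAt 𝓘(ℝ, E × F) 𝓘(ℝ, E) ∞
      (fun p : E × F => (extChartAt 𝓘(ℝ, E) g₀).symm p.1) (extChartAt 𝓘(ℝ, E) g₀ g₀, v) := by
    have h2 : ContMDiffAt 𝓘(ℝ, E) 𝓘(ℝ, E) ∞ (extChartAt 𝓘(ℝ, E) g₀).symm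
        (extChartAt 𝓘(ℝ, E) g₀ g₀) :=
      (contMDiffOn_extChartAt_symm g₀).contMDiffAt (extChartAt_target_mem_nhds g₀)
    exact ContMDiffAt.comp (I' := 𝓘(ℝ, E)) (extChartAt 𝓘(ℝ, E) g₀ g₀, v) h2
      contDiff_fst.contMDiff.contMDiffAt
  have h2 : ContMDiffAt 𝓘(ℝ, E × F) 𝓘(ℝ, F) ∞
      (fun p : E × F => (((extChartAt 𝓘(ℝ, E) g₀).symm p.1 : G) : G ⧸ K))
      (extChartAt 𝓘(ℝ, E) g₀ g₀, v) :=
    (contMDiff_proj_quotient hπ).contMDiffAt.comp _ h1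
  have h3 : ContMDiffAt 𝓘(ℝ, E × F) 𝓘(ℝ, F) ∞ (fun p : E × F => p.2)
      (extChartAt 𝓘(ℝ, E) g₀ g₀, v) := contDiff_snd.contMDiff.contMDiffAt
  have h4 : ContMDiffAt (𝓘(ℝ, F).prod 𝓘(ℝ, F)) (𝓘(ℝ, F).prod 𝓘(ℝ, F)) ∞
      (fun p : (G ⧸ K) × F => (⟨p.1, (trivializationAt F (TangentSpace 𝓘(ℝ, F) : G ⧸ K → Type _)
        (g₀ : G ⧸ K)).symm p.1 p.2⟩ : TangentBundle 𝓘(ℝ, F) (G ⧸ K)))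
      ((((extChartAt 𝓘(ℝ, E) g₀).symm (extChartAt 𝓘(ℝ, E) g₀ g₀) : G) : G ⧸ K), v) := by
    rw [hs]
    exact contMDiffAt_tangentBundle_symm _ _
  have h5 := ContMDiffAt.comp (extChartAt 𝓘(ℝ, E) g₀ g₀, v) h4 (h2.prodMk h3)
  have h6 : ContMDiffAt 𝓘(ℝ, E × F) (𝓘(ℝ, F).prod 𝓘(ℝ, F)) ∞
      (fun p : E × F => (⟨(((extChartAt 𝓘(ℝ, E) g₀).symm p.1 : G) : G ⧸ K),
        chartDerivSymm F (g₀ : G ⧸ K) (((extChartAt 𝓘(ℝ, E) g₀).symm p.1 : G) : G ⧸ K) p.2⟩ :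
        TangentBundle 𝓘(ℝ, F) (G ⧸ K))) (extChartAt 𝓘(ℝ, E) g₀ g₀, v) := by
    refine h5.congr_of_eventuallyEq ?_
    have hb := h2.continuousAt ((chartAt F (g₀ : G ⧸ K)).open_source.mem_nhds
      (by dsimp only; rw [hs]; exact mem_chart_source F _))
    filter_upwards [hb] with p hp
    exact congrArg (TotalSpace.mk _) (Trivialization.symmL_apply (R := ℝ)
      (trivializationAt F (TangentSpace 𝓘(ℝ, F) : G ⧸ K → Type _) (g₀ : G ⧸ K)) hp p.2)
  have h7 := (contMDiffAt_hLift hπ hm h1 h6)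
  rw [contMDiffAt_totalSpace] at h7
  have h8 := h7.2
  dsimp only at h8
  rw [hs] at h8
  refine (h8.congr_of_eventuallyEq ?_).contDiffAt
  have hb := h1.continuousAt ((chartAt E g₀).open_source.mem_nhds
      (by dsimp only; rw [hs]; exact mem_chart_source E _))
  filter_upwards [hb] with p hp
  exact Trivialization.continuousLinearMapAt_apply_of_mem (R := ℝ)
    (trivializationAt E (TangentSpace 𝓘(ℝ, E) : G → Type _) g₀) hp _

/-- Local existence of horizontal lifts. -/
theorem exists_isHorizontalLift {c : ℝ → G ⧸ K} {a b t₀ : ℝ} (hab : a < b)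
    (hc : ContMDiffOn 𝓘(ℝ, ℝ) 𝓘(ℝ, F) ∞ c (Icc a b)) (ht₀ : t₀ ∈ Icc a b) :
    ∃ ε > 0, ∃ γ : ℝ → G, ∀ p q, p < q → Icc p q ⊆ Icc a b →
      Icc p q ⊆ Icc (t₀ - ε) (t₀ + ε) → IsHorizontalLift F m γ c p q := by
  obtain ⟨g₀, hg₀⟩ := QuotientGroup.mk_surjective (c t₀)
  set φ := extChartAt 𝓘(ℝ, F) (c t₀) with hφ
  set ψ := extChartAt 𝓘(ℝ, E) g₀ with hψ
  obtain ⟨ε₀, hε₀, hcφ⟩ : ∃ ε₀ > 0, ∀ t ∈ Icc a b, t ∈ Icc (t₀ - ε₀) (t₀ + ε₀) →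
      c t ∈ φ.source := by
    have h1 := (hc t₀ ht₀).continuousWithinAt (extChartAt_source_mem_nhds (I := 𝓘(ℝ, F)) (c t₀))
    obtain ⟨ε₀, hε₀, h⟩ := (nhdsWithin_hasBasis Metric.nhds_basis_closedBall _).mem_iff.mp h1
    exact ⟨ε₀, hε₀, fun t h1 h2 => h ⟨by rwa [Real.closedBall_eq_Icc], h1⟩⟩
  have hJ : ∀ ε > 0, max a (t₀ - ε) < min b (t₀ + ε) ∧
      t₀ ∈ Icc (max a (t₀ - ε)) (min b (t₀ + ε)) := fun ε hε =>
    ⟨max_lt (lt_min hab (by linarith [ht₀.1])) (lt_min (by linarith [ht₀.2]) (by linarith)),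
      max_le ht₀.1 (by linarith), le_min ht₀.2 (by linarith)⟩
  have hJmem : ∀ ε t, t ∈ Icc (max a (t₀ - ε)) (min b (t₀ + ε)) ↔
      t ∈ Icc a b ∧ t ∈ Icc (t₀ - ε) (t₀ + ε) := fun ε t => by
    simp only [mem_Icc, max_le_iff, le_min_iff]
    tauto
  set J₀ := Icc (max a (t₀ - ε₀)) (min b (t₀ + ε₀)) with hJ₀
  have hu : ContDiffOn ℝ ∞ (fun t => φ (c t)) J₀ := by
    have h1 : ContMDiffOn 𝓘(ℝ, ℝ) 𝓘(ℝ, F) ∞ (fun t => φ (c t)) J₀ :=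
      (contMDiffOn_extChartAt (I := 𝓘(ℝ, F)) (x := c t₀)).comp
        (hc.mono fun t ht => ((hJmem _ _).mp ht).1) fun t ht => by
          have := hcφ t ((hJmem _ _).mp ht).1 ((hJmem _ _).mp ht).2
          rwa [extChartAt_source] at this
    exact h1.contDiffOn
  have hu' : ContinuousOn (derivWithin (fun t => φ (c t)) J₀) J₀ :=
    hu.continuousOn_derivWithin (uniqueDiffOn_Icc (hJ ε₀ hε₀).1) (by simp)
  -- The coordinate velocity of `c` is extended by its end values to a continuous function on `ℝ`;
  -- this covers the case where `t₀` is an end point of the interval.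
  set U : ℝ → F := IccExtend (hJ ε₀ hε₀).1.le
    (J₀.domRestrict (derivWithin (fun t => φ (c t)) J₀)) with hU
  have hUc : Continuous U := (continuousOn_iff_continuous_domRestrict.mp hu').Icc_extend'
  have hUu : ∀ t ∈ J₀, HasDerivWithinAt (fun t => φ (c t)) (U t) J₀ t := fun t ht => by
    have h1 : U t = derivWithin (fun t => φ (c t)) J₀ t := IccExtend_of_mem _ _ ht
    rw [h1]
    exact ((hu.differentiableOn (by simp)) t ht).hasDerivWithinAt
  -- The equation lifts the vector with coordinates `U t` placed at `π (γ t)`, not at `c t`. It is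
  -- thus an ordinary differential equation for `γ` alone, and that `γ` lies over `c` is shown
  -- afterwards.
  obtain ⟨ε₁, hε₁, y, hy₀, hy⟩ := exists_hasDerivWithinAt_of_contDiffAt
    ((contDiffAt_chartHLift hπ hm hg₀ (U t₀)).of_le (by simp)) hUc
  obtain ⟨ε₂, hε₂, hyψ⟩ : ∃ ε₂ > 0, ∀ t ∈ Icc (t₀ - ε₂) (t₀ + ε₂), y t ∈ ψ.target ∧
      ((ψ.symm (y t) : G) : G ⧸ K) ∈ φ.source := by
    have h1 : ContinuousAt y t₀ :=
      (hy t₀ ⟨by linarith, by linarith⟩).continuousWithinAt.continuousAt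
        (Icc_mem_nhds (by linarith) (by linarith))
    have h2 : ψ.target ∈ 𝓝 (y t₀) := by
      rw [hy₀]
      exact extChartAt_target_mem_nhds g₀
    have h3 : ContinuousAt (fun t => ((ψ.symm (y t) : G) : G ⧸ K)) t₀ := by
      have h4 : ContinuousAt ψ.symm (y t₀) := by
        rw [hy₀]
        exact continuousAt_extChartAt_symm g₀
      exact (contMDiff_proj_quotient hπ).continuous.continuousAt.comp (h4.comp h1)
    have h4 : φ.source ∈ 𝓝 ((ψ.symm (y t₀) : G) : G ⧸ K) := by
      rw [hy₀, hψ, extChartAt_to_inv, hg₀]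
      exact extChartAt_source_mem_nhds _
    obtain ⟨ε₂, hε₂, h⟩ := Metric.nhds_basis_closedBall.mem_iff.mp (inter_mem (h1 h2) (h3 h4))
    exact ⟨ε₂, hε₂, fun t ht => h (by rwa [Real.closedBall_eq_Icc])⟩
  set ε := min ε₀ (min ε₁ ε₂) with hε
  have hε0 : 0 < ε := lt_min hε₀ (lt_min hε₁ hε₂)
  have hsub : ∀ δ, ε ≤ δ → Icc (t₀ - ε) (t₀ + ε) ⊆ Icc (t₀ - δ) (t₀ + δ) := fun δ h =>
    Icc_subset_Icc (by linarith) (by linarith)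
  have hs0 := hsub ε₀ (min_le_left _ _)
  have hs1 := hsub ε₁ ((min_le_right _ _).trans (min_le_left _ _))
  have hs2 := hsub ε₂ ((min_le_right _ _).trans (min_le_right _ _))
  set γ : ℝ → G := fun t => ψ.symm (y t) with hγ
  set w : ℝ → F := fun t => chartDerivSymm F (c t₀) (γ t : G ⧸ K) (U t) with hw
  have hγd : ∀ t ∈ Icc (t₀ - ε) (t₀ + ε), HasMFDerivWithinAt 𝓘(ℝ, ℝ) 𝓘(ℝ, E) γ
      (Icc (t₀ - ε) (t₀ + ε)) t
      (ContinuousLinearMap.toSpanSingleton ℝ (hLift F K m (γ t) (w t)) : ℝ →L[ℝ] E) := by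
    intro t ht
    have h1 := hasMFDerivWithinAt_extChartAt_symm_comp ((hy t (hs1 ht)).mono hs1)
      (hyψ t (hs2 ht)).1
    have h2 := chartDerivSymm_chartDeriv (ψ.map_target (hyψ t (hs2 ht)).1)
      (hLift F K m (γ t) (w t))
    exact h1.congr_mfderiv (congrArg (fun v : E => ContinuousLinearMap.toSpanSingleton ℝ v) h2)
  have hπγ : ∀ t ∈ Icc (t₀ - ε) (t₀ + ε), HasMFDerivWithinAt 𝓘(ℝ, ℝ) 𝓘(ℝ, F)
      (fun t => (γ t : G ⧸ K)) (Icc (t₀ - ε) (t₀ + ε)) t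
      (ContinuousLinearMap.toSpanSingleton ℝ (w t) : ℝ →L[ℝ] F) := by
    intro t ht
    have h1 := (mdifferentiable_proj_quotient hπ (γ t)).hasMFDerivAt.comp_hasMFDerivWithinAt t
      (hγd t ht)
    refine h1.congr_mfderiv ?_
    have key : ∀ (B : E →L[ℝ] F) (v : E), B ∘L ContinuousLinearMap.toSpanSingleton ℝ v =
      ContinuousLinearMap.toSpanSingleton ℝ (B v) := fun B v => by ext; simp
    exact (key _ _).trans (congrArg (fun v : F => ContinuousLinearMap.toSpanSingleton ℝ v)
      (proj_hLift hπ hm (γ t) (w t)))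
  -- In the chart at `c t₀` both `π ∘ γ` and `c` have velocity `U`, and they agree at `t₀`; their
  -- coordinates therefore coincide.
  have hγc : ∀ t ∈ Icc a b, t ∈ Icc (t₀ - ε) (t₀ + ε) → (γ t : G ⧸ K) = c t := by
    have hd : ∀ t ∈ Icc (max a (t₀ - ε)) (min b (t₀ + ε)),
        HasDerivWithinAt (fun t => φ (γ t) - φ (c t)) 0
          (Icc (max a (t₀ - ε)) (min b (t₀ + ε))) t := by
      intro t ht
      obtain ⟨hta, hte⟩ := (hJmem _ _).mp ht
      have h1 := hasDerivWithinAt_extChartAt_comp (hπγ t hte) (hyψ t (hs2 hte)).2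
      rw [ContinuousLinearMap.toSpanSingleton_apply, one_smul,
        chartDeriv_chartDerivSymm (hyψ t (hs2 hte)).2] at h1
      have h2 := hUu t ((hJmem _ _).mpr ⟨hta, hs0 hte⟩)
      have h3 := (h1.mono fun r hr => ((hJmem _ _).mp hr).2).sub
        (h2.mono fun r hr => (hJmem _ _).mpr ⟨((hJmem _ _).mp hr).1, hs0 ((hJmem _ _).mp hr).2⟩)
      rwa [sub_self] at h3
    intro t hta hte
    have h1 := eq_of_hasDerivWithinAt_zero hd ((hJmem _ _).mpr ⟨hta, hte⟩) (hJ ε hε0).2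
    have h2 : γ t₀ = g₀ := by
      rw [hγ]
      dsimp only
      rw [hy₀]
      exact extChartAt_to_inv _
    rw [h2, hg₀, sub_self, sub_eq_zero] at h1
    exact φ.injOn (hyψ t (hs2 hte)).2 (hcφ t hta (hs0 hte)) h1
  refine ⟨ε, hε0, γ, fun p q hpq hab' hε' t ht => ⟨hγc t (hab' ht) (hε' ht), ?_, ?_⟩⟩
  · exact ((hγd t (hε' ht)).mono hε').mdifferentiableWithinAt
  · have h1 := velocityWithin_eq hpq ht ((hγd t (hε' ht)).mono hε')
    have h2 := velocityWithin_eq hpq ht (((hπγ t (hε' ht)).mono hε').congr_of_eventuallyEq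
      (f₁ := c) (eventually_nhdsWithin_of_forall fun r hr => (hγc r (hab' hr) (hε' hr)).symm)
      (hγc t (hab' ht) (hε' ht)).symm)
    rw [h1, h2]
    simp

end HorizontalLift

/-! ### Parallel transport along piecewise smooth curves -/

section Transport

variable {EGb : Type*} [NormedAddCommGroup EGb] [NormedSpace ℝ EGb]
  {Gb : Type*} [TopologicalSpace Gb] [ChartedSpace EGb Gb] [Group Gb]
  {Hb : Subgroup Gb}
  {FMb : Type*} [NormedAddCommGroup FMb] [NormedSpace ℝ FMb] [FiniteDimensional ℝ FMb]
  [ChartedSpace FMb (Gb ⧸ Hb)]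
  {EG : Type*} [NormedAddCommGroup EG] [NormedSpace ℝ EG]
  {G : Type*} [TopologicalSpace G] [ChartedSpace EG G] [Group G]
  {ι : G →* Gb}
  {FM : Type*} [NormedAddCommGroup FM] [NormedSpace ℝ FM]
  [ChartedSpace FM (G ⧸ Hb.comap ι)] [IsManifold 𝓘(ℝ, FM) ∞ (G ⧸ Hb.comap ι)]
  (hj : Manifold.IsSmoothEmbedding 𝓘(ℝ, FM) 𝓘(ℝ, FMb) ∞ (orbitMap ι Hb))
  [LieGroup 𝓘(ℝ, EGb) ∞ Gb] [IsManifold 𝓘(ℝ, FMb) ∞ (Gb ⧸ Hb)]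
  (hπb : Manifold.IsSubmersion 𝓘(ℝ, EGb) 𝓘(ℝ, FMb) ∞ (fun g : Gb => (g : Gb ⧸ Hb)))
  [LieGroup 𝓘(ℝ, EG) ∞ G] [FiniteDimensional ℝ EG]
  (hι' : Manifold.IsImmersion 𝓘(ℝ, EG) 𝓘(ℝ, EGb) ∞ ι)
  (hπ : Manifold.IsSubmersion 𝓘(ℝ, EG) 𝓘(ℝ, FM) ∞ (fun g : G => (g : G ⧸ Hb.comap ι)))
  {m : Submodule ℝ EG} (hm : IsReductiveDecomposition (E := EG) (Hb.comap ι) m)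
  {c : ℝ → G ⧸ Hb.comap ι}

/-- For the fields along `c` with the property `P`, the value at `p` is arbitrary, and the value
at `q` is the image of the value at `p` under the left translation by `k`. -/
def IsTransportedBy (P : (∀ t : ℝ, AmbientTangent hj (c t)) → Prop) (p q : ℝ) (k : G) : Prop :=
  k • c p = c q ∧
    (∀ v : AmbientTangent hj (c p), ∃ S : ∀ t : ℝ, AmbientTangent hj (c t), P S ∧ S p = v) ∧
    ∀ S : ∀ t : ℝ, AmbientTangent hj (c t), P S → S q = dAct FMb ι k (orbitMap ι Hb (c p)) (S p)

theorem isTransportedBy_one {P : (∀ t : ℝ, AmbientTangent hj (c t)) → Prop} (hP : ∀ S, P S)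
    (p : ℝ) : IsTransportedBy hj P p p 1 := by
  refine ⟨one_smul _ _, fun v => ⟨fun _ => (v : FMb), hP _, rfl⟩, fun S _ => ?_⟩
  rw [dAct_one]
  rfl

include hπb

/-- Transports compose by gluing two fields at `q`. The conditions `hP₁` and `hP₂` express that each
property sees the field only on its own side of `q`, so the glued field keeps both. -/
theorem IsTransportedBy.trans {P P₁ P₂ : (∀ t : ℝ, AmbientTangent hj (c t)) → Prop} {p q r : ℝ}
    {k₁ k₂ : G} (h₁ : IsTransportedBy hj P₁ p q k₁) (h₂ : IsTransportedBy hj P₂ q r k₂)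
    (hP : ∀ S, P S ↔ P₁ S ∧ P₂ S) (hpq : p ≤ q)
    (hP₁ : ∀ S S', (∀ t ≤ q, S' t = S t) → P₁ S → P₁ S')
    (hP₂ : ∀ S S', (∀ t ≥ q, S' t = S t) → P₂ S → P₂ S') :
    IsTransportedBy hj P p r (k₂ * k₁) := by
  refine ⟨by rw [mul_smul, h₁.1, h₂.1], fun v => ?_, fun S hS => ?_⟩
  · obtain ⟨S₁, hS₁, h1⟩ := h₁.2.1 v
    obtain ⟨S₂, hS₂, h2⟩ := h₂.2.1 (S₁ q)
    refine ⟨fun t => if t ≤ q then S₁ t else S₂ t, (hP _).mpr ⟨hP₁ S₁ _ ?_ hS₁, hP₂ S₂ _ ?_ hS₂⟩, ?_⟩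
    · exact fun t ht => if_pos ht
    · intro t ht
      rcases ht.lt_or_eq with h | h
      · exact if_neg h.not_ge
      · subst h
        exact (if_pos le_rfl).trans h2.symm
    · exact (if_pos hpq).trans h1
  · obtain ⟨h1, h2⟩ := (hP S).mp hS
    refine (h₂.2.2 S h2).trans ((congrArg (dAct FMb ι k₂ (orbitMap ι Hb (c q)))
      (h₁.2.2 S h1)).trans ?_)
    exact dAct_dAct hπb _ _ _ _ (by rw [← orbitMap_smul, h₁.1]) _

include hι' hπ hm

/-- Constancy of `(L_γ)_*⁻¹ S` gives `S q = (L_{γ q})_* (L_{γ p})_*⁻¹ (S p)`. Conversely,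
translating a given vector by `γ t * (γ p)⁻¹` defines a parallel field. -/
theorem isTransportedBy_of_lift {γ : ℝ → G} {p q : ℝ} (hpq : p ≤ q)
    (hγ : IsHorizontalLift FM m γ c p q) :
    IsTransportedBy hj (IsParallelOn FMb (canonicalConnection (EG := EG) hj m) c (Icc p q)) p q
      (γ q * (γ p)⁻¹) := by
  have hp : p ∈ Icc p q := left_mem_Icc.mpr hpq
  have hq : q ∈ Icc p q := right_mem_Icc.mpr hpq
  have hmul : ∀ t ∈ Icc p q, (γ t * (γ p)⁻¹) • c p = c t := fun t ht => by
    rw [← (hγ p hp).1, ← (hγ t ht).1, mul_smul, inv_smul_mk, smul_mk_one]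
  have hgo : ∀ t ∈ Icc p q,
      ι (γ t) • orbitMap ι Hb ((1 : G) : G ⧸ Hb.comap ι) = orbitMap ι Hb (c t) := fun t ht => by
    rw [← (hγ t ht).1, smul_orbitMap_one]
  refine ⟨hmul q hq, fun v => ?_, fun S hS => ?_⟩
  · refine ⟨fun t => dAct FMb ι (γ t * (γ p)⁻¹) (orbitMap ι Hb (c p)) v, ?_, ?_⟩
    · refine (isParallelOn_iff_of_lift hj hπb hι' hπ hm hγ _).mpr ?_
      have key : ∀ v : FMb, ∀ t ∈ Icc p q, dAct FMb ι (γ t)⁻¹ (orbitMap ι Hb (c t))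
          (dAct FMb ι (γ t * (γ p)⁻¹) (orbitMap ι Hb (c p)) v) =
          dAct FMb ι (γ p)⁻¹ (orbitMap ι Hb (c p)) v := fun v t ht => by
        rw [dAct_dAct hπb _ _ _ _ (by rw [← orbitMap_smul, hmul t ht]), inv_mul_cancel_left]
      exact fun t ht => (hasDerivWithinAt_const t _ _).congr (key v) (key v t ht)
    · dsimp only
      rw [mul_inv_cancel, dAct_one]
      rfl
  · have h1 := eq_of_hasDerivWithinAt_zero
      ((isParallelOn_iff_of_lift hj hπb hι' hπ hm hγ S).mp hS) hq hp
    have h2 := (dAct_dAct_inv hπb (γ q) _ _ (hgo q hq) (S q)).symm.trans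
      (congrArg (dAct FMb ι (γ q) (orbitMap ι Hb ((1 : G) : G ⧸ Hb.comap ι))) h1)
    refine h2.trans ?_
    exact dAct_dAct hπb _ _ _ _ (by rw [← hgo p hp, map_inv, inv_smul_smul]) _

/-- The parallel transport along a smooth curve is the differential of a left translation. -/
theorem exists_isTransportedBy_Icc {a b : ℝ} (hab : a ≤ b)
    (hc : ContMDiffOn 𝓘(ℝ, ℝ) 𝓘(ℝ, FM) ∞ c (Icc a b)) :
    ∃ k, IsTransportedBy hj
      (IsParallelOn FMb (canonicalConnection (EG := EG) hj m) c (Icc a b)) a b k := by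
  -- On a degenerate interval every field is parallel, since any vector is a derivative within a
  -- single point.
  have hone : ∀ p, IsTransportedBy hj
      (IsParallelOn FMb (canonicalConnection (EG := EG) hj m) c (Icc p p)) p p 1 := fun p =>
    isTransportedBy_one hj (fun S t ht s _ _ =>
      HasFDerivWithinAt.of_subsingleton (by rw [Icc_self]; exact subsingleton_singleton)) p
  rcases hab.eq_or_lt with rfl | hlt
  · exact ⟨1, hone _⟩
  choose ε hε γ hγ using fun t₀ : Icc a b => exists_isHorizontalLift hπ hm hlt hc t₀.2
  -- Compactness gives a subdivision each of whose intervals carries a local lift. The lifts of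
  -- neighbouring intervals need not match, because only the resulting translations are composed.
  obtain ⟨τ, hτ0, hτ, ⟨N, hN⟩, hcov⟩ := exists_monotone_Icc_subset_open_cover_Icc hab
    (c := fun t₀ : Icc a b => Metric.ball t₀ (ε t₀)) (fun _ => Metric.isOpen_ball)
    fun t _ => mem_iUnion.mpr ⟨t, Metric.mem_ball_self (hε t)⟩
  have hstep : ∀ n, ∃ k, IsTransportedBy hj
      (IsParallelOn FMb (canonicalConnection (EG := EG) hj m) c (Icc a (τ n))) a (τ n) k := by
    intro n
    induction n with
    | zero =>
      rw [hτ0]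
      exact ⟨1, hone a⟩
    | succ n ih =>
      obtain ⟨k, hk⟩ := ih
      -- The subdivision is only monotone, so consecutive points may coincide.
      rcases (hτ n.le_succ).eq_or_lt with h | h
      · rw [← h]
        exact ⟨k, hk⟩
      obtain ⟨i, hi⟩ := hcov n
      have h' : (τ n : ℝ) < τ (n + 1) := h
      have hlift := hγ i _ _ h' (Icc_subset_Icc (τ n).2.1 (τ (n + 1)).2.2) fun t ht => by
        have h1 : (⟨t, (τ n).2.1.trans ht.1, ht.2.trans (τ (n + 1)).2.2⟩ : Icc a b) ∈
          Metric.ball i (ε i) := hi ⟨ht.1, ht.2⟩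
        have h2 : t ∈ Metric.closedBall (i : ℝ) (ε i) := Metric.ball_subset_closedBall h1
        rwa [Real.closedBall_eq_Icc] at h2
      have hd : ∀ t ∈ Icc a (τ (n + 1) : ℝ), MDifferentiableWithinAt 𝓘(ℝ, ℝ) 𝓘(ℝ, FM) c
          (Icc a (τ (n + 1))) t := fun t ht =>
        ((hc.mono (Icc_subset_Icc le_rfl (τ (n + 1)).2.2)) t ht).mdifferentiableWithinAt (by simp)
      refine ⟨_, hk.trans hj hπb (isTransportedBy_of_lift hj hπb hι' hπ hm h'.le hlift)
        (fun S => ⟨fun hS => ⟨?_, ?_⟩, fun hS => ?_⟩) (τ n).2.1 ?_ ?_⟩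
      · exact hS.mono_Icc (Icc_subset_Icc le_rfl h'.le) hd
      · exact hS.mono_Icc (Icc_subset_Icc (τ n).2.1 le_rfl) hd
      · exact hS.1.union_Icc (τ n).2.1 h'.le hS.2 hd
      · exact fun S S' hSS' hS => hS.congr fun t ht => hSS' t ht.2
      · exact fun S S' hSS' hS => hS.congr fun t ht => hSS' t ht.1
  have := hstep N
  rwa [hN N le_rfl] at this

/-- The canonical connection is a `G`-connection. -/
theorem isGConnection_canonicalConnection :
    IsGConnection (FM := FM) hj (canonicalConnection (EG := EG) hj m) := by
  intro c n t ht
  -- The induction also carries the order of the division points: gluing at `t n` must leave the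
  -- field unchanged on all earlier intervals, which have to lie to the left of `t n`.
  have h : ∃ k, IsTransportedBy hj (fun S : ∀ r : ℝ, AmbientTangent hj (c r) => ∀ i < n,
      IsParallelOn FMb (canonicalConnection (EG := EG) hj m) c (Icc (t i) (t (i + 1))) S)
      (t 0) (t n) k ∧ t 0 ≤ t n ∧ ∀ i < n, t (i + 1) ≤ t n := by
    induction n with
    | zero => exact ⟨1, isTransportedBy_one hj (fun S i hi => absurd hi (by simp)) _, le_rfl,
        fun i hi => absurd hi (by simp)⟩
    | succ n ih =>
      obtain ⟨k, hk, h0, hle⟩ := ih fun i hi => ht i (hi.trans n.lt_succ_self)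
      obtain ⟨hn, hcn⟩ := ht n n.lt_succ_self
      obtain ⟨k', hk'⟩ := exists_isTransportedBy_Icc hj hπb hι' hπ hm hn hcn
      refine ⟨_, hk.trans hj hπb hk' (fun S => ?_) h0 ?_ ?_, h0.trans hn, fun i hi => ?_⟩
      · exact Nat.forall_lt_succ_right
      · exact fun S S' hSS' hS i hi => (hS i hi).congr fun r hr => hSS' r (hr.2.trans (hle i hi))
      · exact fun S S' hSS' hS => hS.congr fun r hr => hSS' r hr.1
      · rcases Nat.lt_succ_iff_lt_or_eq.mp hi with h | rfl
        · exact (hle i h).trans hn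
        · exact le_rfl
  obtain ⟨k, ⟨hk, hex, huniq⟩, -⟩ := h
  refine ⟨k, hk, fun v => ?_, huniq⟩
  obtain ⟨S, hS, hv⟩ := hex v
  exact ⟨S, hv, hS⟩

end Transport

end

end ReductiveOrbit

theorem proposition2p2
    -- the Lie group `Gb`, a closed subgroup `Hb`, and the homogeneous manifold `Gb ⧸ Hb`
    {EGb : Type*} [NormedAddCommGroup EGb] [NormedSpace ℝ EGb] [FiniteDimensional ℝ EGb]
    {Gb : Type*} [TopologicalSpace Gb] [ChartedSpace EGb Gb] [Group Gb] [LieGroup 𝓘(ℝ, EGb) ∞ Gb]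
    (Hb : Subgroup Gb) (hHb : IsClosed (Hb : Set Gb))
    {FMb : Type*} [NormedAddCommGroup FMb] [NormedSpace ℝ FMb] [FiniteDimensional ℝ FMb]
    [ChartedSpace FMb (Gb ⧸ Hb)] [IsManifold 𝓘(ℝ, FMb) ∞ (Gb ⧸ Hb)]
    (hπb : Manifold.IsSubmersion 𝓘(ℝ, EGb) 𝓘(ℝ, FMb) ∞ (fun g : Gb => (g : Gb ⧸ Hb)))
    -- the Lie subgroup `ι : G → Gb`, and the homogeneous manifold `M = G ⧸ H`, `H = G ∩ Hb`
    {EG : Type*} [NormedAddCommGroup EG] [NormedSpace ℝ EG] [FiniteDimensional ℝ EG]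
    {G : Type*} [TopologicalSpace G] [ChartedSpace EG G] [Group G] [LieGroup 𝓘(ℝ, EG) ∞ G]
    (ι : G →* Gb) (hι : Function.Injective ι)
    (hι' : Manifold.IsImmersion 𝓘(ℝ, EG) 𝓘(ℝ, EGb) ∞ ι)
    {FM : Type*} [NormedAddCommGroup FM] [NormedSpace ℝ FM] [FiniteDimensional ℝ FM]
    [ChartedSpace FM (G ⧸ Hb.comap ι)] [IsManifold 𝓘(ℝ, FM) ∞ (G ⧸ Hb.comap ι)]
    (hπ : Manifold.IsSubmersion 𝓘(ℝ, EG) 𝓘(ℝ, FM) ∞ (fun g : G => (g : G ⧸ Hb.comap ι)))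
    -- `M` is a closed submanifold of `Gb ⧸ Hb`, as the orbit of the base point
    (hj : Manifold.IsSmoothEmbedding 𝓘(ℝ, FM) 𝓘(ℝ, FMb) ∞ (orbitMap ι Hb))
    (hM : IsClosed (Set.range (orbitMap ι Hb)))
    -- a reductive decomposition of the Lie algebra of `G`
    (m : Submodule ℝ (GroupLieAlgebra 𝓘(ℝ, EG) G))
    (hm : IsReductiveDecomposition (Hb.comap ι) m) :
    -- the left-invariant distribution defined by `m` is a principal connection on `G → G ⧸ H`
    IsPrincipalConnection FM (Hb.comap ι) (leftInvariantDistribution m) ∧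
    -- the associated bundle `G ×_H T_o(Gb ⧸ Hb)` is identified with `T(Gb ⧸ Hb)|_M`
    (ContMDiff (𝓘(ℝ, EG).prod 𝓘(ℝ, FMb)) (𝓘(ℝ, FM).prod 𝓘(ℝ, FMb)) ∞ (frameMap hj) ∧
      ∃ Φ : AssociatedBundle hj ≃ TotalSpace FMb (AmbientTangent hj),
        ∀ (g : G) (v : FMb), Φ (Quot.mk _ (g, v)) = frameMap hj (g, v)) ∧
    -- the canonical connection `D` is a smooth linear connection on `T(Gb ⧸ Hb)|_M` ...
    IsCovariantDerivativeOn FMb (canonicalConnection hj m) Set.univ ∧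
    ContMDiffCovariantDerivativeOn FMb ∞ (canonicalConnection hj m) Set.univ ∧
    -- ... which can be computed at every point of the principal bundle, ...
    (∀ (s : ∀ x : G ⧸ Hb.comap ι, AmbientTangent hj x) (g : G),
      MDifferentiableAt 𝓘(ℝ, FM) (𝓘(ℝ, FM).prod 𝓘(ℝ, FMb))
        (fun x => (⟨x, s x⟩ : TotalSpace FMb (AmbientTangent hj))) (g : G ⧸ Hb.comap ι) →
      canonicalConnection hj m s (g : G ⧸ Hb.comap ι) =
        inducedDerivAt hj (leftInvariantDistribution m) s g) ∧
    -- ... is a `G`-connection, ...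
    IsGConnection hj (canonicalConnection hj m) ∧
    -- ... satisfies `(D_{X*} B*)_o = -[X, B]*_o`, ...
    (∀ X ∈ m, ∀ B : GroupLieAlgebra 𝓘(ℝ, EGb) Gb,
      canonicalConnection hj m (restrictedField hj B) ((1 : G) : G ⧸ Hb.comap ι)
          (fundamentalField FM X ((1 : G) : G ⧸ Hb.comap ι)) =
        -restrictedField hj ⁅(lieInclusion ι X : GroupLieAlgebra 𝓘(ℝ, EGb) Gb), B⁆
          ((1 : G) : G ⧸ Hb.comap ι)) ∧
    -- ... and is determined at `o` by this condition among all linear connections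
    ∀ D' : CovariantDerivative 𝓘(ℝ, FM) FMb (AmbientTangent hj),
      (∀ X ∈ m, ∀ B : GroupLieAlgebra 𝓘(ℝ, EGb) Gb,
        D' (restrictedField hj B) ((1 : G) : G ⧸ Hb.comap ι)
            (fundamentalField FM X ((1 : G) : G ⧸ Hb.comap ι)) =
          -restrictedField hj ⁅(lieInclusion ι X : GroupLieAlgebra 𝓘(ℝ, EGb) Gb), B⁆
            ((1 : G) : G ⧸ Hb.comap ι)) →
      ∀ s : ∀ x : G ⧸ Hb.comap ι, AmbientTangent hj x,
        MDifferentiableAt 𝓘(ℝ, FM) (𝓘(ℝ, FM).prod 𝓘(ℝ, FMb))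
          (fun x => (⟨x, s x⟩ : TotalSpace FMb (AmbientTangent hj)))
          ((1 : G) : G ⧸ Hb.comap ι) →
        D' s ((1 : G) : G ⧸ Hb.comap ι) =
          canonicalConnection hj m s ((1 : G) : G ⧸ Hb.comap ι) := by
  exact ⟨isPrincipalConnection_leftInvariantDistribution hπ hm,
    ⟨contMDiff_frameMap hj hπb hι' hπ, exists_equiv_associatedBundle hj hπb⟩,
    isCovariantDerivativeOn_canonicalConnection hj hπb hι' hπ hm,
    contMDiffCovariantDerivativeOn_canonicalConnection hj hπb hι' hπ hm,
    fun s g hs => canonicalConnection_eq_inducedDerivAt hj hπb hι' hπ hm hs,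
    isGConnection_canonicalConnection hj hπb hι' hπ hm,
    fun X hX B => canonicalConnection_restrictedField hj hπb hι' hπ hm X hX B,
    fun D' h s hs => eq_canonicalConnection_of_restrictedField hj hπb hι' hπ hm D' h s hs⟩
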